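/- Let $\Omega\subset\mathbb R^3$ be a compact convex set with non-empty interior whose boundary $\Sigma=\partial\Omega$ is a smoothly embedded $2$-sphere. Let $f$ be a $C^2$ function on an open neighbourhood of $\Omega$ that is positive on $\Omega$ and constant on $\Sigma$, $f|_\Sigma=f(\sigma_0)$. Let $g=f^4\delta$ be the conformally flat metric ($\delta$ the Euclidean metric), let $\rho:\Omega\to\mathbb R$ satisfy the Hamiltonian constraint $\hat\Delta f=-2\pi\rho f^5$ on $\Omega$, where $\hat\Delta$ is the Euclidean Laplacian, and put $M(\Sigma)=\int_\Omega\rho\,\mathrm{dvol}_g$. A Weyl embedding of $\Sigma$ is a smooth isometric embedding $i$ of $\Sigma$, with the metric induced by $g$, into Euclidean $\mathbb R^3$ whose image bounds a compact convex body. The Brown--York mass of $\Sigma$ is $$\mathfrak m_{\rm BY}(\Sigma,g)=\frac1{8\pi}\int_\Sigma(k_0-k)\,d\Sigma,$$ where $k$ is the mean curvature (the divergence of the outward unit normal) of $\Sigma$ with respect to $g$, $k_0$ is the Euclidean mean curvature of $i(\Sigma)$ for a Weyl embedding $i$, and $d\Sigma$ is the area element induced by $g$. Then a Weyl embedding of $\Sigma$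 exists, and for every Weyl embedding $$\mathfrak m_{\rm BY}(\Sigma,g)=\int_\Omega\rho\,\frac{f(\sigma_0)}{f}\,\mathrm{dvol}_g .$$ If moreover $\rho\ge0$ on $\Omega$, then $\mathfrak m_{\rm BY}(\Sigma,g)\le M(\Sigma)$. -/

import Mathlib

open MeasureTheory Set Filter Topology
open scoped Manifold ContDiff InnerProductSpace

noncomputable section

namespace ConformalBrownYork

/-- Euclidean three-space. -/
abbrev E3 := EuclideanSpace ℝ (Fin 3)

/-- The round unit two-sphere, used as parameter domain of surfaces that are topological spheres. -/
abbrev S2 := Metric.sphere (0 : E3) 1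

/-- A field of bilinear forms on three-space; on a set where its values are symmetric and positive
definite it is a Riemannian metric written in Cartesian coordinates. -/
abbrev MetricField := E3 → E3 →L[ℝ] E3 →L[ℝ] ℝ

/-- The Euclidean metric `δ`. -/
def flatMetric : MetricField := fun _ => innerSL ℝ

/-- The conformally flat metric `f ^ 4 δ`. -/
def conformalMetric (f : E3 → ℝ) : MetricField := fun x => (f x) ^ 4 • innerSL ℝ

theorem flatMetric_apply (x u v : E3) : flatMetric x u v = ⟪u, v⟫_ℝ := rfl

theorem conformalMetric_apply (f : E3 → ℝ) (x u v : E3) :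
    conformalMetric f x u v = (f x) ^ 4 * ⟪u, v⟫_ℝ := rfl

/-- The density `√(det g)` of the Riemannian volume `dvol_g` with respect to Lebesgue measure. -/
def volumeDensity (g : MetricField) (x : E3) : ℝ :=
  √(Matrix.det (Matrix.of fun i j : Fin 3 =>
    g x (EuclideanSpace.single i 1) (EuclideanSpace.single j 1)))

/-- The integral `∫_Ω φ dvol_g`. -/
def volumeIntegral (g : MetricField) (Ω : Set E3) (φ : E3 → ℝ) : ℝ :=
  ∫ x in Ω, φ x * volumeDensity g x

/-- The total rest mass `∫_Ω ρ dvol_g`. -/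
def totalRestMass (g : MetricField) (Ω : Set E3) (ρ : E3 → ℝ) : ℝ :=
  volumeIntegral g Ω ρ

/-- The partial derivative at `y`, along the `i`-th vector of a basis of the tangent plane of the
sphere, of a vector-valued function on the sphere. -/
def partialDeriv (X : S2 → E3) (y : S2) (i : Fin 2) : E3 :=
  mvfderiv (𝓡 2) X y (EuclideanSpace.single i (1 : ℝ) : EuclideanSpace ℝ (Fin 2))

/-- The first fundamental form of the parametrized surface `X` that is induced by `g`. -/
def firstForm (g : MetricField) (X : S2 → E3) (y : S2) : Matrix (Fin 2) (Fin 2) ℝ :=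
  Matrix.of fun i j => g (X y) (partialDeriv X y i) (partialDeriv X y j)

/-- The area element `dΣ` of the surface `X` for the metric induced by `g`, as a density with
respect to the area of the round sphere. -/
def areaDensity (g : MetricField) (X : S2 → E3) (y : S2) : ℝ :=
  √(firstForm g X y).det / √(firstForm flatMetric (fun z : S2 => (z : E3)) y).det

/-- The integral `∫_Σ φ dΣ` over the surface `Σ` parametrized by `X`, where `φ` is written as a
function of the parameter and `dΣ` is the area element induced by `g`. -/
def surfaceIntegral (g : MetricField) (X : S2 → E3) (φ : S2 → ℝ) : ℝ :=
  ∫ y, φ y * areaDensity g X y ∂(volume : Measure E3).toSphere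

/-- `X` parametrizes, by a smooth embedding of the two-sphere, the boundary of the compact convex
domain `Ω`. -/
structure IsConvexSphere (Ω : Set E3) (X : S2 → E3) : Prop where
  isCompact : IsCompact Ω
  convex : Convex ℝ Ω
  interior_nonempty : (interior Ω).Nonempty
  smooth : ContMDiff (𝓡 2) 𝓘(ℝ, E3) ∞ X
  injective : Function.Injective X
  immersion : ∀ y, Function.Injective (mvfderiv (𝓡 2) X y)
  range_eq : range X = frontier Ω

/-- `v` is the outward unit normal, with respect to `g`, at the point `X y` of the boundary
of `Ω`. -/
def IsOutwardUnitNormal (g : MetricField) (Ω : Set E3) (X : S2 → E3) (y : S2) (v : E3) : Prop :=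
  (∀ i, g (X y) v (partialDeriv X y i) = 0) ∧ g (X y) v v = 1 ∧
    ∀ᶠ t : ℝ in 𝓝[>] 0, X y + t • v ∉ Ω

/-- The outward unit normal field, with respect to `g`, along the boundary of `Ω`. -/
def outwardNormal (g : MetricField) (Ω : Set E3) (X : S2 → E3) (y : S2) : E3 :=
  Classical.epsilon (IsOutwardUnitNormal g Ω X y)

/-- The value `g (Γ(u, v), w)` at `x` of the Christoffel symbols of the Levi-Civita connection
of `g`. -/
def christoffel (g : MetricField) (x u v w : E3) : ℝ :=
  (fderiv ℝ g x u v w + fderiv ℝ g x v u w - fderiv ℝ g x w u v) / 2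

/-- The second fundamental form `g (∇_i n, ∂_j X)` of the boundary of `Ω` for the outward unit
normal `n`. -/
def secondForm (g : MetricField) (Ω : Set E3) (X : S2 → E3) (y : S2) :
    Matrix (Fin 2) (Fin 2) ℝ :=
  Matrix.of fun i j =>
    g (X y) (partialDeriv (outwardNormal g Ω X) y i) (partialDeriv X y j) +
      christoffel g (X y) (partialDeriv X y i) (outwardNormal g Ω X y) (partialDeriv X y j)

/-- The mean curvature with respect to `g` of the boundary of `Ω`: the divergence of the outward
unit normal, that is, the trace of the second fundamental form (`2 / r` for a Euclidean sphere of
radius `r`). -/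
def meanCurvature (g : MetricField) (Ω : Set E3) (X : S2 → E3) (y : S2) : ℝ :=
  ((firstForm g X y)⁻¹ * secondForm g Ω X y).trace

/-- `Y = i ∘ X` for a Weyl embedding `i` of the surface `Σ` parametrized by `X`, with the metric
induced by `g`: an isometric embedding of `Σ` into Euclidean space as the boundary of a convex
body `Ω₀`. -/
structure IsWeylEmbedding (g : MetricField) (X : S2 → E3) (Ω₀ : Set E3) (Y : S2 → E3) :
    Prop where
  isConvexSphere : IsConvexSphere Ω₀ Y
  isometric : ∀ y, firstForm flatMetric Y y = firstForm g X y

/-- The expression `(1 / 8π) ∫_Σ (k₀ - k) dΣ`, where `k` is the mean curvature of `Σ = ∂Ω` with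
respect to `g` and `k₀` is the Euclidean mean curvature of the Weyl embedding `Y` of `Σ` as the
boundary of `Ω₀`. -/
def brownYorkMass (g : MetricField) (Ω : Set E3) (X : S2 → E3) (Ω₀ : Set E3) (Y : S2 → E3) : ℝ :=
  1 / (8 * Real.pi) *
    surfaceIntegral g X (fun y => meanCurvature flatMetric Ω₀ Y y - meanCurvature g Ω X y)

end ConformalBrownYork

end

open ConformalBrownYork

/-!
The metric `f⁴ δ` restricts to the level surface `Σ` of `f` as `f₀⁴` times the Euclidean induced
metric, so the homothetic surface `f₀² Σ` is a Weyl embedding. Every other Weyl embedding is a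
convex surface isometric to `f₀² Σ`, and isometric convex surfaces have the same total mean
curvature (`integral_meanCurvatureDensity_eq`). Hence `∫ k₀ dΣ` is `f₀²` times the total Euclidean
mean curvature `∫ κ` of `Σ`. The conformal change of the mean curvature
(`meanCurvature_conformal_mul`) reads `k dΣ = f₀² κ + 4 f₀ ∂_ν f dA`, so the curvature terms cancel
and the Brown–York mass is `-(f₀ / 2π) ∫_Σ ∂_ν f dA`. By the divergence theorem
(`integral_divergence`) the flux is `∫_Ω Δf`, which the constraint turns into
`∫_Ω ρ (f₀ / f) f⁶ dx`, where `f⁶ dx` is the Riemannian volume. If `ρ ≥ 0`, then `f` is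
superharmonic and the minimum principle (`le_of_laplacian_nonpos`) gives `f₀ ≤ f`, whence the
inequality.

The equality of total mean curvatures is Herglotz's argument in the form of a rotation field. For
isometric convex surfaces `X`, `Y` there is a field `R` of orthogonal maps on the sphere that
carries the differential and the normal of `X` to those of `Y`, with angular velocity `η`, that is,
`dR = R (η × ·)`. Symmetry of second derivatives makes `η` tangent to `X`
(`inner_normal_angularVelocity`), and the difference of the two shape operators, identified by `R`,
is `η × ν`. The integrability condition of `R` (`structure_equation`), contracted with `ν`, says
that the two surfaces have the same Gauss curvature. With `P` the position vector relative to an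
interior point, the exterior derivative of the one-form `2 ⟪P, η⟫` integrates to zero, and up to
this exact form the difference of the mean curvature densities is `⟪P, ν⟫ dA` times minus the
determinant of the difference of the shape operators. Convexity makes `⟪P, ν⟫` positive and makes
that determinant nonpositive, because the difference of two nonnegative forms of equal determinant
is indefinite (`det_sub_nonpos`). So the total mean curvature of `X` is at most that of `Y`, and by
symmetry the two agree.

Functions and maps on the sphere are handled through their radially constant extensions to
three-space (`RadialSmooth`). Stokes' theorem for exact forms `da ∧ db` on the sphere
(`integral_wedge_fderiv`) is then an integration by parts in space against a radial cutoff
function. The divergence theorem follows from it by parametrizing the body as a cone over its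
boundary: the flux through the dilated boundary surfaces has as derivative the divergence term plus
an exact form on the sphere (`flux_identity`).
-/


noncomputable section

namespace ConformalBrownYork

/-! ### Vector algebra in three-space -/

theorem inner_eq_sum_three (a b : E3) : ⟪a, b⟫_ℝ = a 0 * b 0 + a 1 * b 1 + a 2 * b 2 := by
  simp [PiLp.inner_apply, Fin.sum_univ_three]; ring

/-- The cross product of Euclidean three-space. -/
def cross (a b : E3) : E3 :=
  !₂[a 1 * b 2 - a 2 * b 1, a 2 * b 0 - a 0 * b 2, a 0 * b 1 - a 1 * b 0]

@[simp] theorem cross_zero_coord (a b : E3) : cross a b 0 = a 1 * b 2 - a 2 * b 1 := rfl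
@[simp] theorem cross_one_coord (a b : E3) : cross a b 1 = a 2 * b 0 - a 0 * b 2 := rfl
@[simp] theorem cross_two_coord (a b : E3) : cross a b 2 = a 0 * b 1 - a 1 * b 0 := rfl

/-- The determinant of three vectors. -/
def det3 (a b c : E3) : ℝ := ⟪a, cross b c⟫_ℝ

theorem det3_eq (a b c : E3) : det3 a b c = a 0 * (b 1 * c 2 - b 2 * c 1) +
    a 1 * (b 2 * c 0 - b 0 * c 2) + a 2 * (b 0 * c 1 - b 1 * c 0) := by
  simp [det3, inner_eq_sum_three]

/-- The standard basis vectors. -/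
abbrev e3 (i : Fin 3) : E3 := EuclideanSpace.single i (1 : ℝ)

theorem eq_sum_e3 (a : E3) : a = a 0 • e3 0 + a 1 • e3 1 + a 2 • e3 2 := by
  ext i; fin_cases i <;> simp

theorem map_eq_sum_e3 {V : Type*} [NormedAddCommGroup V] [NormedSpace ℝ V] (A : E3 →L[ℝ] V)
    (a : E3) : A a = a 0 • A (e3 0) + a 1 • A (e3 1) + a 2 • A (e3 2) := by
  conv_lhs => rw [eq_sum_e3 a]
  simp only [map_add, map_smul]

theorem E3_ext {a b : E3} (h0 : a 0 = b 0) (h1 : a 1 = b 1) (h2 : a 2 = b 2) : a = b := by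
  ext i; fin_cases i <;> assumption

/-- Cross multiplication by `a` as a continuous bilinear map. -/
def crossL : E3 →L[ℝ] E3 →L[ℝ] E3 :=
  LinearMap.toContinuousLinearMap
    ((LinearMap.toContinuousLinearMap : (E3 →ₗ[ℝ] E3) ≃ₗ[ℝ] (E3 →L[ℝ] E3)).toLinearMap ∘ₗ
      LinearMap.mk₂ ℝ cross
        (fun a b c => by apply E3_ext <;> simp <;> ring)
        (fun a b c => by apply E3_ext <;> simp <;> ring)
        (fun a b c => by apply E3_ext <;> simp <;> ring)
        (fun a b c => by apply E3_ext <;> simp <;> ring))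

@[simp] theorem crossL_apply (a b : E3) : crossL a b = cross a b := rfl

theorem inner_cross_cross (a b c d : E3) :
    ⟪cross a b, cross c d⟫_ℝ = ⟪a, c⟫_ℝ * ⟪b, d⟫_ℝ - ⟪a, d⟫_ℝ * ⟪b, c⟫_ℝ := by
  simp only [inner_eq_sum_three, cross_zero_coord, cross_one_coord, cross_two_coord]; ring

theorem cross_cross (a b c : E3) : cross a (cross b c) = ⟪a, c⟫_ℝ • b - ⟪a, b⟫_ℝ • c := by
  apply E3_ext <;> simp [inner_eq_sum_three] <;> ring

/-- A vector orthogonal to two vectors is parallel to their cross product. -/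
theorem smul_eq_smul_cross {m a b : E3} (ha : ⟪m, a⟫_ℝ = 0) (hb : ⟪m, b⟫_ℝ = 0) :
    ‖cross a b‖ ^ 2 • m = ⟪m, cross a b⟫_ℝ • cross a b := by
  have h : cross (cross a b) (cross m (cross a b)) = 0 := by
    rw [cross_cross m, ha, hb]
    apply E3_ext <;> simp
  rw [cross_cross, real_inner_self_eq_norm_sq, real_inner_comm, sub_eq_zero] at h
  exact h

theorem cross_ne_zero_of_linearIndependent {a b : E3}
    (h : ∀ s t : ℝ, s • a + t • b = 0 → s = 0 ∧ t = 0) : cross a b ≠ 0 := by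
  intro h0
  have hg : ⟪a, a⟫_ℝ * ⟪b, b⟫_ℝ - ⟪a, b⟫_ℝ * ⟪b, a⟫_ℝ = 0 := by
    rw [← inner_cross_cross, h0, inner_zero_left]
  have h1 := h (⟪b, b⟫_ℝ) (-⟪a, b⟫_ℝ) (by
    rw [← inner_self_eq_zero (𝕜 := ℝ)]
    simp only [inner_add_left, inner_add_right, inner_smul_left, inner_smul_right,
      RCLike.conj_to_real, real_inner_comm a b] at hg ⊢
    linear_combination ⟪b, b⟫_ℝ * hg)
  have hb : b = 0 := inner_self_eq_zero.1 h1.1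
  have := (h 0 1 (by simp [hb])).2
  exact one_ne_zero this

/-- The trace of a linear map expanded on a triple of vectors. -/
theorem trace_mul_det3 (A : E3 →L[ℝ] E3) (a b c : E3) :
    (A (e3 0) 0 + A (e3 1) 1 + A (e3 2) 2) * det3 a b c =
      det3 (A a) b c + det3 a (A b) c + det3 a b (A c) := by
  rw [map_eq_sum_e3 A a, map_eq_sum_e3 A b, map_eq_sum_e3 A c]
  simp only [det3_eq, PiLp.add_apply, PiLp.smul_apply, smul_eq_mul]
  ring

/-! ### The area form of the sphere -/

/-- `y · (α × β)` for linear forms `α`, `β`; for a unit vector `y` and forms killing `y` this is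
the wedge product `α ∧ β` divided by the area form of the unit sphere at `y`. -/
def wedge (y : E3) (α β : E3 →L[ℝ] ℝ) : ℝ :=
  y 0 * (α (e3 1) * β (e3 2) - α (e3 2) * β (e3 1)) +
  y 1 * (α (e3 2) * β (e3 0) - α (e3 0) * β (e3 2)) +
  y 2 * (α (e3 0) * β (e3 1) - α (e3 1) * β (e3 0))

/-- On forms that kill the unit vector `y`, the wedge product is `wedge` times the area form
`det3 y`. -/
theorem wedge_apply {y : E3} (hy : ‖y‖ = 1) {α β : E3 →L[ℝ] ℝ} (hα : α y = 0) (hβ : β y = 0)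
    (u v : E3) : α u * β v - α v * β u = det3 y u v * wedge y α β := by
  have hy' : y 0 * y 0 + y 1 * y 1 + y 2 * y 2 = 1 := by
    rw [← inner_eq_sum_three, real_inner_self_eq_norm_sq, hy]; norm_num
  rw [map_eq_sum_e3 α u, map_eq_sum_e3 α v, map_eq_sum_e3 β u, map_eq_sum_e3 β v]
  rw [map_eq_sum_e3 α y] at hα
  rw [map_eq_sum_e3 β y] at hβ
  simp only [smul_eq_mul] at *
  unfold wedge
  rw [det3_eq]
  generalize α (e3 0) = a0 at *
  generalize α (e3 1) = a1 at *
  generalize α (e3 2) = a2 at *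
  generalize β (e3 0) = b0 at *
  generalize β (e3 1) = b1 at *
  generalize β (e3 2) = b2 at *
  -- `γ = α × β` satisfies `|y|² γ - (y · γ) y = y × (γ × y)` and `γ × y = (α y) β - (β y) α`
  have k0 : a1 * b2 - a2 * b1 = y 0 * (y 0 * (a1 * b2 - a2 * b1) + y 1 * (a2 * b0 - a0 * b2) +
      y 2 * (a0 * b1 - a1 * b0)) := by
    linear_combination -(a1 * b2 - a2 * b1) * hy' + (y 1 * b2 - y 2 * b1) * hα -
      (y 1 * a2 - y 2 * a1) * hβ
  have k1 : a2 * b0 - a0 * b2 = y 1 * (y 0 * (a1 * b2 - a2 * b1) + y 1 * (a2 * b0 - a0 * b2) +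
      y 2 * (a0 * b1 - a1 * b0)) := by
    linear_combination -(a2 * b0 - a0 * b2) * hy' + (y 2 * b0 - y 0 * b2) * hα -
      (y 2 * a0 - y 0 * a2) * hβ
  have k2 : a0 * b1 - a1 * b0 = y 2 * (y 0 * (a1 * b2 - a2 * b1) + y 1 * (a2 * b0 - a0 * b2) +
      y 2 * (a0 * b1 - a1 * b0)) := by
    linear_combination -(a0 * b1 - a1 * b0) * hy' + (y 0 * b1 - y 1 * b0) * hα -
      (y 0 * a1 - y 1 * a0) * hβ
  linear_combination (u 1 * v 2 - u 2 * v 1) * k0 + (u 2 * v 0 - u 0 * v 2) * k1 +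
    (u 0 * v 1 - u 1 * v 0) * k2

/-- The `i`-th coordinate of a vector-valued linear map. -/
def coordForm (A : E3 →L[ℝ] E3) (i : Fin 3) : E3 →L[ℝ] ℝ := (EuclideanSpace.proj i).comp A

@[simp] theorem coordForm_apply (A : E3 →L[ℝ] E3) (i : Fin 3) (v : E3) :
    coordForm A i v = A v i := rfl

/-- The wedge product of vector-valued forms, contracted with the inner product. -/
def wedgeInner (y : E3) (A B : E3 →L[ℝ] E3) : ℝ := ∑ i, wedge y (coordForm A i) (coordForm B i)

theorem wedgeInner_apply {y : E3} (hy : ‖y‖ = 1) {A B : E3 →L[ℝ] E3} (hA : A y = 0)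
    (hB : B y = 0) (u v : E3) :
    ⟪A u, B v⟫_ℝ - ⟪A v, B u⟫_ℝ = det3 y u v * wedgeInner y A B := by
  unfold wedgeInner
  rw [Finset.mul_sum, Fin.sum_univ_three]
  rw [← wedge_apply hy (by simp [hA]) (by simp [hB]),
    ← wedge_apply hy (by simp [hA]) (by simp [hB]),
    ← wedge_apply hy (by simp [hA]) (by simp [hB])]
  simp only [inner_eq_sum_three, coordForm_apply]; ring

/-- The vector `L u × L v` for positively oriented orthonormal `u, v` in the plane orthogonal
to `y`. -/
def conormal (y : E3) (A : E3 →L[ℝ] E3) : E3 :=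
  !₂[wedge y (coordForm A 1) (coordForm A 2), wedge y (coordForm A 2) (coordForm A 0),
    wedge y (coordForm A 0) (coordForm A 1)]

@[simp] theorem conormal_zero_coord (y : E3) (A : E3 →L[ℝ] E3) :
    conormal y A 0 = wedge y (coordForm A 1) (coordForm A 2) := rfl
@[simp] theorem conormal_one_coord (y : E3) (A : E3 →L[ℝ] E3) :
    conormal y A 1 = wedge y (coordForm A 2) (coordForm A 0) := rfl
@[simp] theorem conormal_two_coord (y : E3) (A : E3 →L[ℝ] E3) :
    conormal y A 2 = wedge y (coordForm A 0) (coordForm A 1) := rfl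

theorem cross_map_map {y : E3} (hy : ‖y‖ = 1) {A : E3 →L[ℝ] E3} (hA : A y = 0) (u v : E3) :
    cross (A u) (A v) = det3 y u v • conormal y A := by
  apply E3_ext
  · simp [← wedge_apply hy (α := coordForm A 1) (β := coordForm A 2) (by simp [hA]) (by simp [hA])]
    ring
  · simp [← wedge_apply hy (α := coordForm A 2) (β := coordForm A 0) (by simp [hA]) (by simp [hA])]
    ring
  · simp [← wedge_apply hy (α := coordForm A 0) (β := coordForm A 1) (by simp [hA]) (by simp [hA])]
    ring

/-! ### Radially constant extensions -/

/-- The radial projection onto the unit sphere (with an arbitrary value at the origin). -/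
def radialProj (x : E3) : S2 :=
  if h : x = 0 then ⟨e3 0, by simp⟩ else ⟨‖x‖⁻¹ • x, by simp [norm_smul, h]⟩

theorem coe_radialProj {x : E3} (h : x ≠ 0) : (radialProj x : E3) = ‖x‖⁻¹ • x := by
  simp [radialProj, h]

theorem radialProj_coe (y : S2) : radialProj (y : E3) = y := by
  have : (y : E3) ≠ 0 := ne_zero_of_mem_unit_sphere y
  apply Subtype.ext
  rw [coe_radialProj this]; simp

theorem radialProj_smul {c : ℝ} (hc : 0 < c) (x : E3) : radialProj (c • x) = radialProj x := by
  by_cases h : x = 0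
  · simp [h]
  · apply Subtype.ext
    have : c • x ≠ 0 := by simp [hc.ne', h]
    rw [coe_radialProj h, coe_radialProj this, norm_smul, smul_smul, Real.norm_of_nonneg hc.le]
    congr 1
    have : ‖x‖ ≠ 0 := by simpa using h
    field_simp

theorem contDiffOn_coe_radialProj {k : ℕ∞ω} :
    ContDiffOn ℝ k (fun x => (radialProj x : E3)) {0}ᶜ := by
  have : ContDiffOn ℝ k (fun x : E3 => ‖x‖⁻¹ • x) {0}ᶜ := by
    intro x hx
    have hx' : x ≠ 0 := hx
    refine ContDiffAt.contDiffWithinAt ?_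
    exact ((contDiffAt_norm ℝ hx').inv (by simpa using hx')).smul contDiffAt_id
  exact this.congr fun x hx => coe_radialProj hx

theorem continuousOn_radialProj : ContinuousOn radialProj {0}ᶜ := by
  rw [Topology.IsInducing.subtypeVal.continuousOn_iff]
  exact (contDiffOn_coe_radialProj (k := 0)).continuousOn

theorem fact_finrank_E3 : Fact (Module.finrank ℝ E3 = 2 + 1) := ⟨finrank_euclideanSpace_fin⟩

/-- The radial projection is smooth as a map into the sphere. -/
theorem contMDiffAt_radialProj {x : E3} (hx : x ≠ 0) :
    ContMDiffAt 𝓘(ℝ, E3) (𝓡 2) ∞ radialProj x := by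
  have := fact_finrank_E3
  rw [contMDiffAt_iff_target]
  refine ⟨continuousOn_radialProj.continuousAt (isOpen_compl_singleton.mem_nhds hx), ?_⟩
  set v : S2 := radialProj x
  let U : _ ≃ₗᵢ[ℝ] _ :=
    (OrthonormalBasis.fromOrthogonalSpanSingleton (𝕜 := ℝ)
        2 (ne_zero_of_mem_unit_sphere (-v))).repr
  have hop : IsOpen {z : E3 | innerSL ℝ ((-v : S2) : E3) z ≠ (1 : ℝ)} :=
    isOpen_ne_fun (by fun_prop) continuous_const
  have h1 : ContDiffAt ℝ ∞ (stereoToFun ((-v : S2) : E3)) (radialProj x : E3) := by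
    refine (contDiffOn_stereoToFun (v := ((-v : S2) : E3))).contDiffAt (hop.mem_nhds ?_)
    simp only [mem_ofPred_eq]
    change innerSL ℝ ((-v : S2) : E3) (v : E3) ≠ 1
    simp [innerSL_apply_apply]
    norm_num
  have h2 := (U.contDiff.contDiffAt (n := ∞)).comp _ (h1.comp x
    ((contDiffOn_coe_radialProj (k := ∞)).contDiffAt (isOpen_compl_singleton.mem_nhds hx)))
  exact h2.contMDiffAt

section RadialSmooth

variable {V : Type*} [NormedAddCommGroup V] [NormedSpace ℝ V]

/-- A map on three-space that is constant on open rays from the origin and `C^k` away from the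
origin. Maps on the unit sphere are studied through their extensions of this kind. -/
structure RadialSmooth (k : ℕ∞ω) (F : E3 → V) : Prop where
  contDiffOn : ContDiffOn ℝ k F {0}ᶜ
  map_smul : ∀ c : ℝ, 0 < c → ∀ x, F (c • x) = F x

theorem RadialSmooth.of_le {k l : ℕ∞ω} {F : E3 → V} (h : RadialSmooth k F) (hl : l ≤ k) :
    RadialSmooth l F := ⟨h.1.of_le hl, h.2⟩

theorem RadialSmooth.contDiffAt {k : ℕ∞ω} {F : E3 → V} (h : RadialSmooth k F) {x : E3}
    (hx : x ≠ 0) : ContDiffAt ℝ k F x := h.1.contDiffAt (isOpen_compl_singleton.mem_nhds hx)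

theorem RadialSmooth.differentiableAt {k : ℕ∞ω} {F : E3 → V} (h : RadialSmooth k F) (hk : 1 ≤ k)
    {x : E3} (hx : x ≠ 0) : DifferentiableAt ℝ F x :=
  (h.contDiffAt hx).differentiableAt (by intro h0; simp [h0] at hk)

/-- The radially constant extension of the restriction to the sphere of a map. -/
theorem radialSmooth_comp_radialProj {k : ℕ∞ω} {F : E3 → V} (h : ContDiffOn ℝ k F {0}ᶜ) :
    RadialSmooth k (fun x => F (radialProj x)) :=
  ⟨h.comp contDiffOn_coe_radialProj fun x _ => ne_zero_of_mem_unit_sphere (radialProj x),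
    fun c hc x => by rw [radialProj_smul hc]⟩

theorem radialSmooth_of_contMDiff {X : S2 → E3} (h : ContMDiff (𝓡 2) 𝓘(ℝ, E3) ∞ X) :
    RadialSmooth ∞ (X ∘ radialProj) := by
  refine ⟨fun x hx => ?_, fun c hc x => by simp [radialProj_smul hc]⟩
  have := (h.contMDiffAt (x := radialProj x)).comp x (contMDiffAt_radialProj hx)
  exact (contMDiffAt_iff_contDiffAt.1 this).contDiffWithinAt

/-- Euler's identity for a radially constant map. -/
theorem RadialSmooth.fderiv_self {k : ℕ∞ω} {F : E3 → V} (h : RadialSmooth k F) (hk : 1 ≤ k)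
    {x : E3} (hx : x ≠ 0) : fderiv ℝ F x x = 0 := by
  have h1 : HasDerivAt (fun t : ℝ => F (x + t • x)) (fderiv ℝ F x x) 0 :=
    (h.differentiableAt hk hx).hasFDerivAt.hasLineDerivAt x
  have h2 : (fun t : ℝ => F (x + t • x)) =ᶠ[𝓝 0] fun _ => F x := by
    filter_upwards [Ioi_mem_nhds (show (-1 : ℝ) < 0 by norm_num)] with t ht
    have : x + t • x = (1 + t) • x := by rw [add_smul, one_smul]
    rw [this, h.2 _ (by have := mem_Ioi.1 ht; linarith)]
  exact h1.unique ((hasDerivAt_const (0 : ℝ) (F x)).congr_of_eventuallyEq h2)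

theorem RadialSmooth.fderiv_smul {k : ℕ∞ω} {F : E3 → V} (h : RadialSmooth k F) (hk : 1 ≤ k)
    {c : ℝ} (hc : 0 < c) {x : E3} (hx : x ≠ 0) :
    fderiv ℝ F (c • x) = c⁻¹ • fderiv ℝ F x := by
  have hcx : c • x ≠ 0 := by simp [hc.ne', hx]
  have h1 : HasFDerivAt (fun z => F (c • z)) ((fderiv ℝ F (c • x)).comp
      (c • ContinuousLinearMap.id ℝ E3)) x :=
    (h.differentiableAt hk hcx).hasFDerivAt.comp x ((hasFDerivAt_id x).const_smul c)
  have h2 : (fun z => F (c • z)) = F := funext fun z => h.2 c hc z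
  rw [h2] at h1
  rw [h1.fderiv]
  ext v
  simp [smul_smul, hc.ne']

theorem RadialSmooth.continuousOn_fderiv {k : ℕ∞ω} {F : E3 → V} (h : RadialSmooth k F)
    (hk : 1 ≤ k) : ContinuousOn (fderiv ℝ F) {0}ᶜ :=
  h.1.continuousOn_fderiv_of_isOpen isOpen_compl_singleton hk

theorem RadialSmooth.continuous_fderiv_coe {k : ℕ∞ω} {F : E3 → V} (h : RadialSmooth k F)
    (hk : 1 ≤ k) : Continuous (fun y : S2 => fderiv ℝ F y) :=
  (h.continuousOn_fderiv hk).comp_continuous continuous_subtype_val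
    fun y => ne_zero_of_mem_unit_sphere y

end RadialSmooth

theorem RadialSmooth.coord {k : ℕ∞ω} {F : E3 → E3} (h : RadialSmooth k F) (i : Fin 3) :
    RadialSmooth k (fun x => F x i) :=
  ⟨(EuclideanSpace.proj (𝕜 := ℝ) i).contDiff.comp_contDiffOn h.1, fun c hc x => by rw [h.2 c hc]⟩

theorem fderiv_coord {F : E3 → E3} {x : E3} (h : DifferentiableAt ℝ F x) (i : Fin 3) :
    fderiv ℝ (fun z => F z i) x = coordForm (fderiv ℝ F x) i :=
  ((EuclideanSpace.proj (𝕜 := ℝ) i).hasFDerivAt.comp x h.hasFDerivAt).fderiv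

/-- The chain rule for the restriction to the sphere of a differentiable map. -/
theorem partialDeriv_comp_coe {F : E3 → E3} {y : S2} (h : DifferentiableAt ℝ F y) (i : Fin 2) :
    partialDeriv (fun z : S2 => F z) y i =
      fderiv ℝ F y (partialDeriv (fun z : S2 => (z : E3)) y i) := by
  have := fact_finrank_E3
  have hc : MDifferentiableAt (𝓡 2) 𝓘(ℝ, E3) (fun z : S2 => (z : E3)) y :=
    (contMDiff_coe_sphere (m := 1)).mdifferentiableAt one_ne_zero
  have := mfderiv_comp (I := 𝓡 2) (I' := 𝓘(ℝ, E3)) (I'' := 𝓘(ℝ, E3)) y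
    (g := F) (f := fun z : S2 => (z : E3)) h.mdifferentiableAt hc
  unfold partialDeriv mvfderiv
  change (mfderiv (𝓡 2) 𝓘(ℝ, E3) (F ∘ fun z : S2 => (z : E3)) y) _ = _
  rw [this, mfderiv_eq_fderiv]
  rfl

/-! ### The coordinate frame of the sphere -/

/-- The coordinate frame, at `y`, of the tangent plane of the unit sphere. -/
def sphereFrame (y : S2) (i : Fin 2) : E3 := partialDeriv (fun z : S2 => (z : E3)) y i

/-- The oriented area of the coordinate frame of the unit sphere. -/
def frameDet (y : S2) : ℝ := det3 y (sphereFrame y 0) (sphereFrame y 1)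

theorem norm_coe_S2 (y : S2) : ‖(y : E3)‖ = 1 := norm_eq_of_mem_sphere y

theorem coe_S2_ne_zero (y : S2) : (y : E3) ≠ 0 := ne_zero_of_mem_unit_sphere y

theorem inner_sphereFrame (y : S2) (i : Fin 2) : ⟪(y : E3), sphereFrame y i⟫_ℝ = 0 := by
  have := fact_finrank_E3
  have h := range_mvfderiv_subtypeVal (n := 2) y
  have h2 : sphereFrame y i ∈ (ℝ ∙ (y : E3))ᗮ := by
    rw [← h]; exact ⟨_, rfl⟩
  exact Submodule.mem_orthogonal_singleton_iff_inner_right.1 h2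

theorem mvfderiv_apply_eq (X : S2 → E3) (y : S2) (ξ : EuclideanSpace ℝ (Fin 2)) :
    (mvfderiv (𝓡 2) X y : EuclideanSpace ℝ (Fin 2) →L[ℝ] E3) ξ =
      ξ 0 • partialDeriv X y 0 + ξ 1 • partialDeriv X y 1 := by
  have h : ξ = ξ 0 • EuclideanSpace.single 0 1 + ξ 1 • EuclideanSpace.single 1 1 := by
    ext i; fin_cases i <;> simp
  have key : ∀ A : EuclideanSpace ℝ (Fin 2) →L[ℝ] E3, A ξ =
      ξ 0 • A (EuclideanSpace.single 0 1) + ξ 1 • A (EuclideanSpace.single 1 1) := fun A => by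
    conv_lhs => rw [h]
    rw [map_add, map_smul, map_smul]
  exact key _

theorem exists_sphereFrame_coords (y : S2) {a : E3} (ha : ⟪(y : E3), a⟫_ℝ = 0) :
    ∃ s t : ℝ, a = s • sphereFrame y 0 + t • sphereFrame y 1 := by
  have := fact_finrank_E3
  have h := range_mvfderiv_subtypeVal (n := 2) y
  have h2 : a ∈ (ℝ ∙ (y : E3))ᗮ := Submodule.mem_orthogonal_singleton_iff_inner_right.2 ha
  rw [← h] at h2
  obtain ⟨ξ, hξ⟩ := h2
  exact ⟨_, _, hξ.symm.trans (mvfderiv_apply_eq (fun z : S2 => (z : E3)) y ξ)⟩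

theorem linearIndependent_partialDeriv {X : S2 → E3} {y : S2}
    (h : Function.Injective (mvfderiv (𝓡 2) X y)) (s t : ℝ)
    (h0 : s • partialDeriv X y 0 + t • partialDeriv X y 1 = 0) : s = 0 ∧ t = 0 := by
  have h1 := mvfderiv_apply_eq X y !₂[s, t]
  have h2 : (!₂[s, t] : EuclideanSpace ℝ (Fin 2)) = 0 := by
    apply h
    refine (h1.trans ?_).trans (map_zero (mvfderiv (𝓡 2) X y)).symm
    simpa using h0
  exact ⟨by simpa using congrArg (fun ξ : EuclideanSpace ℝ (Fin 2) => ξ 0) h2,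
    by simpa using congrArg (fun ξ : EuclideanSpace ℝ (Fin 2) => ξ 1) h2⟩

theorem frameDet_ne_zero (y : S2) : frameDet y ≠ 0 := by
  have := fact_finrank_E3
  have hc : cross (sphereFrame y 0) (sphereFrame y 1) ≠ 0 :=
    cross_ne_zero_of_linearIndependent
      (linearIndependent_partialDeriv (injective_mvfderiv_subtypeVal_sphere (n := 2) y))
  intro h0
  have h1 := smul_eq_smul_cross (inner_sphereFrame y 0) (inner_sphereFrame y 1)
  change ⟪(y : E3), cross _ _⟫_ℝ = 0 at h0
  rw [h0, zero_smul, smul_eq_zero] at h1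
  rcases h1 with h1 | h1
  · exact hc (by simpa using h1)
  · exact coe_S2_ne_zero y h1

theorem partialDeriv_eq_fderiv {X : S2 → E3} (h : ContMDiff (𝓡 2) 𝓘(ℝ, E3) ∞ X) (y : S2)
    (i : Fin 2) :
    partialDeriv X y i = fderiv ℝ (X ∘ radialProj) y (sphereFrame y i) := by
  have h1 : X = fun z : S2 => (X ∘ radialProj) z := by
    funext z; simp [radialProj_coe]
  conv_lhs => rw [h1]
  exact partialDeriv_comp_coe
    ((radialSmooth_of_contMDiff h).differentiableAt (by norm_num) (coe_S2_ne_zero y)) i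

/-- Vectors of three-space decompose along the position vector and the coordinate frame. -/
theorem exists_coords (y : S2) (a : E3) : ∃ r s t : ℝ,
    a = r • (y : E3) + s • sphereFrame y 0 + t • sphereFrame y 1 := by
  obtain ⟨s, t, h⟩ := exists_sphereFrame_coords y (a := a - ⟪(y : E3), a⟫_ℝ • (y : E3)) (by
    rw [inner_sub_right, inner_smul_right, real_inner_self_eq_norm_sq, norm_coe_S2]; ring)
  exact ⟨⟪(y : E3), a⟫_ℝ, s, t, by rw [add_assoc, ← h]; abel⟩

/-! ### Polar coordinates -/

/-- The area measure of the unit sphere. -/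
abbrev sphereMeasure : Measure S2 := (volume : Measure E3).toSphere

theorem map_polar : MeasurePreserving (homeomorphUnitSphereProd E3)
    ((volume : Measure E3).comap (↑)) (sphereMeasure.prod (Measure.volumeIoiPow 2)) := by
  have := (volume : Measure E3).measurePreserving_homeomorphUnitSphereProd
  rwa [finrank_euclideanSpace_fin] at this

theorem homeomorphUnitSphereProd_eq (x : ({0}ᶜ : Set E3)) :
    (homeomorphUnitSphereProd E3 x).1 = radialProj x ∧
      ((homeomorphUnitSphereProd E3 x).2 : ℝ) = ‖(x : E3)‖ := by
  refine ⟨Subtype.ext ?_, by simp⟩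
  rw [coe_radialProj x.2]
  simp

theorem integral_polar_prod (φ : S2 → ℝ → ℝ) :
    ∫ x : E3, φ (radialProj x) ‖x‖ =
      ∫ p, φ p.1 p.2 ∂(sphereMeasure.prod (Measure.volumeIoiPow 2)) := by
  calc ∫ x : E3, φ (radialProj x) ‖x‖
      = ∫ x : ({(0)}ᶜ : Set E3), φ (radialProj x.1) ‖x.1‖
          ∂((volume : Measure E3).comap Subtype.val) := by
        rw [integral_subtype_comap (measurableSet_singleton _).compl
          fun x => φ (radialProj x) ‖x‖, restrict_compl_singleton]
    _ = _ := by
        rw [← map_polar.integral_comp (Homeomorph.measurableEmbedding _)]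
        simp only [homeomorphUnitSphereProd_eq]

theorem integral_volumeIoiPow (φ : ℝ → ℝ) :
    ∫ r : Ioi (0 : ℝ), φ r ∂(Measure.volumeIoiPow 2) = ∫ r in Ioi (0 : ℝ), r ^ 2 * φ r := by
  simp only [Measure.volumeIoiPow, ENNReal.ofReal]
  rw [integral_withDensity_eq_integral_smul,
    integral_subtype_comap measurableSet_Ioi fun a => Real.toNNReal (a ^ 2) • φ a,
    setIntegral_congr_fun measurableSet_Ioi fun x hx => ?_]
  · simp only [NNReal.smul_def, smul_eq_mul]
    rw [Real.coe_toNNReal _ (pow_nonneg hx.out.le _)]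
  · exact (measurable_subtype_coe.pow_const _).real_toNNReal

theorem integral_polar_mul (q : S2 → ℝ) (η : ℝ → ℝ) :
    ∫ x : E3, q (radialProj x) * η ‖x‖ =
      (∫ y, q y ∂sphereMeasure) * ∫ r in Ioi (0 : ℝ), r ^ 2 * η r := by
  rw [integral_polar_prod (fun y r => q y * η r), ← integral_volumeIoiPow]
  exact integral_prod_mul q (fun r : Ioi (0 : ℝ) => η r)

/-! ### Stokes' theorem on the sphere -/

theorem wedge_smul_smul (c d : ℝ) (y : E3) (α β : E3 →L[ℝ] ℝ) :
    wedge y (c • α) (d • β) = c * d * wedge y α β := by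
  simp only [wedge, smul_apply, smul_eq_mul]; ring

theorem wedge_smul_left (c : ℝ) (y : E3) (α β : E3 →L[ℝ] ℝ) :
    wedge (c • y) α β = c * wedge y α β := by
  simp only [wedge, PiLp.smul_apply, smul_eq_mul]; ring

theorem continuous_wedge {T : Type*} [TopologicalSpace T] {p : T → E3} {α β : T → E3 →L[ℝ] ℝ}
    {s : Set T}
    (hp : ContinuousOn p s) (hα : ContinuousOn α s) (hβ : ContinuousOn β s) :
    ContinuousOn (fun t => wedge (p t) (α t) (β t)) s := by
  unfold wedge
  have hp' : ∀ i, ContinuousOn (fun t => p t i) s := fun i =>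
    (EuclideanSpace.proj (𝕜 := ℝ) i).continuous.comp_continuousOn hp
  have hα' : ∀ v, ContinuousOn (fun t => α t v) s := fun v => hα.clm_apply continuousOn_const
  have hβ' : ∀ v, ContinuousOn (fun t => β t v) s := fun v => hβ.clm_apply continuousOn_const
  fun_prop (disch := assumption)

/-- A smooth radial cutoff function supported in an annulus around the origin. -/
theorem exists_radial_cutoff : ∃ ψ : ℝ → ℝ, ContDiff ℝ ∞ ψ ∧ (∀ t, 0 ≤ ψ t) ∧ 0 < ψ 1 ∧
    tsupport ψ ⊆ Icc (1 / 2) (3 / 2) := by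
  let b : ContDiffBump (1 : ℝ) := ⟨1 / 4, 1 / 2, by norm_num, by norm_num⟩
  refine ⟨b, b.contDiff, fun t => b.nonneg, ?_, ?_⟩
  · rw [b.one_of_mem_closedBall (by simp [b])]; norm_num
  · rw [b.tsupport_eq, Real.closedBall_eq_Icc]
    norm_num [b]

theorem integrable_of_annulus {h : E3 → ℝ} (hc : ContinuousOn h {0}ᶜ)
    (h0 : ∀ x, ‖x‖ ^ 2 ∉ Icc (1 / 2 : ℝ) (3 / 2) → h x = 0) : Integrable h := by
  set K : Set E3 := {x | ‖x‖ ^ 2 ∈ Icc (1 / 2 : ℝ) (3 / 2)}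
  have hK : IsCompact K := by
    refine Metric.isCompact_of_isClosed_isBounded
      (isClosed_Icc.preimage (continuous_norm.pow 2)) ?_
    refine (Metric.isBounded_closedBall (x := (0 : E3)) (r := 2)).subset fun x hx => ?_
    have := hx.2
    simp only [Metric.mem_closedBall, dist_zero_right]
    nlinarith [norm_nonneg x]
  have hK0 : K ⊆ {0}ᶜ := by
    rintro x hx rfl
    have := hx.1
    norm_num at this
  rw [← integrableOn_iff_integrable_of_support_subset (s := K)]
  · exact (hc.mono hK0).integrableOn_compact hK
  · intro x hx
    by_contra hxK
    exact hx (h0 x hxK)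

theorem integral_pos_of_cutoff {ψ : ℝ → ℝ} (hψ : Continuous ψ) (h0 : ∀ t, 0 ≤ ψ t)
    (h1 : 0 < ψ 1) (hs : tsupport ψ ⊆ Icc (1 / 2) (3 / 2)) :
    0 < ∫ r in Ioi (0 : ℝ), r ^ 2 * (ψ (r ^ 2) * r⁻¹) := by
  have e : ∫ r in Ioi (0 : ℝ), r ^ 2 * (ψ (r ^ 2) * r⁻¹) = ∫ r : ℝ, max r 0 * ψ (r ^ 2) := by
    rw [← setIntegral_eq_integral_of_forall_compl_eq_zero (s := Ioi (0 : ℝ))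
      (f := fun r : ℝ => max r 0 * ψ (r ^ 2))]
    · refine setIntegral_congr_fun measurableSet_Ioi fun r hr => ?_
      have hr : 0 < r := hr
      simp only [max_eq_left hr.le]
      field_simp
    · intro r hr
      rw [max_eq_right (not_lt.1 hr), zero_mul]
  rw [e]
  refine Continuous.integral_pos_of_hasCompactSupport_nonneg_nonzero (x := 1)
    (by fun_prop) ?_ (fun r => mul_nonneg (le_max_right _ _) (h0 _)) ?_
  · refine HasCompactSupport.intro (isCompact_Icc (a := (-2 : ℝ)) (b := 2)) fun r hr => ?_
    rw [image_eq_zero_of_notMem_tsupport (f := ψ), mul_zero]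
    intro h
    have := (hs h).2
    exact hr ⟨by nlinarith, by nlinarith⟩
  · simp [h1.ne']

/-- Integration by parts against a vector field that is compactly supported in an annulus. -/
theorem integral_fderiv_mul_of_annulus {a : E3 → ℝ} (ha : ContDiffOn ℝ 1 a {0}ᶜ) {v : E3 → ℝ}
    (hv : ContDiffOn ℝ 1 v {0}ᶜ) (h0 : ∀ x, ‖x‖ ^ 2 ∉ Icc (1 / 2 : ℝ) (3 / 2) → v x = 0)
    (w : E3) :
    Integrable (fun x => fderiv ℝ a x w * v x) ∧ Integrable (fun x => a x * fderiv ℝ v x w) ∧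
      ∫ x, fderiv ℝ a x w * v x = - ∫ x, a x * fderiv ℝ v x w := by
  have hK : IsClosed {x : E3 | ‖x‖ ^ 2 ∈ Icc (1 / 2 : ℝ) (3 / 2)} :=
    isClosed_Icc.preimage (continuous_norm.pow 2)
  have hts : tsupport v ⊆ {x : E3 | ‖x‖ ^ 2 ∈ Icc (1 / 2 : ℝ) (3 / 2)} :=
    closure_minimal (fun x hx => by by_contra h; exact hx (h0 x h)) hK
  have hd : ∀ x, ‖x‖ ^ 2 ∉ Icc (1 / 2 : ℝ) (3 / 2) → fderiv ℝ v x = 0 := fun x hx => by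
    by_contra h
    exact hx (hts (support_fderiv_subset ℝ h))
  have hv' : Differentiable ℝ v := fun x => by
    by_cases hx : x = 0
    · have : v =ᶠ[𝓝 x] fun _ => 0 := by
        refine Filter.eventually_of_mem (hK.isOpen_compl.mem_nhds ?_) fun z hz => h0 z hz
        simp only [hx, mem_compl_iff, mem_ofPred_eq]; norm_num
      exact (differentiableAt_const (0 : ℝ)).congr_of_eventuallyEq this
    · exact (hv.contDiffAt (isOpen_compl_singleton.mem_nhds hx)).differentiableAt one_ne_zero
  have hac := ha.continuousOn_fderiv_of_isOpen isOpen_compl_singleton le_rfl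
  have hvc := hv.continuousOn_fderiv_of_isOpen isOpen_compl_singleton le_rfl
  have i1 : Integrable (fun x => fderiv ℝ a x w * v x) :=
    integrable_of_annulus ((hac.clm_apply continuousOn_const).mul hv.continuousOn)
      fun x hx => by simp [h0 x hx]
  have i2 : Integrable (fun x => a x * fderiv ℝ v x w) :=
    integrable_of_annulus (ha.continuousOn.mul (hvc.clm_apply continuousOn_const))
      fun x hx => by simp [hd x hx]
  have i3 : Integrable (fun x => a x * v x) :=
    integrable_of_annulus (ha.continuousOn.mul hv.continuousOn)
      fun x hx => by simp [h0 x hx]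
  refine ⟨i1, i2, ?_⟩
  rw [integral_mul_fderiv_eq_neg_fderiv_mul_of_integrable i1 i2 i3 ?_ fun x _ => hv' x, neg_neg]
  intro x hx
  refine (ha.contDiffAt (isOpen_compl_singleton.mem_nhds ?_)).differentiableAt one_ne_zero
  rintro rfl
  have := (hts hx).1
  norm_num at this

/-- The field `(∇b × x)` multiplied by a radial function is divergence free. -/
theorem sum_fderiv_cutoff_rotation {b : E3 → ℝ} {x : E3} (hb : ContDiffAt ℝ 2 b x)
    {ψ : ℝ → ℝ} (hψ : Differentiable ℝ ψ) :
    fderiv ℝ (fun z => ψ (‖z‖ ^ 2) * (fderiv ℝ b z (e3 1) * z 2 - fderiv ℝ b z (e3 2) * z 1)) x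
        (e3 0) +
      fderiv ℝ (fun z => ψ (‖z‖ ^ 2) * (fderiv ℝ b z (e3 2) * z 0 - fderiv ℝ b z (e3 0) * z 2)) x
        (e3 1) +
      fderiv ℝ (fun z => ψ (‖z‖ ^ 2) * (fderiv ℝ b z (e3 0) * z 1 - fderiv ℝ b z (e3 1) * z 0)) x
        (e3 2) = 0 := by
  have hsymm := hb.isSymmSndFDerivAt (by simp)
  have hd : DifferentiableAt ℝ (fderiv ℝ b) x :=
    (hb.fderiv_right (m := 1) (by norm_num)).differentiableAt one_ne_zero
  have hB : ∀ i, HasFDerivAt (fun z => fderiv ℝ b z (e3 i))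
      ((fderiv ℝ (fderiv ℝ b) x).flip (e3 i)) x := fun i =>
    hd.hasFDerivAt.clm_apply (hasFDerivAt_const (e3 i) x) |>.congr_fderiv (by ext; simp)
  have hz : ∀ i : Fin 3, HasFDerivAt (fun z : E3 => z i) (EuclideanSpace.proj (𝕜 := ℝ) i) x :=
    fun i => (EuclideanSpace.proj (𝕜 := ℝ) i).hasFDerivAt
  have hκ : HasFDerivAt (fun z : E3 => ψ (‖z‖ ^ 2))
      (deriv ψ (‖x‖ ^ 2) • (2 • innerSL ℝ x)) x :=
    (hψ _).hasDerivAt.comp_hasFDerivAt x (hasStrictFDerivAt_norm_sq x).hasFDerivAt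
  have hV : ∀ i j : Fin 3, ∀ v, fderiv ℝ (fun z : E3 => ψ (‖z‖ ^ 2) *
      (fderiv ℝ b z (e3 i) * z j - fderiv ℝ b z (e3 j) * z i)) x v = _ := fun i j v => by
    rw [(hκ.fun_mul (((hB i).fun_mul (hz j)).fun_sub ((hB j).fun_mul (hz i)))).fderiv]
  rw [hV, hV, hV]
  have s01 := hsymm (e3 0) (e3 1)
  have s02 := hsymm (e3 0) (e3 2)
  have s12 := hsymm (e3 1) (e3 2)
  simp [inner_eq_sum_three]
  rw [s01, s02, s12]
  ring

/-- **Stokes' theorem** on the sphere: the exact form `d(a db)` integrates to zero. -/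
theorem integral_wedge_fderiv {a b : E3 → ℝ} (ha : RadialSmooth 1 a) (hb : RadialSmooth 2 b) :
    ∫ y : S2, wedge y (fderiv ℝ a y) (fderiv ℝ b y) ∂sphereMeasure = 0 := by
  obtain ⟨ψ, hψ, hψ0, hψ1, hs⟩ := exists_radial_cutoff
  have hpolar := integral_polar_mul (fun y : S2 => wedge y (fderiv ℝ a y) (fderiv ℝ b y))
    (fun r => ψ (r ^ 2) * r⁻¹)
  have hpos := integral_pos_of_cutoff hψ.continuous hψ0 hψ1 hs
  suffices h : ∫ x : E3, wedge (radialProj x : E3) (fderiv ℝ a (radialProj x))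
      (fderiv ℝ b (radialProj x)) * (ψ (‖x‖ ^ 2) * ‖x‖⁻¹) = 0 by
    rw [h] at hpolar
    exact (mul_eq_zero.1 hpolar.symm).resolve_right hpos.ne'
  -- the components of the divergence free field `ψ(|x|²) (∇b × x)`
  set v : Fin 3 → Fin 3 → E3 → ℝ := fun i j z =>
    ψ (‖z‖ ^ 2) * (fderiv ℝ b z (e3 i) * z j - fderiv ℝ b z (e3 j) * z i) with hv
  have hvs : ∀ i j, ContDiffOn ℝ 1 (v i j) {0}ᶜ := fun i j => by
    have h1 : ∀ i, ContDiffOn ℝ 1 (fun z => fderiv ℝ b z (e3 i)) {0}ᶜ := fun i =>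
      (hb.1.fderiv_of_isOpen isOpen_compl_singleton (by norm_num)).clm_apply contDiffOn_const
    have h2 : ∀ i : Fin 3, ContDiff ℝ 1 (fun z : E3 => z i) := fun i =>
      (EuclideanSpace.proj (𝕜 := ℝ) i).contDiff
    have h3 : ContDiff ℝ 1 (fun z : E3 => ψ (‖z‖ ^ 2)) :=
      (hψ.of_le (by exact_mod_cast le_top)).comp (contDiff_norm_sq ℝ)
    exact h3.contDiffOn.mul (((h1 i).mul (h2 j).contDiffOn).sub ((h1 j).mul (h2 i).contDiffOn))
  have hv0 : ∀ i j x, ‖x‖ ^ 2 ∉ Icc (1 / 2 : ℝ) (3 / 2) → v i j x = 0 := fun i j x hx => by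
    have : ψ (‖x‖ ^ 2) = 0 := image_eq_zero_of_notMem_tsupport fun h => hx (hs h)
    simp [hv, this]
  obtain ⟨i0, j0, k0⟩ := integral_fderiv_mul_of_annulus ha.1 (hvs 1 2) (hv0 1 2) (e3 0)
  obtain ⟨i1, j1, k1⟩ := integral_fderiv_mul_of_annulus ha.1 (hvs 2 0) (hv0 2 0) (e3 1)
  obtain ⟨i2, j2, k2⟩ := integral_fderiv_mul_of_annulus ha.1 (hvs 0 1) (hv0 0 1) (e3 2)
  have hne : ∀ᵐ x : E3, x ≠ 0 := by simp [ae_iff]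
  have e1 : ∫ x : E3, wedge (radialProj x : E3) (fderiv ℝ a (radialProj x))
      (fderiv ℝ b (radialProj x)) * (ψ (‖x‖ ^ 2) * ‖x‖⁻¹) =
      ∫ x, (fderiv ℝ a x (e3 0) * v 1 2 x + fderiv ℝ a x (e3 1) * v 2 0 x +
        fderiv ℝ a x (e3 2) * v 0 1 x) := by
    refine integral_congr_ae ?_
    filter_upwards [hne] with x hx
    have hn : 0 < ‖x‖ := by positivity
    rw [coe_radialProj hx, ha.fderiv_smul le_rfl (by positivity) hx,
      hb.fderiv_smul (by norm_num) (by positivity) hx, inv_inv, wedge_smul_smul, wedge_smul_left]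
    simp only [hv, wedge]
    field_simp
    ring
  have i01 : Integrable fun x => fderiv ℝ a x (e3 0) * v 1 2 x + fderiv ℝ a x (e3 1) * v 2 0 x :=
    i0.add i1
  have j01 : Integrable fun x => a x * fderiv ℝ (v 1 2) x (e3 0) +
    a x * fderiv ℝ (v 2 0) x (e3 1) := j0.add j1
  rw [e1, integral_add i01 i2, integral_add i0 i1, k0, k1, k2, ← neg_add, ← neg_add,
    ← integral_add j0 j1, ← integral_add j01 j2, neg_eq_zero]
  refine integral_eq_zero_of_ae ?_
  filter_upwards [hne] with x hx
  have := sum_fderiv_cutoff_rotation (hb.contDiffAt hx) (hψ.differentiable (by simp))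
  simp only [Pi.zero_apply, ← mul_add]
  rw [this, mul_zero]

theorem continuous_wedge_fderiv {a b : E3 → ℝ} (ha : RadialSmooth 1 a) (hb : RadialSmooth 1 b) :
    Continuous fun y : S2 => wedge y (fderiv ℝ a y) (fderiv ℝ b y) := by
  rw [← continuousOn_univ]
  exact continuous_wedge continuous_subtype_val.continuousOn
    (ha.continuous_fderiv_coe le_rfl).continuousOn (hb.continuous_fderiv_coe le_rfl).continuousOn

theorem integrable_of_continuous {φ : S2 → ℝ} (h : Continuous φ) : Integrable φ sphereMeasure :=
  h.integrable_of_hasCompactSupport (HasCompactSupport.of_compactSpace φ)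

theorem wedgeInner_fderiv {F G : E3 → E3} {y : S2} (hF : RadialSmooth 1 F)
    (hG : RadialSmooth 1 G) : wedgeInner y (fderiv ℝ F y) (fderiv ℝ G y) =
      ∑ i, wedge y (fderiv ℝ (fun z => F z i) y) (fderiv ℝ (fun z => G z i) y) := by
  unfold wedgeInner
  simp only [fderiv_coord (hF.differentiableAt le_rfl (coe_S2_ne_zero y)),
    fderiv_coord (hG.differentiableAt le_rfl (coe_S2_ne_zero y))]

theorem continuous_wedgeInner_fderiv {F G : E3 → E3} (hF : RadialSmooth 1 F)
    (hG : RadialSmooth 1 G) :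
    Continuous fun y : S2 => wedgeInner y (fderiv ℝ F y) (fderiv ℝ G y) := by
  simp only [wedgeInner_fderiv hF hG]
  exact continuous_finsetSum _ fun i _ => continuous_wedge_fderiv (hF.coord i) (hG.coord i)

/-- Stokes' theorem on the sphere for vector-valued functions. -/
theorem integral_wedgeInner_fderiv {F G : E3 → E3} (hF : RadialSmooth 1 F)
    (hG : RadialSmooth 2 G) :
    ∫ y : S2, wedgeInner y (fderiv ℝ F y) (fderiv ℝ G y) ∂sphereMeasure = 0 := by
  have hG' := hG.of_le (l := 1) (by norm_num)
  simp only [wedgeInner_fderiv hF hG']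
  rw [integral_finsetSum _ fun i _ => integrable_of_continuous
    (continuous_wedge_fderiv (hF.coord i) (hG'.coord i))]
  exact Finset.sum_eq_zero fun i _ => integral_wedge_fderiv (hF.coord i) (hG.coord i)

/-! ### The differential and the area vector of a surface -/

/-- The differential of the radially constant extension of a map on the sphere. -/
def surfDeriv (X : S2 → E3) (x : E3) : E3 →L[ℝ] E3 := fderiv ℝ (X ∘ radialProj) x

/-- The normal vector `∂₁X × ∂₂X` of a surface, in a positively oriented orthonormal frame of the
parameter sphere. -/
def areaVec (X : S2 → E3) (x : E3) : E3 := conormal x (surfDeriv X x)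

theorem contDiffOn_wedge {p : E3 → E3} {α β : E3 → E3 →L[ℝ] ℝ} {s : Set E3} {k : ℕ∞ω}
    (hp : ContDiffOn ℝ k p s) (hα : ContDiffOn ℝ k α s) (hβ : ContDiffOn ℝ k β s) :
    ContDiffOn ℝ k (fun t => wedge (p t) (α t) (β t)) s := by
  unfold wedge
  have hp' : ∀ i, ContDiffOn ℝ k (fun t => p t i) s := fun i =>
    (EuclideanSpace.proj (𝕜 := ℝ) i).contDiff.comp_contDiffOn hp
  have hα' : ∀ v, ContDiffOn ℝ k (fun t => α t v) s := fun v => hα.clm_apply contDiffOn_const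
  have hβ' : ∀ v, ContDiffOn ℝ k (fun t => β t v) s := fun v => hβ.clm_apply contDiffOn_const
  have key : ∀ i v w, ContDiffOn ℝ k (fun t => p t i * (α t v * β t w - α t w * β t v)) s :=
    fun i v w => (hp' i).mul (((hα' v).mul (hβ' w)).sub ((hα' w).mul (hβ' v)))
  exact ((key _ _ _).add (key _ _ _)).add (key _ _ _)

theorem contDiffOn_conormal {A : E3 → E3 →L[ℝ] E3} {s : Set E3} {k : ℕ∞ω}
    (hA : ContDiffOn ℝ k A s) : ContDiffOn ℝ k (fun x => conormal x (A x)) s := by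
  have h : ∀ i, ContDiffOn ℝ k (fun x => coordForm (A x) i) s := fun i =>
    (contDiff_const (c := (EuclideanSpace.proj i : E3 →L[ℝ] ℝ))).contDiffOn.clm_comp hA
  rw [contDiffOn_euclidean]
  intro i
  fin_cases i
  · exact contDiffOn_wedge contDiffOn_id (h 1) (h 2)
  · exact contDiffOn_wedge contDiffOn_id (h 2) (h 0)
  · exact contDiffOn_wedge contDiffOn_id (h 0) (h 1)

theorem IsConvexSphere.radialSmooth {Ω : Set E3} {X : S2 → E3} (h : IsConvexSphere Ω X) :
    RadialSmooth ∞ (X ∘ radialProj) := radialSmooth_of_contMDiff h.smooth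

section Surface

variable {Ω : Set E3} {X : S2 → E3} (hX : IsConvexSphere Ω X)
include hX

theorem surfDeriv_self {x : E3} (hx : x ≠ 0) : surfDeriv X x x = 0 :=
  hX.radialSmooth.fderiv_self (by norm_num) hx

theorem partialDeriv_eq_surfDeriv (y : S2) (i : Fin 2) :
    partialDeriv X y i = surfDeriv X y (sphereFrame y i) := partialDeriv_eq_fderiv hX.smooth y i

theorem cross_surfDeriv (y : S2) (u v : E3) :
    cross (surfDeriv X y u) (surfDeriv X y v) = det3 y u v • areaVec X y :=
  cross_map_map (norm_coe_S2 y) (surfDeriv_self hX (coe_S2_ne_zero y)) u v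

theorem areaVec_ne_zero (y : S2) : areaVec X y ≠ 0 := by
  intro h
  have h1 := cross_surfDeriv hX y (sphereFrame y 0) (sphereFrame y 1)
  rw [h, smul_zero, ← partialDeriv_eq_surfDeriv hX, ← partialDeriv_eq_surfDeriv hX] at h1
  exact cross_ne_zero_of_linearIndependent
    (linearIndependent_partialDeriv (hX.immersion y)) h1

theorem surfDeriv_injective (y : S2) {a : E3} (ha : ⟪(y : E3), a⟫_ℝ = 0)
    (h : surfDeriv X y a = 0) : a = 0 := by
  obtain ⟨s, t, rfl⟩ := exists_sphereFrame_coords y ha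
  rw [map_add, map_smul, map_smul, ← partialDeriv_eq_surfDeriv hX,
    ← partialDeriv_eq_surfDeriv hX] at h
  obtain ⟨rfl, rfl⟩ := linearIndependent_partialDeriv (hX.immersion y) s t h
  simp

theorem contDiffOn_surfDeriv : ContDiffOn ℝ ∞ (surfDeriv X) {0}ᶜ :=
  hX.radialSmooth.1.fderiv_of_isOpen isOpen_compl_singleton (by simp)

theorem contDiffOn_areaVec : ContDiffOn ℝ ∞ (areaVec X) {0}ᶜ :=
  contDiffOn_conormal (contDiffOn_surfDeriv hX)

theorem surface_mem (y : S2) : X y ∈ Ω :=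
  hX.isCompact.isClosed.frontier_subset (hX.range_eq ▸ mem_range_self y)

/-! ### The outward unit normal of a convex body -/

/-- A vector supporting the body at a surface point is orthogonal to the surface. -/
theorem inner_surfDeriv_of_support {y : S2} {m : E3} (hm : ∀ z ∈ Ω, ⟪m, z⟫_ℝ ≤ ⟪m, X y⟫_ℝ)
    (u : E3) : ⟪m, surfDeriv X y u⟫_ℝ = 0 := by
  have hd := (hX.radialSmooth.differentiableAt (by norm_num) (coe_S2_ne_zero y)).hasFDerivAt
  have h1 : HasFDerivAt (fun x => ⟪m, (X ∘ radialProj) x⟫_ℝ)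
      ((innerSL ℝ m).comp (surfDeriv X y)) y := (innerSL ℝ m).hasFDerivAt.comp _ hd
  have h2 : IsLocalMax (fun x => ⟪m, (X ∘ radialProj) x⟫_ℝ) (y : E3) := by
    refine Eventually.of_forall fun x => ?_
    simp only [Function.comp_apply, radialProj_coe]
    exact hm _ (surface_mem hX _)
  have h3 := h2.hasFDerivAt_eq_zero h1
  exact congrArg (fun A : E3 →L[ℝ] ℝ => A u) h3

theorem closure_interior_eq : closure (interior Ω) = Ω := by
  rw [hX.convex.closure_interior_eq_closure_of_nonempty_interior hX.interior_nonempty,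
    hX.isCompact.isClosed.closure_eq]

/-- An open half-space bound on the interior of the body extends to a support inequality. -/
theorem support_of_interior {m : E3} {c : ℝ} (h : ∀ z ∈ interior Ω, ⟪m, z⟫_ℝ < c) :
    ∀ z ∈ Ω, ⟪m, z⟫_ℝ ≤ c := by
  intro z hz
  rw [← closure_interior_eq hX] at hz
  exact closure_minimal (t := {z : E3 | ⟪m, z⟫_ℝ ≤ c}) (fun w hw => (h w hw).le)
    (isClosed_le (by fun_prop) continuous_const) hz

theorem exists_support (y : S2) : ∃ m : E3, ∀ z ∈ interior Ω, ⟪m, z⟫_ℝ < ⟪m, X y⟫_ℝ := by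
  have hy : X y ∉ interior Ω := by
    have : X y ∈ frontier Ω := hX.range_eq ▸ mem_range_self y
    exact this.2
  obtain ⟨ℓ, hℓ⟩ := geometric_hahn_banach_open_point hX.convex.interior isOpen_interior hy
  refine ⟨(InnerProductSpace.toDual ℝ E3).symm ℓ, fun z hz => ?_⟩
  simpa using hℓ z hz

omit hX in
/-- The outward unit normal at the surface point `X x`, for `x` on the unit sphere: the area vector,
normalized and oriented away from the interior point `z₀`. -/
def outerNormal (X : S2 → E3) (z₀ : E3) (x : E3) : E3 :=
  (⟪areaVec X x, X (radialProj x) - z₀⟫_ℝ /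
    (|⟪areaVec X x, X (radialProj x) - z₀⟫_ℝ| * ‖areaVec X x‖)) • areaVec X x

variable {z₀ : E3} (hz₀ : z₀ ∈ interior Ω)
include hz₀

theorem inner_areaVec_ne_zero (y : S2) : ⟪areaVec X y, X y - z₀⟫_ℝ ≠ 0 := by
  obtain ⟨m, hm⟩ := exists_support hX y
  have hs := inner_surfDeriv_of_support hX (support_of_interior hX hm)
  have h1 := smul_eq_smul_cross (hs (sphereFrame y 0)) (hs (sphereFrame y 1))
  rw [cross_surfDeriv hX] at h1
  intro h0
  have h2 := congrArg (fun w => ⟪w, X y - z₀⟫_ℝ) h1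
  simp only [inner_smul_left, RCLike.conj_to_real, h0, mul_zero] at h2
  have h3 : 0 < ⟪m, X y - z₀⟫_ℝ := by rw [inner_sub_right]; linarith [hm z₀ hz₀]
  have h4 : det3 y (sphereFrame y 0) (sphereFrame y 1) • areaVec X y ≠ 0 :=
    smul_ne_zero (frameDet_ne_zero y) (areaVec_ne_zero hX y)
  have h5 : 0 < ‖det3 y (sphereFrame y 0) (sphereFrame y 1) • areaVec X y‖ ^ 2 := by positivity
  exact (mul_pos h5 h3).ne' h2

theorem norm_outerNormal (y : S2) : ‖outerNormal X z₀ y‖ = 1 := by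
  have h1 := inner_areaVec_ne_zero hX hz₀ y
  have h2 : ‖areaVec X y‖ ≠ 0 := by simpa using areaVec_ne_zero hX y
  rw [outerNormal, radialProj_coe, norm_smul, norm_div, norm_mul, norm_norm, Real.norm_eq_abs,
    Real.norm_eq_abs, abs_abs]
  have : |⟪areaVec X y, X y - z₀⟫_ℝ| ≠ 0 := by simpa using h1
  field_simp

theorem inner_outerNormal_pos (y : S2) : 0 < ⟪outerNormal X z₀ y, X y - z₀⟫_ℝ := by
  have h1 := inner_areaVec_ne_zero hX hz₀ y
  have h2 : 0 < ‖areaVec X y‖ := by simpa using areaVec_ne_zero hX y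
  rw [outerNormal, radialProj_coe, inner_smul_left, RCLike.conj_to_real, div_mul_eq_mul_div]
  have := abs_pos.2 h1
  have := mul_self_pos.2 h1
  positivity

theorem inner_outerNormal_surfDeriv (y : S2) (u : E3) :
    ⟪outerNormal X z₀ y, surfDeriv X y u⟫_ℝ = 0 := by
  obtain ⟨m, hm⟩ := exists_support hX y
  have hs := inner_surfDeriv_of_support hX (support_of_interior hX hm)
  have h1 := smul_eq_smul_cross (hs (sphereFrame y 0)) (hs (sphereFrame y 1))
  rw [cross_surfDeriv hX] at h1
  have h2 := congrArg (fun w => ⟪w, surfDeriv X y u⟫_ℝ) h1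
  have h3 : 0 < ⟪m, X y - z₀⟫_ℝ := by rw [inner_sub_right]; linarith [hm z₀ hz₀]
  have hm0 : m ≠ 0 := by rintro rfl; simp at h3
  have h4 : det3 y (sphereFrame y 0) (sphereFrame y 1) • areaVec X y ≠ 0 :=
    smul_ne_zero (frameDet_ne_zero y) (areaVec_ne_zero hX y)
  have h5 : ⟪m, det3 y (sphereFrame y 0) (sphereFrame y 1) • areaVec X y⟫_ℝ ≠ 0 := by
    intro h0
    rw [h0, zero_smul, smul_eq_zero] at h1
    rcases h1 with h1 | h1
    · exact h4 (by simpa using h1)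
    · exact hm0 h1
  simp only [inner_smul_left, inner_smul_right, RCLike.conj_to_real, hs u, mul_zero] at h2 h5
  have h6 := (mul_eq_zero.1 h2.symm).resolve_left h5
  have h7 := (mul_eq_zero.1 h6).resolve_left (frameDet_ne_zero y)
  rw [outerNormal, inner_smul_left, h7, mul_zero]

/-- A vector orthogonal to the surface is a multiple of the outward unit normal. -/
theorem eq_smul_outerNormal (y : S2) {m : E3}
    (hm : ∀ i, ⟪m, surfDeriv X y (sphereFrame y i)⟫_ℝ = 0) :
    m = ⟪m, outerNormal X z₀ y⟫_ℝ • outerNormal X z₀ y := by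
  set ν := outerNormal X z₀ y
  have hν : ‖ν‖ = 1 := norm_outerNormal hX hz₀ y
  have h0 : ∀ i, ⟪m - ⟪m, ν⟫_ℝ • ν, surfDeriv X y (sphereFrame y i)⟫_ℝ = 0 := fun i => by
    rw [inner_sub_left, hm, inner_smul_left, inner_outerNormal_surfDeriv hX hz₀]; simp
  have h1 := smul_eq_smul_cross (h0 0) (h0 1)
  rw [cross_surfDeriv hX] at h1
  have h4 : det3 y (sphereFrame y 0) (sphereFrame y 1) • areaVec X y ≠ 0 :=
    smul_ne_zero (frameDet_ne_zero y) (areaVec_ne_zero hX y)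
  set N := det3 y (sphereFrame y 0) (sphereFrame y 1) • areaVec X y with hN
  have h5 : ⟪m - ⟪m, ν⟫_ℝ • ν, ν⟫_ℝ = 0 := by
    rw [inner_sub_left, inner_smul_left, real_inner_self_eq_norm_sq, hν]; simp
  -- the area vector is a nonzero multiple of the normal
  have h6 : ⟪N, ν⟫_ℝ ≠ 0 := by
    have k1 := inner_areaVec_ne_zero hX hz₀ y
    have k2 := areaVec_ne_zero hX y
    have k3 : ‖areaVec X y‖ ≠ 0 := by simpa using k2
    have k4 : |⟪areaVec X y, X y - z₀⟫_ℝ| ≠ 0 := by simpa using k1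
    simp only [hN, ν, outerNormal, radialProj_coe, inner_smul_left, inner_smul_right,
      real_inner_self_eq_norm_sq, RCLike.conj_to_real]
    exact mul_ne_zero (div_ne_zero k1 (mul_ne_zero k4 k3))
      (mul_ne_zero (frameDet_ne_zero y) (pow_ne_zero 2 k3))
  have h7 := congrArg (fun w => ⟪w, ν⟫_ℝ) h1
  simp only [inner_smul_left, RCLike.conj_to_real, h5, mul_zero] at h7
  rw [(mul_eq_zero.1 h7.symm).resolve_right h6, zero_smul, smul_eq_zero] at h1
  rcases h1 with h1 | h1
  · exact absurd (by simpa using h1) h4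
  · exact sub_eq_zero.1 h1

/-- The outward unit normal supports the body. -/
theorem inner_outerNormal_le (y : S2) {z : E3} (hz : z ∈ Ω) :
    ⟪outerNormal X z₀ y, z⟫_ℝ ≤ ⟪outerNormal X z₀ y, X y⟫_ℝ := by
  obtain ⟨m, hm⟩ := exists_support hX y
  have hsup := support_of_interior hX hm
  have h1 := eq_smul_outerNormal hX hz₀ y
    fun i => inner_surfDeriv_of_support hX hsup (sphereFrame y i)
  have h3 : 0 < ⟪m, X y - z₀⟫_ℝ := by rw [inner_sub_right]; linarith [hm z₀ hz₀]
  have h2 := hsup z hz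
  have h4 := inner_outerNormal_pos hX hz₀ y
  rw [h1, inner_smul_left, RCLike.conj_to_real] at h3
  rw [h1, inner_smul_left, inner_smul_left, RCLike.conj_to_real] at h2
  have h5 : 0 < ⟪m, outerNormal X z₀ y⟫_ℝ := pos_of_mul_pos_left h3 h4.le
  exact le_of_mul_le_mul_left h2 h5

theorem add_smul_outerNormal_notMem (y : S2) {t : ℝ} (ht : 0 < t) :
    X y + t • outerNormal X z₀ y ∉ Ω := by
  intro h
  have := inner_outerNormal_le hX hz₀ y h
  rw [inner_add_right, inner_smul_right, real_inner_self_eq_norm_sq, norm_outerNormal hX hz₀]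
    at this
  linarith

/-- The inward normal ray of a convex body with smooth boundary enters the body. -/
theorem exists_sub_smul_outerNormal_mem (y : S2) :
    ∃ t : ℝ, 0 < t ∧ X y - t • outerNormal X z₀ y ∈ Ω := by
  by_contra! hcon
  set ν := outerNormal X z₀ y
  have hray : Convex ℝ ((fun t : ℝ => X y - t • ν) '' Ioi 0) := by
    have : (fun t : ℝ => X y - t • ν) = fun t => AffineMap.lineMap (X y) (X y - ν) t := by
      funext t
      simp [AffineMap.lineMap_apply]; abel
    rw [this]
    exact (convex_Ioi 0).affine_image _
  have hdis : Disjoint (interior Ω) ((fun t : ℝ => X y - t • ν) '' Ioi 0) := by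
    rw [Set.disjoint_right]
    rintro _ ⟨t, ht, rfl⟩ h
    exact hcon t ht (interior_subset h)
  obtain ⟨ℓ, c, h1, h2⟩ := geometric_hahn_banach_open hX.convex.interior isOpen_interior hray hdis
  set m := (InnerProductSpace.toDual ℝ E3).symm ℓ
  have hm : ∀ z, ⟪m, z⟫_ℝ = ℓ z := fun z => by simp [m]
  have h3 : ∀ z ∈ Ω, ⟪m, z⟫_ℝ ≤ c :=
    support_of_interior hX fun z hz => by rw [hm]; exact h1 z hz
  have h4 : ∀ t : ℝ, 0 < t → c ≤ ⟪m, X y⟫_ℝ - t * ⟪m, ν⟫_ℝ := fun t ht => by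
    have := h2 _ ⟨t, ht, rfl⟩
    rwa [← hm, inner_sub_right, inner_smul_right] at this
  have h5 : c ≤ ⟪m, X y⟫_ℝ := by
    have hl : Tendsto (fun t : ℝ => ⟪m, X y⟫_ℝ - t * ⟪m, ν⟫_ℝ) (𝓝[>] 0)
        (𝓝 (⟪m, X y⟫_ℝ - 0 * ⟪m, ν⟫_ℝ)) :=
      ((continuous_const.sub (continuous_id.mul continuous_const)).tendsto _).mono_left
        nhdsWithin_le_nhds
    rw [zero_mul, sub_zero] at hl
    exact ge_of_tendsto hl (eventually_mem_nhdsWithin.mono fun t ht => h4 t ht)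
  have h6 := eq_smul_outerNormal hX hz₀ y fun i =>
    inner_surfDeriv_of_support hX (fun z hz => (h3 z hz).trans h5) (sphereFrame y i)
  have h7 : 0 < ⟪m, X y - z₀⟫_ℝ := by
    rw [inner_sub_right]
    have := h1 z₀ hz₀
    rw [← hm] at this
    linarith
  rw [h6, inner_smul_left, RCLike.conj_to_real] at h7
  have h8 : 0 < ⟪m, ν⟫_ℝ := pos_of_mul_pos_left h7 (inner_outerNormal_pos hX hz₀ y).le
  have h9 := h4 1 one_pos
  have := h3 _ (surface_mem hX y)
  linarith

/-- A normal vector of the surface that points out of the body is a positive multiple of the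
outward unit normal. -/
theorem inner_outerNormal_pos_of_outward (y : S2) {v : E3}
    (hv : ∀ i, ⟪v, surfDeriv X y (sphereFrame y i)⟫_ℝ = 0) (hv0 : v ≠ 0)
    (hout : ∀ᶠ t : ℝ in 𝓝[>] 0, X y + t • v ∉ Ω) : 0 < ⟪v, outerNormal X z₀ y⟫_ℝ := by
  have h1 := eq_smul_outerNormal hX hz₀ y hv
  by_contra! hcon
  set ν := outerNormal X z₀ y
  rcases hcon.lt_or_eq with hlt | heq
  · obtain ⟨t, ht, hmem⟩ := exists_sub_smul_outerNormal_mem hX hz₀ y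
    set a := -⟪v, ν⟫_ℝ with ha
    have ha0 : 0 < a := by linarith
    have h2 : ∀ᶠ s : ℝ in 𝓝[>] 0, s ∈ Ioo 0 (t / a) := Ioo_mem_nhdsGT (by positivity)
    obtain ⟨s, hs1, hs2⟩ := (hout.and h2).exists
    refine hs1 ?_
    have hs3 : s * a / t ∈ Icc (0 : ℝ) 1 := by
      constructor
      · have := hs2.1; positivity
      · rw [div_le_one ht]; exact ((lt_div_iff₀ ha0).1 hs2.2).le
    have h3 := hX.convex.add_smul_sub_mem (surface_mem hX y) hmem hs3
    have h4 : X y + (s * a / t) • (X y - t • ν - X y) = X y + s • v := by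
      rw [h1, sub_sub_cancel_left, smul_neg, smul_smul, smul_smul, div_mul_cancel₀ _ ht.ne', ha,
        mul_neg, neg_smul, neg_neg]
    rwa [h4] at h3
  · rw [heq, zero_smul] at h1
    exact hv0 h1

theorem contDiffOn_outerNormal :
    ContDiffOn ℝ ∞ (fun x => outerNormal X z₀ (radialProj x)) {0}ᶜ := by
  have hN : ContDiffOn ℝ ∞ (fun x => areaVec X (radialProj x)) {0}ᶜ :=
    (radialSmooth_comp_radialProj (contDiffOn_areaVec hX)).1
  have hP : ContDiffOn ℝ ∞ (fun x => X (radialProj x) - z₀) {0}ᶜ :=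
    hX.radialSmooth.1.sub contDiffOn_const
  have hI := hN.inner ℝ hP
  simp only [outerNormal, radialProj_coe]
  have h1 := fun x : E3 => inner_areaVec_ne_zero hX hz₀ (radialProj x)
  refine ContDiffOn.smul (hI.div (ContDiffOn.mul ?_ (hN.norm ℝ ?_)) ?_) hN
  · intro x hx
    exact (contDiffAt_abs (h1 x)).comp_contDiffWithinAt x (hI x hx)
  · exact fun x _ => areaVec_ne_zero hX _
  · intro x _
    exact mul_ne_zero (by simpa using h1 x) (by simpa using areaVec_ne_zero hX _)

theorem radialSmooth_outerNormal :
    RadialSmooth ∞ (fun x => outerNormal X z₀ (radialProj x)) :=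
  ⟨contDiffOn_outerNormal hX hz₀, fun c hc x => by rw [radialProj_smul hc]⟩

/-- The parametrization either preserves or reverses orientation. -/
theorem exists_orientation : ∃ ε : ℝ, ε * ε = 1 ∧
    ∀ y : S2, areaVec X y = (ε * ‖areaVec X y‖) • outerNormal X z₀ y ∧
      0 < ε * ⟪areaVec X y, X y - z₀⟫_ℝ := by
  have hc : Continuous fun y : S2 => ⟪areaVec X y, X y - z₀⟫_ℝ := by
    have h1 : Continuous fun y : S2 => areaVec X y :=
      (contDiffOn_areaVec hX).continuousOn.comp_continuous continuous_subtype_val coe_S2_ne_zero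
    exact h1.inner (hX.smooth.continuous.sub continuous_const)
  have hconn : IsPreconnected (univ : Set S2) := by
    have h := isPreconnected_sphere (E := E3) (by
      rw [← Module.finrank_eq_rank, finrank_euclideanSpace_fin]; norm_num) 0 1
    exact (isPreconnected_iff_preconnectedSpace.1 h).isPreconnected_univ
  have hne := inner_areaVec_ne_zero hX hz₀
  have hsign : (∀ y : S2, 0 < ⟪areaVec X y, X y - z₀⟫_ℝ) ∨
      ∀ y : S2, ⟪areaVec X y, X y - z₀⟫_ℝ < 0 := by
    by_contra! hcon
    obtain ⟨⟨a, ha⟩, b, hb⟩ := hcon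
    obtain ⟨y, -, hy⟩ := hconn.intermediate_value (mem_univ a) (mem_univ b) hc.continuousOn
      ⟨ha, hb⟩
    exact hne y hy
  rcases hsign with h | h
  · refine ⟨1, by norm_num, fun y => ⟨?_, by simpa using h y⟩⟩
    have k3 : ‖areaVec X y‖ ≠ 0 := by simpa using areaVec_ne_zero hX y
    rw [outerNormal, radialProj_coe, abs_of_pos (h y), smul_smul]
    have := (h y).ne'
    field_simp
    simp
  · refine ⟨-1, by norm_num, fun y => ⟨?_, by simpa using h y⟩⟩
    have k3 : ‖areaVec X y‖ ≠ 0 := by simpa using areaVec_ne_zero hX y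
    rw [outerNormal, radialProj_coe, abs_of_neg (h y), smul_smul]
    have := (h y).ne
    field_simp
    simp

end Surface

/-! ### Mean curvature of convex surfaces under conformal changes -/

theorem hasFDerivAt_smul_vector {V : Type*} [NormedAddCommGroup V] [NormedSpace ℝ V] {c : E3 → ℝ}
    {c' : E3 →L[ℝ] ℝ} {x : E3} (h : HasFDerivAt c c' x) (J : V) :
    HasFDerivAt (fun z => c z • J) (c'.smulRight J) x := h.smul_const J

theorem flatMetric_eq : flatMetric = conformalMetric fun _ => 1 := by
  funext x; simp [flatMetric, conformalMetric]

/-- The Gram matrix of two pairs of vectors. -/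
def gramPair (a b : Fin 2 → E3) : Matrix (Fin 2) (Fin 2) ℝ := Matrix.of fun i j => ⟪a i, b j⟫_ℝ

theorem det_gramPair (a b : Fin 2 → E3) :
    (gramPair a b).det = ⟪cross (a 0) (a 1), cross (b 0) (b 1)⟫_ℝ := by
  rw [inner_cross_cross, Matrix.det_fin_two]
  simp [gramPair]

/-- The trace of the operator that maps the frame `b` to the tangential part of `a`, in terms of
cross products. -/
theorem trace_inv_gramPair_mul (a b : Fin 2 → E3) (h : cross (b 0) (b 1) ≠ 0) :
    ((gramPair b b)⁻¹ * gramPair a b).trace =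
      (⟪cross (a 0) (b 1), cross (b 0) (b 1)⟫_ℝ + ⟪cross (b 0) (a 1), cross (b 0) (b 1)⟫_ℝ) /
        ‖cross (b 0) (b 1)‖ ^ 2 := by
  have hd : ‖cross (b 0) (b 1)‖ ^ 2 ≠ 0 := by simpa using h
  rw [Matrix.inv_def, det_gramPair, real_inner_self_eq_norm_sq, Matrix.adjugate_fin_two,
    Matrix.trace_fin_two]
  simp only [inner_cross_cross, Ring.inverse_eq_inv', Matrix.smul_apply,
    Matrix.mul_apply, Fin.sum_univ_two, smul_eq_mul, gramPair, Matrix.of_apply, Matrix.cons_val',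
    Matrix.cons_val_zero, Matrix.cons_val_one, Matrix.cons_val_fin_one]
  field_simp
  rw [real_inner_comm (b 0) (b 1)]
  ring

theorem continuous_wedgeInner {A B : S2 → E3 →L[ℝ] E3} (hA : Continuous A) (hB : Continuous B) :
    Continuous fun y : S2 => wedgeInner y (A y) (B y) := by
  have h : ∀ (C : S2 → E3 →L[ℝ] E3), Continuous C → ∀ i, Continuous fun y => coordForm (C y) i :=
    fun C hC i => continuous_const.clm_comp hC
  refine continuous_finsetSum _ fun i _ => ?_
  rw [← continuousOn_univ]
  exact continuous_wedge continuous_subtype_val.continuousOn (h A hA i).continuousOn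
    (h B hB i).continuousOn

/-- The differential of the radially constant extension of the outward unit normal. -/
def normalDeriv (X : S2 → E3) (z₀ x : E3) : E3 →L[ℝ] E3 :=
  fderiv ℝ (fun z => outerNormal X z₀ (radialProj z)) x

/-- The coordinate tangent vectors of a surface. -/
def surfFrame (X : S2 → E3) (y : S2) (i : Fin 2) : E3 := surfDeriv X y (sphereFrame y i)

/-- The derivatives of the outward unit normal along the coordinate frame. -/
def normalFrame (X : S2 → E3) (z₀ : E3) (y : S2) (i : Fin 2) : E3 :=
  normalDeriv X z₀ y (sphereFrame y i)

/-- The Euclidean mean curvature of a surface times its area element. -/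
def meanCurvatureDensity (X : S2 → E3) (z₀ : E3) (y : S2) : ℝ :=
  ((gramPair (surfFrame X y) (surfFrame X y))⁻¹ *
    gramPair (normalFrame X z₀ y) (surfFrame X y)).trace * ‖areaVec X y‖

section Surface

variable {Ω : Set E3} {X : S2 → E3} (hX : IsConvexSphere Ω X)
include hX

theorem firstForm_flat (y : S2) :
    firstForm flatMetric X y = gramPair (surfFrame X y) (surfFrame X y) := by
  ext i j
  simp only [firstForm, gramPair, Matrix.of_apply, flatMetric_apply, surfFrame,
    partialDeriv_eq_surfDeriv hX]

theorem cross_surfFrame (y : S2) :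
    cross (surfFrame X y 0) (surfFrame X y 1) = frameDet y • areaVec X y :=
  cross_surfDeriv hX y _ _

theorem cross_surfFrame_ne_zero (y : S2) : cross (surfFrame X y 0) (surfFrame X y 1) ≠ 0 := by
  rw [cross_surfFrame hX]
  exact smul_ne_zero (frameDet_ne_zero y) (areaVec_ne_zero hX y)

omit hX in
theorem firstForm_conformal {f : E3 → ℝ} {y : S2} {f₀ : ℝ} (hf : f (X y) = f₀) :
    firstForm (conformalMetric f) X y = f₀ ^ 4 • firstForm flatMetric X y := by
  ext i j
  simp [firstForm, conformalMetric_apply, flatMetric_apply, hf]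

omit hX in
theorem det_firstForm_sphere (y : S2) :
    (firstForm flatMetric (fun z : S2 => (z : E3)) y).det = frameDet y ^ 2 := by
  have h : firstForm flatMetric (fun z : S2 => (z : E3)) y =
    gramPair (sphereFrame y) (sphereFrame y) := rfl
  have h1 := smul_eq_smul_cross (inner_sphereFrame y 0) (inner_sphereFrame y 1)
  change _ = frameDet y • _ at h1
  have h2 := congrArg (fun w => ⟪(y : E3), w⟫_ℝ) h1
  simp only [inner_smul_right, real_inner_self_eq_norm_sq, norm_coe_S2] at h2
  change _ = frameDet y * frameDet y at h2
  rw [h, det_gramPair, real_inner_self_eq_norm_sq]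
  linarith

theorem areaDensity_flat (y : S2) : areaDensity flatMetric X y = ‖areaVec X y‖ := by
  have h0 := frameDet_ne_zero y
  rw [areaDensity, det_firstForm_sphere, firstForm_flat hX, det_gramPair, cross_surfFrame hX,
    real_inner_self_eq_norm_sq, norm_smul, Real.sqrt_sq (by positivity), Real.sqrt_sq_eq_abs,
    Real.norm_eq_abs]
  have : |frameDet y| ≠ 0 := by simpa using h0
  field_simp

theorem areaDensity_conformal {f : E3 → ℝ} {y : S2} {f₀ : ℝ} (hf : f (X y) = f₀) :
    areaDensity (conformalMetric f) X y = f₀ ^ 4 * ‖areaVec X y‖ := by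
  rw [← areaDensity_flat hX, areaDensity, areaDensity, firstForm_conformal hf, Matrix.det_smul,
    Fintype.card_fin, Real.sqrt_mul (by positivity), Real.sqrt_sq (by positivity), mul_div_assoc]

variable {z₀ : E3} (hz₀ : z₀ ∈ interior Ω)
include hz₀

/-- For a conformally flat metric the outward unit normal is the rescaled Euclidean one. -/
theorem outwardNormal_conformal {f : E3 → ℝ} {y : S2} {f₀ : ℝ} (hf : f (X y) = f₀)
    (hf₀ : 0 < f₀) :
    outwardNormal (conformalMetric f) Ω X y = (f₀ ^ 2)⁻¹ • outerNormal X z₀ y := by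
  have hex : IsOutwardUnitNormal (conformalMetric f) Ω X y ((f₀ ^ 2)⁻¹ • outerNormal X z₀ y) := by
    refine ⟨fun i => ?_, ?_, ?_⟩
    · rw [conformalMetric_apply, partialDeriv_eq_surfDeriv hX, inner_smul_left,
        inner_outerNormal_surfDeriv hX hz₀]
      simp
    · rw [conformalMetric_apply, hf, inner_smul_left, inner_smul_right,
        real_inner_self_eq_norm_sq, norm_outerNormal hX hz₀]
      simp only [RCLike.conj_to_real]
      field_simp
    · filter_upwards [self_mem_nhdsWithin] with t ht
      rw [smul_smul]
      exact add_smul_outerNormal_notMem hX hz₀ y (mul_pos ht (by positivity))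
  obtain ⟨h1, h2, h3⟩ := Classical.epsilon_spec ⟨_, hex⟩
  change ∀ i, _ at h1
  set v := outwardNormal (conformalMetric f) Ω X y
  change ∀ i, conformalMetric f (X y) v (partialDeriv X y i) = 0 at h1
  change conformalMetric f (X y) v v = 1 at h2
  change ∀ᶠ t : ℝ in 𝓝[>] 0, X y + t • v ∉ Ω at h3
  simp only [conformalMetric_apply, hf, partialDeriv_eq_surfDeriv hX] at h1 h2
  have h1' : ∀ i, ⟪v, surfDeriv X y (sphereFrame y i)⟫_ℝ = 0 := fun i =>
    (mul_eq_zero.1 (h1 i)).resolve_left (by positivity)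
  have hv0 : v ≠ 0 := by intro h; simp [h] at h2
  have h4 := eq_smul_outerNormal hX hz₀ y h1'
  have h5 := inner_outerNormal_pos_of_outward hX hz₀ y h1' hv0 h3
  rw [h4, inner_smul_left, inner_smul_right, real_inner_self_eq_norm_sq,
    norm_outerNormal hX hz₀, RCLike.conj_to_real] at h2
  have h6 : (f₀ ^ 2 * ⟪v, outerNormal X z₀ y⟫_ℝ) ^ 2 = 1 := by linarith
  have h7 : f₀ ^ 2 * ⟪v, outerNormal X z₀ y⟫_ℝ = 1 :=
    (pow_eq_one_iff_of_nonneg (by positivity) two_ne_zero).1 h6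
  rw [h4]
  congr 1
  field_simp
  linarith

theorem partialDeriv_outwardNormal {f : E3 → ℝ} {f₀ : ℝ} (hf : ∀ y, f (X y) = f₀)
    (hf₀ : 0 < f₀) (y : S2) (i : Fin 2) :
    partialDeriv (outwardNormal (conformalMetric f) Ω X) y i =
      (f₀ ^ 2)⁻¹ • normalFrame X z₀ y i := by
  have hd := (radialSmooth_outerNormal hX hz₀).differentiableAt (by norm_num) (coe_S2_ne_zero y)
  have h1 : outwardNormal (conformalMetric f) Ω X =
      fun z : S2 => (fun x => (f₀ ^ 2)⁻¹ • outerNormal X z₀ (radialProj x)) (z : E3) := by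
    funext z
    simp only [outwardNormal_conformal hX hz₀ (hf z) hf₀, radialProj_coe]
  rw [h1, partialDeriv_comp_coe (F := fun x => (f₀ ^ 2)⁻¹ • outerNormal X z₀ (radialProj x))
    (hd.fun_const_smul _), fderiv_fun_const_smul hd]
  rfl

theorem secondForm_conformal {f : E3 → ℝ} {f₀ : ℝ} (hf : ∀ y, f (X y) = f₀)
    (hf₀ : 0 < f₀) (y : S2) (hd : DifferentiableAt ℝ f (X y)) :
    secondForm (conformalMetric f) Ω X y =
      f₀ ^ 2 • gramPair (normalFrame X z₀ y) (surfFrame X y) +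
        (2 * f₀ * fderiv ℝ f (X y) (outerNormal X z₀ y)) •
          gramPair (surfFrame X y) (surfFrame X y) := by
  let J : E3 →L[ℝ] E3 →L[ℝ] ℝ := innerSL ℝ
  have hg : HasFDerivAt (conformalMetric f)
      (((4 * f (X y) ^ 3) • fderiv ℝ f (X y)).smulRight J) (X y) := by
    have h4 : HasFDerivAt (fun x => f x ^ 4) ((4 * f (X y) ^ 3) • fderiv ℝ f (X y)) (X y) :=
      (hd.hasFDerivAt.pow 4).congr_fderiv (by simp)
    exact hasFDerivAt_smul_vector h4 J
  ext i j
  have ht : ∀ i, ⟪outerNormal X z₀ y, surfFrame X y i⟫_ℝ = 0 := fun i =>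
    inner_outerNormal_surfDeriv hX hz₀ y _
  have ht' : ∀ i, ⟪surfFrame X y i, outerNormal X z₀ y⟫_ℝ = 0 := fun i => by
    rw [real_inner_comm]; exact ht i
  have hp : ∀ i, partialDeriv X y i = surfFrame X y i := partialDeriv_eq_surfDeriv hX y
  have hsl : ∀ a b : E3, J a b = ⟪a, b⟫_ℝ := fun a b => rfl
  simp only [secondForm, christoffel, hg.fderiv, Matrix.of_apply, Matrix.add_apply,
    Matrix.smul_apply, gramPair, partialDeriv_outwardNormal hX hz₀ hf hf₀,
    outwardNormal_conformal hX hz₀ (hf y) hf₀, hp, conformalMetric_apply, hf,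
    ContinuousLinearMap.smulRight_apply, smul_apply, smul_eq_mul, map_smul, ht, ht', hsl]
  field_simp
  ring

/-- The mean curvature for the metric `f⁴ δ`, with `f` constant on the surface. -/
theorem meanCurvature_conformal_mul {f : E3 → ℝ} {f₀ : ℝ} (hf : ∀ y, f (X y) = f₀)
    (hf₀ : 0 < f₀) (y : S2) (hd : DifferentiableAt ℝ f (X y)) :
    meanCurvature (conformalMetric f) Ω X y * (f₀ ^ 4 * ‖areaVec X y‖) =
      f₀ ^ 2 * meanCurvatureDensity X z₀ y +
        4 * f₀ * (fderiv ℝ f (X y) (outerNormal X z₀ y) * ‖areaVec X y‖) := by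
  have : Invertible (f₀ ^ 4) := invertibleOfNonzero (by positivity)
  have hdet : IsUnit (gramPair (surfFrame X y) (surfFrame X y)).det := by
    rw [det_gramPair, real_inner_self_eq_norm_sq, isUnit_iff_ne_zero]
    simpa using cross_surfFrame_ne_zero hX y
  rw [meanCurvature, secondForm_conformal hX hz₀ hf hf₀ y hd, firstForm_conformal (hf y),
    firstForm_flat hX, Matrix.inv_smul _ _ hdet]
  rw [mul_add, Matrix.smul_mul, Matrix.smul_mul, Matrix.mul_smul, Matrix.mul_smul,
    Matrix.nonsing_inv_mul _ hdet, Matrix.trace_add]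
  simp only [Matrix.trace_smul, Matrix.trace_one, Fintype.card_fin, smul_eq_mul, invOf_eq_inv,
    meanCurvatureDensity]
  field_simp
  push_cast
  ring

theorem meanCurvature_flat_mul (y : S2) :
    meanCurvature flatMetric Ω X y * ‖areaVec X y‖ = meanCurvatureDensity X z₀ y := by
  have := meanCurvature_conformal_mul hX hz₀ (f := fun _ => 1) (f₀ := 1) (fun _ => rfl) one_pos y
    (by fun_prop)
  rw [flatMetric_eq]
  simpa using this

omit hz₀ in
/-- Traces against the first fundamental form, multiplied by the area element, are linear
combinations of determinants with the normal. -/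
theorem trace_density {ε : ℝ} {y : S2}
    (hN : areaVec X y = (ε * ‖areaVec X y‖) • outerNormal X z₀ y) (a : Fin 2 → E3) :
    ((gramPair (surfFrame X y) (surfFrame X y))⁻¹ * gramPair a (surfFrame X y)).trace *
        ‖areaVec X y‖ =
      ε / frameDet y * (det3 (outerNormal X z₀ y) (a 0) (surfFrame X y 1) +
        det3 (outerNormal X z₀ y) (surfFrame X y 0) (a 1)) := by
  have h0 := frameDet_ne_zero y
  have h1 : ‖areaVec X y‖ ≠ 0 := by simpa using areaVec_ne_zero hX y
  rw [trace_inv_gramPair_mul _ _ (cross_surfFrame_ne_zero hX y), cross_surfFrame hX]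
  have h2 : ∀ w, ⟪w, frameDet y • areaVec X y⟫_ℝ =
      frameDet y * (ε * ‖areaVec X y‖) * ⟪outerNormal X z₀ y, w⟫_ℝ := fun w => by
    conv_lhs => rw [hN]
    rw [inner_smul_right, inner_smul_right, real_inner_comm]; ring
  rw [h2, h2, norm_smul, mul_pow, Real.norm_eq_abs, sq_abs]
  simp only [det3]
  field_simp

theorem normalDeriv_self {x : E3} (hx : x ≠ 0) : normalDeriv X z₀ x x = 0 :=
  (radialSmooth_outerNormal hX hz₀).fderiv_self (by norm_num) hx

/-- The mean curvature density without reference to the discontinuous coordinate frame. -/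
theorem meanCurvatureDensity_eq {ε : ℝ} {y : S2}
    (hN : areaVec X y = (ε * ‖areaVec X y‖) • outerNormal X z₀ y) :
    meanCurvatureDensity X z₀ y =
      ε * wedgeInner y ((crossL (outerNormal X z₀ y)).comp (normalDeriv X z₀ y))
        (surfDeriv X y) := by
  have h0 := frameDet_ne_zero y
  have h1 := wedgeInner_apply (norm_coe_S2 y)
    (A := (crossL (outerNormal X z₀ y)).comp (normalDeriv X z₀ y)) (B := surfDeriv X y)
    (by simp only [ContinuousLinearMap.comp_apply, normalDeriv_self hX hz₀ (coe_S2_ne_zero y),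
      map_zero])
    (surfDeriv_self hX (coe_S2_ne_zero y)) (sphereFrame y 0) (sphereFrame y 1)
  have h2 : wedgeInner y ((crossL (outerNormal X z₀ y)).comp (normalDeriv X z₀ y))
        (surfDeriv X y) = (⟪cross (outerNormal X z₀ y) (normalFrame X z₀ y 0), surfFrame X y 1⟫_ℝ -
          ⟪cross (outerNormal X z₀ y) (normalFrame X z₀ y 1), surfFrame X y 0⟫_ℝ) / frameDet y := by
    rw [eq_div_iff h0, mul_comm]; exact h1.symm
  rw [h2, meanCurvatureDensity, trace_density hX hN]
  simp only [det3_eq, inner_eq_sum_three, cross_zero_coord, cross_one_coord, cross_two_coord]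
  ring

theorem continuous_outerNormal : Continuous fun y : S2 => outerNormal X z₀ y := by
  have := (contDiffOn_outerNormal hX hz₀).continuousOn.comp_continuous continuous_subtype_val
    coe_S2_ne_zero
  simpa only [Function.comp_def, radialProj_coe] using this

omit hz₀ in
theorem continuous_areaVec : Continuous fun y : S2 => areaVec X y :=
  (contDiffOn_areaVec hX).continuousOn.comp_continuous continuous_subtype_val coe_S2_ne_zero

theorem continuous_meanCurvatureDensity : Continuous (meanCurvatureDensity X z₀) := by
  obtain ⟨ε, -, h⟩ := exists_orientation hX hz₀
  have : meanCurvatureDensity X z₀ = _ := funext fun y =>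
    meanCurvatureDensity_eq hX hz₀ (h y).1
  rw [this]
  refine continuous_const.mul (continuous_wedgeInner ?_ ?_)
  · exact (crossL.continuous.comp (continuous_outerNormal hX hz₀)).clm_comp
      ((radialSmooth_outerNormal hX hz₀).continuous_fderiv_coe (by norm_num))
  · exact hX.radialSmooth.continuous_fderiv_coe (by norm_num)

end Surface

theorem one_le_infty : (1 : ℕ∞ω) ≤ ∞ := by norm_num

theorem two_le_infty : (2 : ℕ∞ω) ≤ ∞ := WithTop.coe_le_coe.2 le_top

/-! ### The divergence theorem for a convex body -/

/-- The divergence of a vector field on three-space. -/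
def divergence (F : E3 → E3) (x : E3) : ℝ :=
  fderiv ℝ F x (e3 0) 0 + fderiv ℝ F x (e3 1) 1 + fderiv ℝ F x (e3 2) 2

theorem det_eq_det3 (A : E3 →L[ℝ] E3) : A.det = det3 (A (e3 0)) (A (e3 1)) (A (e3 2)) := by
  rw [ContinuousLinearMap.det, ← LinearMap.det_toMatrix (EuclideanSpace.basisFun (Fin 3) ℝ).toBasis,
    Matrix.det_fin_three, det3_eq]
  simp [LinearMap.toMatrix_apply]
  ring

theorem det_mul_det3 (A : E3 →L[ℝ] E3) (a b c : E3) :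
    A.det * det3 a b c = det3 (A a) (A b) (A c) := by
  rw [det_eq_det3, map_eq_sum_e3 A a, map_eq_sum_e3 A b, map_eq_sum_e3 A c]
  simp only [det3_eq, PiLp.add_apply, PiLp.smul_apply, smul_eq_mul]
  ring

/-- The cone parametrization of a convex body over its boundary, with vertex `z₀`. -/
def coneMap (X : S2 → E3) (z₀ x : E3) : E3 := z₀ + ‖x‖ • (X (radialProj x) - z₀)

/-- The differential of the cone parametrization. -/
def coneDeriv (X : S2 → E3) (z₀ x : E3) : E3 →L[ℝ] E3 :=
  ‖x‖ • surfDeriv X x + (innerSL ℝ (‖x‖⁻¹ • x)).smulRight (X (radialProj x) - z₀)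

section Surface

variable {Ω : Set E3} {X : S2 → E3} (hX : IsConvexSphere Ω X)
include hX

theorem hasFDerivAt_coneMap {x : E3} (hx : x ≠ 0) (z₀ : E3) :
    HasFDerivAt (coneMap X z₀) (coneDeriv X z₀ x) x := by
  have h1 : HasFDerivAt (fun z => X (radialProj z) - z₀) (surfDeriv X x) x :=
    (hX.radialSmooth.differentiableAt (by norm_num) hx).hasFDerivAt.sub_const z₀
  have h2 : HasFDerivAt (fun z : E3 => ‖z‖) (innerSL ℝ (‖x‖⁻¹ • x)) x := by
    have := (hasStrictFDerivAt_norm_sq x).hasFDerivAt.sqrt (by simpa using hx)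
    simp only [Real.sqrt_sq (norm_nonneg _)] at this
    refine this.congr_fderiv ?_
    ext v
    have : ‖x‖ ≠ 0 := by simpa using hx
    simp
    field_simp
  exact (h2.fun_smul h1).const_add z₀

/-- The Jacobian of the cone parametrization does not depend on the radius. -/
theorem det_coneDeriv {x : E3} (hx : x ≠ 0) (z₀ : E3) :
    (coneDeriv X z₀ x).det =
      ⟪areaVec X (radialProj x), X (radialProj x) - z₀⟫_ℝ := by
  set y := radialProj x
  have hn : ‖x‖ ≠ 0 := by simpa using hx
  have hxy : x = ‖x‖ • (y : E3) := by
    rw [coe_radialProj hx, smul_smul, mul_inv_cancel₀ hn, one_smul]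
  have hL : ‖x‖ • surfDeriv X x = surfDeriv X y := by
    have := hX.radialSmooth.fderiv_smul (by norm_num) (c := ‖x‖) (by positivity) (coe_S2_ne_zero y)
    rw [← hxy] at this
    rw [surfDeriv, this, smul_smul, mul_inv_cancel₀ hn, one_smul]
    rfl
  have hA : ∀ v, coneDeriv X z₀ x v = surfDeriv X y v + ⟪(y : E3), v⟫_ℝ • (X y - z₀) := fun v => by
    rw [coneDeriv, hL, ← coe_radialProj hx]; rfl
  have h1 := det_mul_det3 (coneDeriv X z₀ x) y (sphereFrame y 0) (sphereFrame y 1)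
  rw [hA, hA, hA, surfDeriv_self hX (coe_S2_ne_zero y), inner_sphereFrame, inner_sphereFrame,
    real_inner_self_eq_norm_sq, norm_coe_S2, zero_smul, add_zero, add_zero, zero_add,
    one_pow, one_smul] at h1
  conv_rhs at h1 => rw [det3, cross_surfDeriv hX, inner_smul_right, real_inner_comm]
  rw [mul_comm] at h1
  exact mul_left_cancel₀ (frameDet_ne_zero y) h1

theorem segment_mem {z₀ : E3} (hz₀ : z₀ ∈ Ω) (y : S2) {r : ℝ} (h0 : 0 ≤ r) (h1 : r ≤ 1) :
    z₀ + r • (X y - z₀) ∈ Ω :=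
  hX.convex.add_smul_sub_mem hz₀ (surface_mem hX y) ⟨h0, h1⟩

variable {z₀ : E3} (hz₀ : z₀ ∈ interior Ω)
include hz₀

theorem segment_mem_interior (y : S2) {r : ℝ} (h0 : 0 ≤ r) (h1 : r < 1) :
    z₀ + r • (X y - z₀) ∈ interior Ω := by
  have h := hX.convex.combo_interior_self_mem_interior hz₀ (surface_mem hX y)
    (a := 1 - r) (b := r) (by linarith) h0 (by ring)
  convert h using 1
  rw [smul_sub, sub_smul, one_smul]; abel

omit hz₀ in
theorem notMem_interior (y : S2) : X y ∉ interior Ω := by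
  have : X y ∈ frontier Ω := hX.range_eq ▸ mem_range_self y
  exact this.2

omit hX hz₀ in
theorem norm_smul_radialProj {x : E3} (hx : x ≠ 0) : ‖x‖ • (radialProj x : E3) = x := by
  have hn : ‖x‖ ≠ 0 := by simpa using hx
  rw [coe_radialProj hx, smul_smul, mul_inv_cancel₀ hn, one_smul]

/-- A ray from the interior point `z₀` meets the boundary only once. -/
theorem not_lt_of_smul_eq_smul {y y' : S2} {r r' : ℝ} (hr : 0 < r)
    (h : r • (X y - z₀) = r' • (X y' - z₀)) : ¬ r < r' := by
  intro hlt
  have hr' : 0 < r' := hr.trans hlt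
  have h1 : X y' = z₀ + (r / r') • (X y - z₀) := by
    rw [div_eq_inv_mul, mul_smul, h, smul_smul, inv_mul_cancel₀ hr'.ne', one_smul]; abel
  refine notMem_interior hX y' ?_
  rw [h1]
  exact segment_mem_interior hX hz₀ y (by positivity) ((div_lt_one hr').2 hlt)

theorem injOn_coneMap : InjOn (coneMap X z₀) {0}ᶜ := by
  intro x hx x' hx' h
  have hx : x ≠ 0 := hx
  have hx' : x' ≠ 0 := hx'
  have h := add_left_cancel h
  have hn : ‖x‖ = ‖x'‖ := le_antisymm
    (not_lt.1 (not_lt_of_smul_eq_smul hX hz₀ (by positivity) h.symm))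
    (not_lt.1 (not_lt_of_smul_eq_smul hX hz₀ (by positivity) h))
  have hn0 : ‖x'‖ ≠ 0 := by simpa using hx'
  rw [hn] at h
  have h2 := hX.injective (sub_left_injective (smul_right_injective E3 hn0 h))
  rw [← norm_smul_radialProj hx, ← norm_smul_radialProj hx', hn, h2]

/-- Every point of the body lies on a segment from `z₀` to the boundary. -/
theorem image_coneMap : coneMap X z₀ '' (Metric.closedBall 0 1 \ {0}) = Ω \ {z₀} := by
  apply Subset.antisymm
  · rintro _ ⟨x, ⟨hx1, hx⟩, rfl⟩
    have hx : x ≠ 0 := hx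
    rw [mem_closedBall_zero_iff] at hx1
    refine ⟨segment_mem hX (interior_subset hz₀) _ (norm_nonneg x) hx1, fun h => ?_⟩
    have h1 : ‖x‖ • (X (radialProj x) - z₀) = 0 := by
      have : z₀ + ‖x‖ • (X (radialProj x) - z₀) = z₀ := h
      simpa using this
    rcases smul_eq_zero.1 h1 with h2 | h2
    · exact hx (by simpa using h2)
    · exact notMem_interior hX (radialProj x) (sub_eq_zero.1 h2 ▸ hz₀)
  · rintro z ⟨hz, hz0⟩
    have hz0 : z - z₀ ≠ 0 := sub_ne_zero.2 hz0
    have hzn : 0 < ‖z - z₀‖ := by positivity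
    have hcont : Continuous fun t : ℝ => z₀ + t • (z - z₀) := by fun_prop
    -- the last parameter at which the ray through `z` meets the body
    have hcomp : IsCompact {t : ℝ | z₀ + t • (z - z₀) ∈ Ω} := by
      refine Metric.isCompact_of_isClosed_isBounded (hX.isCompact.isClosed.preimage hcont) ?_
      obtain ⟨R, hR⟩ := hX.isCompact.isBounded.exists_norm_le
      refine (Metric.isBounded_closedBall (x := (0 : ℝ)) (r := (R + ‖z₀‖) / ‖z - z₀‖)).subset
        fun t ht => ?_
      rw [mem_closedBall_zero_iff, le_div_iff₀ hzn, ← norm_smul]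
      calc ‖t • (z - z₀)‖ = ‖(z₀ + t • (z - z₀)) - z₀‖ := by rw [add_sub_cancel_left]
        _ ≤ _ := (norm_sub_le _ _).trans (by gcongr; exact hR _ ht)
    have h1mem : (1 : ℝ) ∈ {t : ℝ | z₀ + t • (z - z₀) ∈ Ω} := by simpa using hz
    obtain ⟨T, hT, hTmax⟩ := hcomp.exists_isGreatest ⟨1, h1mem⟩
    have hT1 : 1 ≤ T := hTmax h1mem
    have hfr : z₀ + T • (z - z₀) ∈ frontier Ω := by
      refine ⟨subset_closure hT, fun hint => ?_⟩
      have hop : IsOpen {t : ℝ | z₀ + t • (z - z₀) ∈ interior Ω} :=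
        isOpen_interior.preimage hcont
      have hev : ∀ᶠ t in 𝓝[>] T, z₀ + t • (z - z₀) ∈ interior Ω :=
        nhdsWithin_le_nhds (hop.mem_nhds hint)
      obtain ⟨t, ht1, ht2⟩ := (hev.and self_mem_nhdsWithin).exists
      exact (hTmax (interior_subset (s := Ω) ht1)).not_gt ht2
    rw [← hX.range_eq] at hfr
    obtain ⟨y, hy⟩ := hfr
    have hT0 : 0 < T := by linarith
    refine ⟨T⁻¹ • (y : E3), ⟨?_, ?_⟩, ?_⟩
    · rw [mem_closedBall_zero_iff, norm_smul, norm_coe_S2, mul_one,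
        Real.norm_of_nonneg (by positivity)]
      exact inv_le_one_of_one_le₀ hT1
    · simpa [hT0.ne'] using coe_S2_ne_zero y
    · rw [coneMap, radialProj_smul (by positivity), radialProj_coe, norm_smul, norm_coe_S2, mul_one,
        Real.norm_of_nonneg (by positivity), hy, add_sub_cancel_left, smul_smul,
        inv_mul_cancel₀ hT0.ne', one_smul]
      abel

omit hX hz₀ in
theorem radialSmooth_cross {F G : E3 → E3} (hF : RadialSmooth 1 F) (hG : RadialSmooth 1 G) :
    RadialSmooth 1 (fun x => cross (F x) (G x)) := by
  refine ⟨?_, fun c hc x => by rw [hF.2 c hc, hG.2 c hc]⟩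
  exact (crossL.contDiff.comp_contDiffOn hF.1).clm_apply hG.1

omit hX hz₀ in
theorem fderiv_cross {F G : E3 → E3} {x : E3} (hF : DifferentiableAt ℝ F x)
    (hG : DifferentiableAt ℝ G x) (u : E3) :
    fderiv ℝ (fun x => cross (F x) (G x)) x u =
      cross (fderiv ℝ F x u) (G x) +
        cross (F x) (fderiv ℝ G x u) := by
  have h := (crossL.hasFDerivAt.comp x hF.hasFDerivAt).clm_apply hG.hasFDerivAt
  have h2 : fderiv ℝ (fun x => cross (F x) (G x)) x = _ := h.fderiv
  rw [h2]
  simp [add_comm]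

omit hz₀ in
/-- The flux integrand along the dilated surface differentiates to the divergence, up to an exact
form on the sphere. -/
theorem flux_identity {F : E3 → E3} {y : S2} {r : ℝ}
    (hF : DifferentiableAt ℝ F (z₀ + r • (X y - z₀))) :
    2 * ⟪F (z₀ + r • (X y - z₀)), areaVec X y⟫_ℝ +
        r * ⟪fderiv ℝ F (z₀ + r • (X y - z₀)) (X y - z₀), areaVec X y⟫_ℝ -
        r * (divergence F (z₀ + r • (X y - z₀)) * ⟪areaVec X y, X y - z₀⟫_ℝ) =
      wedgeInner y
        (fderiv ℝ (fun x => cross (F (z₀ + r • (X (radialProj x) - z₀)))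
          (X (radialProj x) - z₀)) y)
        (fderiv ℝ (fun x => X (radialProj x) - z₀) y) := by
  have hy := coe_S2_ne_zero y
  have hP : HasFDerivAt (fun z => X (radialProj z) - z₀) (surfDeriv X y) y :=
    (hX.radialSmooth.differentiableAt (by norm_num) hy).hasFDerivAt.sub_const z₀
  have hG : HasFDerivAt (fun x => F (z₀ + r • (X (radialProj x) - z₀)))
      ((fderiv ℝ F (z₀ + r • (X y - z₀))).comp (r • surfDeriv X y)) y := by
    have h1 : HasFDerivAt F (fderiv ℝ F (z₀ + r • (X y - z₀)))
        (z₀ + r • (X (radialProj y) - z₀)) := by rw [radialProj_coe]; exact hF.hasFDerivAt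
    exact h1.comp (y : E3) ((hP.const_smul r).const_add z₀)
  have hC := fderiv_cross hG.differentiableAt hP.differentiableAt
  rw [hG.fderiv, hP.fderiv] at hC
  simp only [radialProj_coe, ContinuousLinearMap.comp_apply, smul_apply, map_smul] at hC
  set A := fderiv ℝ F (z₀ + r • (X y - z₀))
  set G := F (z₀ + r • (X y - z₀))
  set P := X y - z₀
  set C := fderiv ℝ (fun x => cross (F (z₀ + r • (X (radialProj x) - z₀)))
          (X (radialProj x) - z₀)) y
  set L := surfDeriv X y
  rw [hP.fderiv]
  have hL0 : L y = 0 := surfDeriv_self hX hy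
  have h1 := wedgeInner_apply (norm_coe_S2 y) (A := C) (B := L)
    (by rw [hC, hL0]; apply E3_ext <;> simp) hL0 (sphereFrame y 0) (sphereFrame y 1)
  rw [hC, hC] at h1
  have h2 := cross_surfDeriv hX y (sphereFrame y 0) (sphereFrame y 1)
  change cross (L _) (L _) = _ at h2
  have h3 := trace_mul_det3 A P (L (sphereFrame y 0)) (L (sphereFrame y 1))
  set a := L (sphereFrame y 0)
  set b := L (sphereFrame y 1)
  change _ = frameDet y * _ at h1
  change _ = frameDet y • _ at h2
  have h4 : ∀ w, det3 w a b = frameDet y * ⟪w, areaVec X y⟫_ℝ := fun w => by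
    rw [det3, h2, inner_smul_right]
  rw [h4, h4] at h3
  apply mul_left_cancel₀ (frameDet_ne_zero y)
  rw [← h1, real_inner_comm P (areaVec X y)]
  have h5 : ∀ w, ⟪cross w a, b⟫_ℝ = det3 w a b := fun w => by
    simp only [det3_eq, inner_eq_sum_three, cross_zero_coord, cross_one_coord, cross_two_coord]
    ring
  have h6 : ∀ w, ⟪cross w b, a⟫_ℝ = - det3 w a b := fun w => by
    simp only [det3_eq, inner_eq_sum_three, cross_zero_coord, cross_one_coord, cross_two_coord]
    ring
  simp only [inner_add_left, h5, h6, h4]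
  have h7 : ⟪cross (r • A a) P, b⟫_ℝ -
      ⟪cross (r • A b) P, a⟫_ℝ = -r * (det3 P (A a) b + det3 P a (A b)) := by
    simp only [det3_eq, inner_eq_sum_three, cross_zero_coord, cross_one_coord, cross_two_coord,
      PiLp.smul_apply, smul_eq_mul]
    ring
  have h8 : divergence F (z₀ + r • P) = A (e3 0) 0 + A (e3 1) 1 + A (e3 2) 2 := rfl
  rw [h8]
  linear_combination (-1) * h7 - r * h3

/-- Integration over the body in the polar coordinates of the cone over its boundary. -/
theorem integral_eq_integral_cone {ε : ℝ}
    (hε : ∀ y : S2, 0 < ε * ⟪areaVec X y, X y - z₀⟫_ℝ) (hε1 : ε * ε = 1) {g : E3 → ℝ}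
    (hg : ContinuousOn g Ω) :
    ∫ x in Ω, g x = ∫ y : S2, (∫ r in (0 : ℝ)..1,
      r ^ 2 * (ε * ⟪areaVec X y, X y - z₀⟫_ℝ * g (z₀ + r • (X y - z₀)))) ∂sphereMeasure := by
  set B : Set E3 := Metric.closedBall 0 1 \ {0} with hB
  have hBm : MeasurableSet B := measurableSet_closedBall.diff (measurableSet_singleton 0)
  have hB0 : ∀ x ∈ B, x ≠ 0 := fun x hx => hx.2
  have hder : ∀ x ∈ B, HasFDerivWithinAt (coneMap X z₀) (coneDeriv X z₀ x) B x := fun x hx =>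
    (hasFDerivAt_coneMap hX (hB0 x hx) z₀).hasFDerivWithinAt
  have hinj : InjOn (coneMap X z₀) B := (injOn_coneMap hX hz₀).mono hB0
  have hdet : ∀ x ∈ B, |(coneDeriv X z₀ x).det| =
      ε * ⟪areaVec X (radialProj x), X (radialProj x) - z₀⟫_ℝ := fun x hx => by
    have h1 : |ε| = 1 := by
      have := abs_mul_abs_self ε
      rw [hε1] at this
      nlinarith [abs_nonneg ε]
    rw [det_coneDeriv hX (hB0 x hx), ← abs_of_pos (hε (radialProj x)), abs_mul, h1, one_mul]
  have hae : (Ω \ {z₀} : Set E3) =ᵐ[volume] Ω := sdiff_null_ae_eq_self (measure_singleton z₀)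
  -- the integrand in polar coordinates
  set φ : S2 → ℝ → ℝ := fun y r => (Iic (1 : ℝ)).indicator
    (fun r => ε * ⟪areaVec X y, X y - z₀⟫_ℝ * g (z₀ + r • (X y - z₀))) r with hφ
  have hφB : ∀ᵐ x : E3, φ (radialProj x) ‖x‖ =
      B.indicator (fun x => |(coneDeriv X z₀ x).det| • g (coneMap X z₀ x)) x := by
    have hne : ∀ᵐ x : E3, x ≠ 0 := by simp [ae_iff]
    filter_upwards [hne] with x hx
    by_cases hx1 : ‖x‖ ≤ 1
    · have hxB : x ∈ B := ⟨by simpa using hx1, hx⟩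
      rw [indicator_of_mem hxB, hdet x hxB, hφ]
      simp only [indicator_of_mem (show ‖x‖ ∈ Iic (1 : ℝ) from hx1)]
      rfl
    · have hxB : x ∉ B := fun h => hx1 (by simpa using h.1)
      rw [indicator_of_notMem hxB, hφ]
      simp only [indicator_of_notMem (show ‖x‖ ∉ Iic (1 : ℝ) from hx1)]
  have hint : Integrable fun x => φ (radialProj x) ‖x‖ := by
    refine (integrable_congr hφB).2 ?_
    rw [integrable_indicator_iff hBm,
      ← integrableOn_image_iff_integrableOn_abs_det_fderiv_smul volume hBm hder hinj,
      image_coneMap hX hz₀, integrableOn_congr_set_ae hae]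
    exact hg.integrableOn_compact hX.isCompact
  have hint2 : Integrable (fun p : S2 × Ioi (0 : ℝ) => φ p.1 p.2)
      (sphereMeasure.prod (Measure.volumeIoiPow 2)) := by
    rw [← map_polar.integrable_comp_emb (Homeomorph.measurableEmbedding _)]
    have h1 : Integrable (fun x : ({(0)}ᶜ : Set E3) => φ (radialProj x.1) ‖x.1‖)
        ((volume : Measure E3).comap Subtype.val) :=
      (integrableOn_iff_comap_subtypeVal (measurableSet_singleton (0 : E3)).compl).1
        hint.integrableOn
    refine h1.congr (Eventually.of_forall fun x => ?_)
    simp only [Function.comp_apply, homeomorphUnitSphereProd_eq]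
  calc ∫ x in Ω, g x = ∫ x in coneMap X z₀ '' B, g x := by
        rw [image_coneMap hX hz₀, setIntegral_congr_set hae]
    _ = ∫ x in B, |(coneDeriv X z₀ x).det| • g (coneMap X z₀ x) :=
        integral_image_eq_integral_abs_det_fderiv_smul volume hBm hder hinj g
    _ = ∫ x, φ (radialProj x) ‖x‖ := by
        rw [← integral_indicator hBm]
        exact (integral_congr_ae hφB).symm
    _ = ∫ y : S2, (∫ r : Ioi (0 : ℝ), φ y r ∂(Measure.volumeIoiPow 2)) ∂sphereMeasure := by
        rw [integral_polar_prod, integral_prod _ hint2]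
    _ = _ := by
        refine integral_congr_ae (Eventually.of_forall fun y => ?_)
        simp only
        rw [integral_volumeIoiPow (φ y), intervalIntegral.integral_of_le zero_le_one,
          ← Ioi_inter_Iic, ← setIntegral_indicator measurableSet_Iic]
        refine setIntegral_congr_fun measurableSet_Ioi fun r _ => ?_
        by_cases hr : r ∈ Iic (1 : ℝ)
        · simp only [hφ, indicator_of_mem hr]
        · simp only [hφ, indicator_of_notMem hr, mul_zero]

omit hz₀ in
theorem continuousOn_segment {V : Type*} [TopologicalSpace V] {g : E3 → V} (hg : ContinuousOn g Ω)
    (hz : z₀ ∈ Ω) :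
    ContinuousOn (fun p : S2 × ℝ => g (z₀ + p.2 • (X p.1 - z₀))) (univ ×ˢ Icc 0 1) := by
  have h : Continuous fun p : S2 × ℝ => z₀ + p.2 • (X p.1 - z₀) := by
    have := hX.smooth.continuous
    fun_prop
  exact hg.comp h.continuousOn fun p hp => segment_mem hX hz p.1 hp.2.1 hp.2.2

/-- The **divergence theorem** for a convex body with smooth boundary. -/
theorem integral_divergence {U : Set E3} (hU : IsOpen U) (hΩU : Ω ⊆ U) {F : E3 → E3}
    (hF : ContDiffOn ℝ 1 F U) :
    ∫ x in Ω, divergence F x =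
      ∫ y : S2, ⟪F (X y), outerNormal X z₀ y⟫_ℝ * ‖areaVec X y‖ ∂sphereMeasure := by
  obtain ⟨ε, hε1, hε⟩ := exists_orientation hX hz₀
  have hz : z₀ ∈ Ω := interior_subset hz₀
  have hFd : ∀ x ∈ Ω, DifferentiableAt ℝ F x := fun x hx =>
    (hF.contDiffAt (hU.mem_nhds (hΩU hx))).differentiableAt one_ne_zero
  have hFc : ContinuousOn F Ω := hF.continuousOn.mono hΩU
  have hDc : ContinuousOn (fderiv ℝ F) Ω :=
    (hF.continuousOn_fderiv_of_isOpen hU le_rfl).mono hΩU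
  have hdiv : ContinuousOn (divergence F) Ω := by
    have : ∀ i : Fin 3, ContinuousOn (fun x => fderiv ℝ F x (e3 i) i) Ω := fun i =>
      (EuclideanSpace.proj (𝕜 := ℝ) i).continuous.comp_continuousOn
        (hDc.clm_apply continuousOn_const)
    exact ((this 0).add (this 1)).add (this 2)
  set N : S2 → E3 := fun y => areaVec X y
  have hNc : Continuous N := continuous_areaVec hX
  have hPc : Continuous fun y => X y - z₀ := hX.smooth.continuous.sub continuous_const
  -- the flux through the dilated surface, its derivative, and the divergence term
  set I₁ : S2 → ℝ → ℝ := fun y r => 2 * r * ⟪F (z₀ + r • (X y - z₀)), N y⟫_ℝ +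
    r ^ 2 * ⟪fderiv ℝ F (z₀ + r • (X y - z₀)) (X y - z₀), N y⟫_ℝ with hI₁
  set I₂ : S2 → ℝ → ℝ := fun y r =>
    r ^ 2 * (⟪N y, X y - z₀⟫_ℝ * divergence F (z₀ + r • (X y - z₀))) with hI₂
  have hc₁ : ContinuousOn (fun p : S2 × ℝ => I₁ p.1 p.2) (univ ×ˢ Icc 0 1) := by
    have h1 := continuousOn_segment hX hFc hz
    have h2 := continuousOn_segment hX hDc hz
    have h3 : ContinuousOn (fun p : S2 × ℝ => N p.1) (univ ×ˢ Icc 0 1) :=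
      (hNc.comp continuous_fst).continuousOn
    have h4 : ContinuousOn (fun p : S2 × ℝ => X p.1 - z₀) (univ ×ˢ Icc 0 1) :=
      (hPc.comp continuous_fst).continuousOn
    have h5 := h2.clm_apply h4
    exact ((by fun_prop : ContinuousOn (fun p : S2 × ℝ => 2 * p.2) _).mul (h1.inner h3)).add
      ((by fun_prop : ContinuousOn (fun p : S2 × ℝ => p.2 ^ 2) _).mul (h5.inner h3))
  have hc₂ : ContinuousOn (fun p : S2 × ℝ => I₂ p.1 p.2) (univ ×ˢ Icc 0 1) := by
    have h1 := continuousOn_segment hX hdiv hz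
    have h3 : ContinuousOn (fun p : S2 × ℝ => ⟪N p.1, X p.1 - z₀⟫_ℝ) (univ ×ˢ Icc 0 1) :=
      ((hNc.comp continuous_fst).inner (hPc.comp continuous_fst)).continuousOn
    exact (by fun_prop : ContinuousOn (fun p : S2 × ℝ => p.2 ^ 2) _).mul (h3.mul h1)
  have hsec : ∀ {I : S2 → ℝ → ℝ}, ContinuousOn (fun p : S2 × ℝ => I p.1 p.2) (univ ×ˢ Icc 0 1) →
      ∀ y, ContinuousOn (I y) (Icc 0 1) := fun h y =>
    h.comp (f := fun r : ℝ => (y, r)) (by fun_prop) fun r hr => ⟨mem_univ _, hr⟩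
  have hii : ∀ {I : S2 → ℝ → ℝ}, ContinuousOn (fun p : S2 × ℝ => I p.1 p.2) (univ ×ˢ Icc 0 1) →
      ∀ y, IntervalIntegrable (I y) volume 0 1 := fun h y =>
    (hsec h y).intervalIntegrable_of_Icc zero_le_one
  have hprod : ∀ {I : S2 → ℝ → ℝ}, ContinuousOn (fun p : S2 × ℝ => I p.1 p.2)
      (univ ×ˢ Icc 0 1) → Integrable (fun p : S2 × ℝ => I p.1 p.2)
      (sphereMeasure.prod (volume.restrict (Ioc 0 1))) := fun {I} h => by
    have h1 := h.integrableOn_compact (μ := sphereMeasure.prod volume)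
      (isCompact_univ.prod isCompact_Icc)
    have h2 := h1.mono_set (t := univ ×ˢ Icc 0 1) (s := univ ×ˢ Ioc 0 1)
      (prod_mono_right Ioc_subset_Icc_self)
    rwa [IntegrableOn, ← Measure.prod_restrict, Measure.restrict_univ] at h2
  -- the radial derivative of the flux
  have hftc : ∀ y, ∫ r in (0 : ℝ)..1, I₁ y r = ⟪F (X y), N y⟫_ℝ := fun y => by
    have hd : ∀ r ∈ uIcc (0 : ℝ) 1,
        HasDerivAt (fun r : ℝ => r ^ 2 * ⟪F (z₀ + r • (X y - z₀)), N y⟫_ℝ) (I₁ y r) r := by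
      intro r hr
      rw [uIcc_of_le zero_le_one] at hr
      have h1 : HasDerivAt (fun r : ℝ => z₀ + r • (X y - z₀)) (X y - z₀) r := by
        simpa using ((hasDerivAt_id r).smul_const (X y - z₀)).const_add z₀
      have h2 := (hFd _ (segment_mem hX hz y hr.1 hr.2)).hasFDerivAt.comp_hasDerivAt r h1
      have h3 := (hasDerivAt_pow 2 r).fun_mul (h2.inner ℝ (hasDerivAt_const r (N y)))
      refine h3.congr_deriv ?_
      simp [hI₁]
    rw [intervalIntegral.integral_eq_sub_of_hasDerivAt hd (hii hc₁ y)]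
    simp
  -- the difference is an exact form on the sphere, for each dilation factor
  have hzero : ∀ r ∈ Ioc (0 : ℝ) 1, ∫ y, (I₁ y r - I₂ y r) ∂sphereMeasure = 0 := by
    intro r hr
    have hP : RadialSmooth ∞ fun x => X (radialProj x) - z₀ :=
      ⟨hX.radialSmooth.1.sub contDiffOn_const, fun c hc x => by rw [radialProj_smul hc]⟩
    have hG : RadialSmooth 1 fun x => F (z₀ + r • (X (radialProj x) - z₀)) := by
      refine ⟨?_, fun c hc x => by rw [radialProj_smul hc]⟩
      refine hF.comp (contDiffOn_const.add (contDiffOn_const.fun_smul (hP.1.of_le one_le_infty))) ?_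
      exact fun x _ => hΩU (segment_mem hX hz _ hr.1.le hr.2)
    have hst := integral_wedgeInner_fderiv (radialSmooth_cross hG (hP.of_le one_le_infty))
      (hP.of_le two_le_infty)
    have heq : ∀ y : S2, I₁ y r - I₂ y r = r * wedgeInner y
        (fderiv ℝ (fun x => cross (F (z₀ + r • (X (radialProj x) - z₀)))
          (X (radialProj x) - z₀)) y)
        (fderiv ℝ (fun x => X (radialProj x) - z₀) y) := fun y => by
      rw [← flux_identity hX (hFd _ (segment_mem hX hz y hr.1.le hr.2))]
      simp only [hI₁, hI₂, N]
      ring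
    simp only [heq]
    rw [integral_const_mul, hst, mul_zero]
  have hdiff : ∫ y, (∫ r in (0 : ℝ)..1, (I₁ y r - I₂ y r)) ∂sphereMeasure = 0 := by
    simp only [intervalIntegral.integral_of_le zero_le_one]
    rw [integral_integral_swap (hprod (hc₁.sub hc₂)),
      setIntegral_congr_fun measurableSet_Ioc hzero, integral_zero]
  have hint₁ : Integrable (fun y => ∫ r in (0 : ℝ)..1, I₁ y r) sphereMeasure := by
    simp only [hftc]
    exact integrable_of_continuous ((hFc.comp_continuous hX.smooth.continuous
      (surface_mem hX)).inner hNc)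
  have hint₂ : Integrable (fun y => ∫ r in (0 : ℝ)..1, I₂ y r) sphereMeasure := by
    simp only [intervalIntegral.integral_of_le zero_le_one]
    exact (hprod hc₂).integral_prod_left
  have hsub : ∀ y, ∫ r in (0 : ℝ)..1, (I₁ y r - I₂ y r) =
      (∫ r in (0 : ℝ)..1, I₁ y r) - ∫ r in (0 : ℝ)..1, I₂ y r := fun y =>
    intervalIntegral.integral_sub (hii hc₁ y) (hii hc₂ y)
  simp only [hsub] at hdiff
  rw [integral_sub hint₁ hint₂, sub_eq_zero] at hdiff
  simp only [hftc] at hdiff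
  rw [integral_eq_integral_cone hX hz₀ (fun y => (hε y).2) hε1 hdiv]
  have e1 : ∀ y : S2, ∫ r in (0 : ℝ)..1, r ^ 2 * (ε * ⟪areaVec X y, X y - z₀⟫_ℝ *
      divergence F (z₀ + r • (X y - z₀))) = ε * ∫ r in (0 : ℝ)..1, I₂ y r := fun y => by
    rw [← intervalIntegral.integral_const_mul]
    congr 1
    funext r
    simp only [hI₂, N]; ring
  have e2 : ∀ y : S2, ⟪F (X y), outerNormal X z₀ y⟫_ℝ * ‖areaVec X y‖ =
      ε * ⟪F (X y), N y⟫_ℝ := fun y => by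
    simp only [N]
    conv_rhs => rw [(hε y).1]
    rw [inner_smul_right, ← mul_assoc, ← mul_assoc, hε1]; ring
  simp only [e1, e2]
  rw [integral_const_mul, integral_const_mul, hdiff]

end Surface

/-! ### The second fundamental form of a convex surface -/

section Surface

variable {Ω : Set E3} {X : S2 → E3} (hX : IsConvexSphere Ω X)
include hX

theorem hasFDerivAt_surface {x : E3} (hx : x ≠ 0) :
    HasFDerivAt (X ∘ radialProj) (surfDeriv X x) x :=
  (hX.radialSmooth.differentiableAt one_le_infty hx).hasFDerivAt

theorem hasFDerivAt_surfDeriv_apply {x : E3} (hx : x ≠ 0) (v : E3) :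
    HasFDerivAt (fun z => surfDeriv X z v) ((fderiv ℝ (surfDeriv X) x).flip v) x := by
  have h : DifferentiableAt ℝ (surfDeriv X) x :=
    ((contDiffOn_surfDeriv hX).contDiffAt (isOpen_compl_singleton.mem_nhds hx)).differentiableAt
      (by norm_num)
  exact (h.hasFDerivAt.clm_apply (hasFDerivAt_const v x)).congr_fderiv (by ext; simp)

theorem fderiv_surfDeriv_symm {x : E3} (hx : x ≠ 0) (u v : E3) :
    fderiv ℝ (surfDeriv X) x u v = fderiv ℝ (surfDeriv X) x v u :=
  ((hX.radialSmooth.contDiffAt hx).of_le two_le_infty).isSymmSndFDerivAt (by simp) u v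

theorem surfDeriv_eq_smul {x : E3} (hx : x ≠ 0) :
    surfDeriv X x = ‖x‖⁻¹ • surfDeriv X (radialProj x) := by
  have h := hX.radialSmooth.fderiv_smul one_le_infty (c := ‖x‖) (by positivity)
    (coe_S2_ne_zero (radialProj x))
  rw [norm_smul_radialProj hx] at h
  exact h

variable {z₀ : E3} (hz₀ : z₀ ∈ interior Ω)
include hz₀

theorem hasFDerivAt_normal {x : E3} (hx : x ≠ 0) :
    HasFDerivAt (fun z => outerNormal X z₀ (radialProj z)) (normalDeriv X z₀ x) x :=
  ((radialSmooth_outerNormal hX hz₀).differentiableAt one_le_infty hx).hasFDerivAt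

theorem inner_normal_surfDeriv {x : E3} (hx : x ≠ 0) (u : E3) :
    ⟪outerNormal X z₀ (radialProj x), surfDeriv X x u⟫_ℝ = 0 := by
  rw [surfDeriv_eq_smul hX hx, smul_apply, inner_smul_right,
    inner_outerNormal_surfDeriv hX hz₀, mul_zero]

theorem inner_normal_normalDeriv {x : E3} (hx : x ≠ 0) (u : E3) :
    ⟪outerNormal X z₀ (radialProj x), normalDeriv X z₀ x u⟫_ℝ = 0 := by
  have h := hasFDerivAt_normal hX hz₀ hx
  have h1 := (h.inner ℝ h).fderiv
  have h2 : (fun z => ⟪outerNormal X z₀ (radialProj z), outerNormal X z₀ (radialProj z)⟫_ℝ) =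
      fun _ => (1 : ℝ) := by
    funext z
    rw [real_inner_self_eq_norm_sq, norm_outerNormal hX hz₀, one_pow]
  rw [h2] at h1
  have h3 := congrArg (fun A : E3 →L[ℝ] ℝ => A u) h1
  simp [fderivInnerCLM_apply] at h3
  rw [real_inner_comm (outerNormal X z₀ (radialProj x))] at h3
  linarith

/-- The second fundamental form is symmetric. -/
theorem secondFundamental_symm {x : E3} (hx : x ≠ 0) (u v : E3) :
    ⟪normalDeriv X z₀ x u, surfDeriv X x v⟫_ℝ = ⟪normalDeriv X z₀ x v, surfDeriv X x u⟫_ℝ := by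
  have key : ∀ u v, ⟪outerNormal X z₀ (radialProj x), fderiv ℝ (surfDeriv X) x u v⟫_ℝ +
      ⟪normalDeriv X z₀ x u, surfDeriv X x v⟫_ℝ = 0 := fun u v => by
    have h1 := ((hasFDerivAt_normal hX hz₀ hx).inner ℝ (hasFDerivAt_surfDeriv_apply hX hx v))
    have h2 : (fun z => ⟪outerNormal X z₀ (radialProj z), surfDeriv X z v⟫_ℝ) =ᶠ[𝓝 x]
        fun _ => (0 : ℝ) := by
      filter_upwards [isOpen_compl_singleton.mem_nhds hx] with z hz
      exact inner_normal_surfDeriv hX hz₀ hz v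
    have h3 := h1.unique ((hasFDerivAt_const (0 : ℝ) x).congr_of_eventuallyEq h2)
    have h4 := congrArg (fun A : E3 →L[ℝ] ℝ => A u) h3
    simpa [fderivInnerCLM_apply] using h4
  have h1 := key u v
  have h2 := key v u
  rw [fderiv_surfDeriv_symm hX hx] at h1
  linarith

/-- The second fundamental form of a convex surface is nonnegative: the outward unit normal is a
monotone function of the position. -/
theorem secondFundamental_nonneg {x : E3} (hx : x ≠ 0) (u : E3) :
    0 ≤ ⟪normalDeriv X z₀ x u, surfDeriv X x u⟫_ℝ := by
  have h1 : HasDerivAt (fun t : ℝ => outerNormal X z₀ (radialProj (x + t • u)))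
      (normalDeriv X z₀ x u) 0 := (hasFDerivAt_normal hX hz₀ hx).hasLineDerivAt u
  have h2 : HasDerivAt (fun t : ℝ => (X ∘ radialProj) (x + t • u))
      (surfDeriv X x u) 0 := (hasFDerivAt_surface hX hx).hasLineDerivAt u
  have h3 := h1.tendsto_slope.inner (𝕜 := ℝ) h2.tendsto_slope
  refine ge_of_tendsto h3 (Eventually.of_forall fun t => ?_)
  simp only [slope, vsub_eq_sub, sub_zero, zero_smul, add_zero, Function.comp_apply,
    inner_smul_left, inner_smul_right, RCLike.conj_to_real, ← mul_assoc]
  refine mul_nonneg (mul_self_nonneg _) ?_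
  set p := radialProj (x + t • u)
  set q := radialProj x
  have k1 := inner_outerNormal_le hX hz₀ p (surface_mem hX q)
  have k2 := inner_outerNormal_le hX hz₀ q (surface_mem hX p)
  simp only [inner_sub_left, inner_sub_right]
  linarith

theorem secondFundamental_frame (y : S2) :
    ⟪normalFrame X z₀ y 0, surfFrame X y 1⟫_ℝ = ⟪normalFrame X z₀ y 1, surfFrame X y 0⟫_ℝ ∧
    ∀ s t : ℝ, 0 ≤ s ^ 2 * ⟪normalFrame X z₀ y 0, surfFrame X y 0⟫_ℝ +
      2 * s * t * ⟪normalFrame X z₀ y 0, surfFrame X y 1⟫_ℝ +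
      t ^ 2 * ⟪normalFrame X z₀ y 1, surfFrame X y 1⟫_ℝ := by
  have hs := secondFundamental_symm hX hz₀ (coe_S2_ne_zero y) (sphereFrame y 0) (sphereFrame y 1)
  refine ⟨hs, fun s t => ?_⟩
  have h := secondFundamental_nonneg hX hz₀ (coe_S2_ne_zero y)
    (s • sphereFrame y 0 + t • sphereFrame y 1)
  simp only [map_add, map_smul, inner_add_left, inner_add_right, inner_smul_left,
    inner_smul_right, RCLike.conj_to_real] at h
  rw [← hs] at h
  simp only [normalFrame, surfFrame]
  linarith

omit hX hz₀ in
/-- The difference of two nonnegative quadratic forms of equal determinant is indefinite. -/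
theorem det_sub_nonpos {a b c a' b' c' : ℝ}
    (h : ∀ s t : ℝ, 0 ≤ s ^ 2 * a + 2 * s * t * b + t ^ 2 * c)
    (h' : ∀ s t : ℝ, 0 ≤ s ^ 2 * a' + 2 * s * t * b' + t ^ 2 * c')
    (hd : a * c - b * b = a' * c' - b' * b') :
    (a' - a) * (c' - c) - (b' - b) * (b' - b) ≤ 0 := by
  have ha : 0 ≤ a := by simpa using h 1 0
  have hc : 0 ≤ c := by simpa using h 0 1
  have ha' : 0 ≤ a' := by simpa using h' 1 0
  have hc' : 0 ≤ c' := by simpa using h' 0 1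
  -- nonnegative determinants
  have hK : 0 ≤ a * c - b * b := by
    have h1 : discrim a (2 * b) c ≤ 0 := discrim_le_zero fun x => by
      have := h x 1
      linarith
    rw [discrim] at h1
    linarith
  -- `a c' + a' c ≥ 2 √((a c') (a' c)) ≥ 2 (K + |b b'|)`
  have h1 : ((a * c - b * b) + |b * b'|) ^ 2 ≤ (a * c') * (a' * c) := by
    have e : (a * c') * (a' * c) = ((a * c - b * b) + b * b) * ((a' * c' - b' * b') + b' * b') := by
      ring
    rw [e, ← hd]
    have h2 : |b * b'| ^ 2 = (b * b) * (b' * b') := by rw [sq_abs]; ring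
    have h3 : 2 * |b * b'| ≤ b * b + b' * b' := by
      rw [abs_mul]
      nlinarith [sq_nonneg (|b| - |b'|), abs_mul_abs_self b, abs_mul_abs_self b']
    nlinarith [mul_le_mul_of_nonneg_left h3 hK]
  have h4 : (2 * ((a * c - b * b) + |b * b'|)) ^ 2 ≤ (a * c' + a' * c) ^ 2 := by
    nlinarith [sq_nonneg (a * c' - a' * c)]
  have h5 := abs_le_of_sq_le_sq' h4 (by positivity)
  have h6 := le_abs_self (b * b')
  nlinarith [h5.2]

end Surface

/-! ### The rotation field of an isometry of convex surfaces -/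

/-- The linear map that sends the tangent plane of the unit sphere at `x` to the tangent plane of
the surface by the differential and `x` to the outward unit normal. -/
def framingMap (X : S2 → E3) (z₀ x : E3) : E3 →L[ℝ] E3 :=
  surfDeriv X x + (innerSL ℝ x).smulRight (outerNormal X z₀ (radialProj x))

/-- The linear map that carries the tangent planes and the outward unit normals of the surface `X`
to those of the surface `Y`. It is a field of orthogonal maps if the surfaces are isometric. -/
def rotationField (X : S2 → E3) (z₀ : E3) (Y : S2 → E3) (z₁ : E3) (x : E3) : E3 →L[ℝ] E3 :=
  (framingMap Y z₁ (radialProj x)).comp (framingMap X z₀ (radialProj x)).inverse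

theorem framingMap_apply (X : S2 → E3) (z₀ : E3) (y : S2) (v : E3) :
    framingMap X z₀ y v = surfDeriv X y v + ⟪(y : E3), v⟫_ℝ • outerNormal X z₀ y := by
  rw [framingMap, radialProj_coe]; rfl

section Surface

variable {Ω : Set E3} {X : S2 → E3} (hX : IsConvexSphere Ω X)
include hX
variable {z₀ : E3} (hz₀ : z₀ ∈ interior Ω)
include hz₀

theorem exists_framingEquiv (y : S2) :
    ∃ e : E3 ≃L[ℝ] E3, (e : E3 →L[ℝ] E3) = framingMap X z₀ y := by
  have hinj : Function.Injective (framingMap X z₀ y).toLinearMap := by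
    rw [injective_iff_map_eq_zero]
    intro a ha
    have ha : framingMap X z₀ y a = 0 := ha
    rw [framingMap_apply] at ha
    have h1 := congrArg (fun w => ⟪outerNormal X z₀ y, w⟫_ℝ) ha
    simp only [inner_add_right, inner_outerNormal_surfDeriv hX hz₀, inner_smul_right,
      real_inner_self_eq_norm_sq, norm_outerNormal hX hz₀, inner_zero_right] at h1
    have h2 : ⟪(y : E3), a⟫_ℝ = 0 := by linarith
    rw [h2, zero_smul, add_zero] at ha
    exact surfDeriv_injective hX y h2 ha
  refine ⟨(LinearEquiv.ofInjectiveEndo _ hinj).toContinuousLinearEquiv, ?_⟩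
  ext v
  rfl

theorem contDiffOn_framingMap : ContDiffOn ℝ ∞ (framingMap X z₀) {0}ᶜ := by
  refine (contDiffOn_surfDeriv hX).add ?_
  exact ((innerSL ℝ : E3 →L[ℝ] E3 →L[ℝ] ℝ).contDiff.contDiffOn).smulRight
    (contDiffOn_outerNormal hX hz₀)

theorem framingMap_surjective (y : S2) : Function.Surjective (framingMap X z₀ y) := by
  obtain ⟨e, he⟩ := exists_framingEquiv hX hz₀ y
  intro w
  exact ⟨e.symm w, by rw [← he]; simp⟩

theorem inverse_framingMap_apply (y : S2) (v : E3) :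
    (framingMap X z₀ y).inverse (framingMap X z₀ y v) = v := by
  obtain ⟨e, he⟩ := exists_framingEquiv hX hz₀ y
  rw [← he, ContinuousLinearMap.inverse_equiv]
  simp

/-- Tangent vectors of a surface are values of the differential. -/
theorem exists_surfDeriv_eq {x : E3} (hx : x ≠ 0) {w : E3}
    (hw : ⟪outerNormal X z₀ (radialProj x), w⟫_ℝ = 0) : ∃ v, surfDeriv X x v = w := by
  have hn : ‖x‖ ≠ 0 := by simpa using hx
  obtain ⟨a, ha⟩ := framingMap_surjective hX hz₀ (radialProj x) w
  rw [framingMap_apply] at ha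
  have h1 := congrArg (fun w => ⟪outerNormal X z₀ (radialProj x), w⟫_ℝ) ha
  simp only [inner_add_right, inner_outerNormal_surfDeriv hX hz₀, inner_smul_right,
    real_inner_self_eq_norm_sq, norm_outerNormal hX hz₀, hw] at h1
  have h2 : ⟪(radialProj x : E3), a⟫_ℝ = 0 := by linarith
  rw [h2, zero_smul, add_zero] at ha
  refine ⟨‖x‖ • a, ?_⟩
  rw [surfDeriv_eq_smul hX hx, smul_apply, map_smul, smul_smul, inv_mul_cancel₀ hn, one_smul, ha]

end Surface

section Pair

variable {Ω Ω' : Set E3} {X Y : S2 → E3} (hX : IsConvexSphere Ω X) (hY : IsConvexSphere Ω' Y)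
  {z₀ z₁ : E3} (hz₀ : z₀ ∈ interior Ω) (hz₁ : z₁ ∈ interior Ω')
include hX hY hz₀ hz₁

theorem radialSmooth_rotationField : RadialSmooth ∞ (rotationField X z₀ Y z₁) := by
  have hMX := (radialSmooth_comp_radialProj (contDiffOn_framingMap hX hz₀)).1
  have hMY := (radialSmooth_comp_radialProj (contDiffOn_framingMap hY hz₁)).1
  refine ⟨hMY.clm_comp fun x hx => ?_, fun c hc x => by
    rw [rotationField, rotationField, radialProj_smul hc]⟩
  obtain ⟨e, he⟩ := exists_framingEquiv hX hz₀ (radialProj x)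
  have h1 : ContDiffAt ℝ ∞ ContinuousLinearMap.inverse (framingMap X z₀ (radialProj x)) := by
    rw [← he]; exact contDiffAt_map_inverse e
  exact h1.comp_contDiffWithinAt x (hMX x hx)

omit hY hz₁ in
theorem rotationField_framingMap (x v : E3) :
    rotationField X z₀ Y z₁ x (framingMap X z₀ (radialProj x) v) =
      framingMap Y z₁ (radialProj x) v := by
  rw [rotationField, ContinuousLinearMap.comp_apply, inverse_framingMap_apply hX hz₀]

omit hz₁ in
theorem rotationField_normal (x : E3) :
    rotationField X z₀ Y z₁ x (outerNormal X z₀ (radialProj x)) =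
      outerNormal Y z₁ (radialProj x) := by
  have h := rotationField_framingMap (Y := Y) (z₁ := z₁) hX hz₀ x (radialProj x)
  rw [framingMap_apply, framingMap_apply, surfDeriv_self hX (coe_S2_ne_zero _),
    surfDeriv_self hY (coe_S2_ne_zero _), real_inner_self_eq_norm_sq, norm_coe_S2] at h
  simpa using h

omit hz₁ in
theorem rotationField_surfDeriv {x : E3} (hx : x ≠ 0) (v : E3) :
    rotationField X z₀ Y z₁ x (surfDeriv X x v) = surfDeriv Y x v := by
  have h := rotationField_framingMap (Y := Y) (z₁ := z₁) hX hz₀ x v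
  rw [framingMap_apply, framingMap_apply, map_add, map_smul,
    rotationField_normal hX hY hz₀] at h
  rw [surfDeriv_eq_smul hX hx, surfDeriv_eq_smul hY hx, smul_apply, smul_apply, map_smul,
    add_right_cancel h]

variable (hiso : ∀ y, firstForm flatMetric Y y = firstForm flatMetric X y)
include hiso

omit hz₀ hz₁ in
theorem inner_surfDeriv_eq (y : S2) (v w : E3) :
    ⟪surfDeriv Y y v, surfDeriv Y y w⟫_ℝ = ⟪surfDeriv X y v, surfDeriv X y w⟫_ℝ := by
  have h : ∀ i j, ⟪surfDeriv Y y (sphereFrame y i), surfDeriv Y y (sphereFrame y j)⟫_ℝ =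
      ⟪surfDeriv X y (sphereFrame y i), surfDeriv X y (sphereFrame y j)⟫_ℝ := fun i j => by
    have := congrArg (fun M : Matrix (Fin 2) (Fin 2) ℝ => M i j) (hiso y)
    rwa [firstForm_flat hX, firstForm_flat hY] at this
  obtain ⟨r, s, t, rfl⟩ := exists_coords y v
  obtain ⟨r', s', t', rfl⟩ := exists_coords y w
  simp only [map_add, map_smul, surfDeriv_self hX (coe_S2_ne_zero y),
    surfDeriv_self hY (coe_S2_ne_zero y), inner_add_left, inner_add_right, inner_smul_left,
    inner_smul_right, h, smul_zero, inner_zero_left, inner_zero_right]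

theorem inner_rotationField (x a b : E3) :
    ⟪rotationField X z₀ Y z₁ x a, rotationField X z₀ Y z₁ x b⟫_ℝ = ⟪a, b⟫_ℝ := by
  obtain ⟨v, rfl⟩ := framingMap_surjective hX hz₀ (radialProj x) a
  obtain ⟨w, rfl⟩ := framingMap_surjective hX hz₀ (radialProj x) b
  rw [rotationField_framingMap hX hz₀, rotationField_framingMap hX hz₀]
  simp only [framingMap_apply, inner_add_left, inner_add_right, inner_smul_left, inner_smul_right,
    RCLike.conj_to_real, inner_surfDeriv_eq hX hY hiso, inner_outerNormal_surfDeriv hX hz₀,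
    inner_outerNormal_surfDeriv hY hz₁, real_inner_self_eq_norm_sq, norm_outerNormal hX hz₀,
    norm_outerNormal hY hz₁, real_inner_comm (outerNormal X z₀ (radialProj x)),
    real_inner_comm (outerNormal Y z₁ (radialProj x))]

omit hX hY hz₀ hz₁ hiso in
/-- An inner product preserving endomorphism of three-space is determined by its inner products
against its own values. -/
theorem eq_of_inner_rotation {R : E3 →L[ℝ] E3} (hR : ∀ a b, ⟪R a, R b⟫_ℝ = ⟪a, b⟫_ℝ) {p q : E3}
    (h : ∀ b, ⟪p, R b⟫_ℝ = ⟪q, R b⟫_ℝ) : p = q := by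
  have hinj : Function.Injective R.toLinearMap := by
    rw [injective_iff_map_eq_zero]
    intro a ha
    have ha : R a = 0 := ha
    have := hR a a
    rw [ha, inner_zero_left] at this
    exact inner_self_eq_zero.1 this.symm
  obtain ⟨b, hb⟩ := (LinearMap.injective_iff_surjective.1 hinj) (p - q)
  have hb : R b = p - q := hb
  have h1 := h b
  rw [hb, ← sub_eq_zero, ← inner_sub_left, inner_self_eq_zero, sub_eq_zero] at h1
  exact h1

end Pair

/-- The angular velocity of a field `R` of orthogonal maps: `R' u = R ∘ (η × ·)`. -/
def angularVelocity (R : E3 → E3 →L[ℝ] E3) (x u : E3) : E3 :=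
  !₂[⟪fderiv ℝ R x u (e3 1), R x (e3 2)⟫_ℝ, ⟪fderiv ℝ R x u (e3 2), R x (e3 0)⟫_ℝ,
    ⟪fderiv ℝ R x u (e3 0), R x (e3 1)⟫_ℝ]

theorem fderiv_eq_rotation_cross {R : E3 → E3 →L[ℝ] E3} {x : E3} (hd : DifferentiableAt ℝ R x)
    (hR : ∀ z a b, ⟪R z a, R z b⟫_ℝ = ⟪a, b⟫_ℝ) (u a : E3) :
    fderiv ℝ R x u a = R x (cross (angularVelocity R x u) a) := by
  have hskew : ∀ a b, ⟪fderiv ℝ R x u a, R x b⟫_ℝ = - ⟪fderiv ℝ R x u b, R x a⟫_ℝ := fun a b => by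
    have h1 := ((hd.hasFDerivAt.clm_apply (hasFDerivAt_const a x)).inner ℝ
      (hd.hasFDerivAt.clm_apply (hasFDerivAt_const b x))).fderiv
    have h2 : (fun z => ⟪R z a, R z b⟫_ℝ) = fun _ => ⟪a, b⟫_ℝ := funext fun z => hR z a b
    rw [h2] at h1
    have h3 := congrArg (fun A : E3 →L[ℝ] ℝ => A u) h1
    simp [fderivInnerCLM_apply] at h3
    rw [real_inner_comm] at h3
    linarith
  have hdiag : ∀ a, ⟪fderiv ℝ R x u a, R x a⟫_ℝ = 0 := fun a => by linarith [hskew a a]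
  refine eq_of_inner_rotation (hR x) fun b => ?_
  rw [hR x]
  have w0 : angularVelocity R x u 0 = ⟪fderiv ℝ R x u (e3 1), R x (e3 2)⟫_ℝ := rfl
  have w1 : angularVelocity R x u 1 = ⟪fderiv ℝ R x u (e3 2), R x (e3 0)⟫_ℝ := rfl
  have w2 : angularVelocity R x u 2 = ⟪fderiv ℝ R x u (e3 0), R x (e3 1)⟫_ℝ := rfl
  rw [map_eq_sum_e3 (fderiv ℝ R x u) a, map_eq_sum_e3 (R x) b]
  simp only [inner_add_left, inner_add_right, inner_smul_left, inner_smul_right,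
    RCLike.conj_to_real, hdiag]
  rw [hskew (e3 1) (e3 0), hskew (e3 2) (e3 1), hskew (e3 0) (e3 2), ← w0, ← w1, ← w2]
  simp only [inner_eq_sum_three, cross_zero_coord, cross_one_coord, cross_two_coord]
  ring

/-- The contraction over an orthonormal basis that turns products of rotation derivatives into
angular velocities. -/
theorem sum_inner_cross (w w' Z Z' : E3) :
    ∑ j, ⟪cross w (cross Z (e3 j)) + cross Z' (e3 j), cross w' (e3 j)⟫_ℝ =
      2 * ⟪Z', w'⟫_ℝ - det3 Z w w' := by
  simp only [Fin.sum_univ_three, det3_eq, inner_eq_sum_three, PiLp.add_apply, cross_zero_coord,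
    cross_one_coord, cross_two_coord]
  simp
  ring

section Rotation

variable {R : E3 → E3 →L[ℝ] E3} (hRs : RadialSmooth ∞ R)
  (hR : ∀ z a b, ⟪R z a, R z b⟫_ℝ = ⟪a, b⟫_ℝ)
include hRs

theorem hasFDerivAt_rotation_apply {x : E3} (hx : x ≠ 0) {Z : E3 → E3} {Z' : E3 →L[ℝ] E3}
    (hZ : HasFDerivAt Z Z' x) :
    HasFDerivAt (fun z => R z (Z z)) ((R x).comp Z' + (fderiv ℝ R x).flip (Z x)) x :=
  (hRs.differentiableAt one_le_infty hx).hasFDerivAt.clm_apply hZ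

theorem hasFDerivAt_rotation_cross {x : E3} (hx : x ≠ 0) {Z : E3 → E3} {Z' : E3 →L[ℝ] E3}
    (hZ : HasFDerivAt Z Z' x) (a : E3) :
    HasFDerivAt (fun z => R z (cross (Z z) a))
      ((R x).comp ((crossL.flip a).comp Z') + (fderiv ℝ R x).flip (cross (Z x) a)) x :=
  hasFDerivAt_rotation_apply hRs hx ((crossL.flip a).hasFDerivAt.comp x hZ)

include hR

/-- The exterior derivative of the one-form `∑ⱼ ⟪R (Z × eⱼ), dR eⱼ⟫ = 2 ⟪Z, η⟫`, evaluated without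
antisymmetrization. -/
theorem sum_inner_fderiv_rotation {x : E3} (hx : x ≠ 0) {Z : E3 → E3} {Z' : E3 →L[ℝ] E3}
    (hZ : HasFDerivAt Z Z' x) (u v : E3) :
    ∑ j, ⟪fderiv ℝ (fun z => R z (cross (Z z) (e3 j))) x u, fderiv ℝ (fun z => R z (e3 j)) x v⟫_ℝ =
      2 * ⟪Z' u, angularVelocity R x v⟫_ℝ -
        det3 (Z x) (angularVelocity R x u) (angularVelocity R x v) := by
  have hd := hRs.differentiableAt one_le_infty hx
  rw [← sum_inner_cross]
  refine Finset.sum_congr rfl fun j _ => ?_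
  have h1 := hasFDerivAt_rotation_apply hRs hx (hasFDerivAt_const (e3 j) x)
  rw [(hasFDerivAt_rotation_cross hRs hx hZ (e3 j)).fderiv, h1.fderiv]
  simp only [add_apply, ContinuousLinearMap.comp_apply, ContinuousLinearMap.flip_apply,
    crossL_apply, zero_apply, map_zero, zero_add, fderiv_eq_rotation_cross hd hR]
  rw [← map_add, hR, add_comm]

/-- If the field `Z` is everywhere orthogonal to the angular velocities, the exterior derivative
of the one-form `⟪Z, η⟫` vanishes. -/
theorem structure_equation {x : E3} (hx : x ≠ 0) {Z : E3 → E3} {Z' : E3 →L[ℝ] E3}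
    (hZ : HasFDerivAt Z Z' x) (hZw : ∀ z, z ≠ 0 → ∀ u, ⟪Z z, angularVelocity R z u⟫_ℝ = 0)
    (u v : E3) :
    ⟪Z' u, angularVelocity R x v⟫_ℝ - ⟪Z' v, angularVelocity R x u⟫_ℝ =
      det3 (Z x) (angularVelocity R x u) (angularVelocity R x v) := by
  have hβ : ∀ a, ContDiffAt ℝ 2 (fun z => R z a) x := fun a =>
    ((hRs.contDiffAt hx).of_le two_le_infty).clm_apply contDiffAt_const
  have hβ' : ∀ a w, HasFDerivAt (fun z => fderiv ℝ (fun z => R z a) z w)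
      ((fderiv ℝ (fderiv ℝ (fun z => R z a)) x).flip w) x := fun a w => by
    have h : DifferentiableAt ℝ (fderiv ℝ (fun z => R z a)) x :=
      ((hβ a).fderiv_right (m := 1) (by norm_num)).differentiableAt one_ne_zero
    exact (h.hasFDerivAt.clm_apply (hasFDerivAt_const w x)).congr_fderiv (by ext; simp)
  -- the one-form vanishes identically
  have hzero : ∀ w, (fun z => ∑ j, ⟪R z (cross (Z z) (e3 j)), fderiv ℝ (fun z => R z (e3 j)) z w⟫_ℝ)
      =ᶠ[𝓝 x] fun _ => 0 := fun w => by
    filter_upwards [isOpen_compl_singleton.mem_nhds hx] with z hz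
    have hd := hRs.differentiableAt one_le_infty hz
    have h1 : ∀ j, ⟪R z (cross (Z z) (e3 j)), fderiv ℝ (fun z => R z (e3 j)) z w⟫_ℝ =
        ⟪cross 0 (cross (Z z) (e3 j)) + cross (Z z) (e3 j),
          cross (angularVelocity R z w) (e3 j)⟫_ℝ := fun j => by
      rw [(hasFDerivAt_rotation_apply hRs hz (hasFDerivAt_const (e3 j) z)).fderiv]
      simp only [add_apply, ContinuousLinearMap.comp_apply, ContinuousLinearMap.flip_apply,
        zero_apply, map_zero, zero_add, fderiv_eq_rotation_cross hd hR, hR]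
      congr 1
      apply E3_ext <;> simp
    simp only [h1]
    rw [sum_inner_cross, hZw z hz]
    simp [det3_eq]
  have key : ∀ u v, ∑ j, (⟪R x (cross (Z x) (e3 j)),
        fderiv ℝ (fderiv ℝ (fun z => R z (e3 j))) x u v⟫_ℝ +
      ⟪fderiv ℝ (fun z => R z (cross (Z z) (e3 j))) x u,
        fderiv ℝ (fun z => R z (e3 j)) x v⟫_ℝ) = 0 := fun u v => by
    have h1 := HasFDerivAt.fun_sum (u := Finset.univ) fun (j : Fin 3) _ =>
      (hasFDerivAt_rotation_cross hRs hx hZ (e3 j)).inner ℝ (hβ' (e3 j) v)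
    have h2 := h1.unique ((hasFDerivAt_const (0 : ℝ) x).congr_of_eventuallyEq (hzero v))
    have h3 := congrArg (fun A : E3 →L[ℝ] ℝ => A u) h2
    simp only [(hasFDerivAt_rotation_cross hRs hx hZ _).fderiv]
    simpa [fderivInnerCLM_apply, sum_apply] using h3
  have h1 := key u v
  have h2 := key v u
  rw [Finset.sum_add_distrib, sum_inner_fderiv_rotation hRs hR hx hZ] at h1 h2
  have h3 : ∑ j, ⟪R x (cross (Z x) (e3 j)),
        fderiv ℝ (fderiv ℝ (fun z => R z (e3 j))) x u v⟫_ℝ =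
      ∑ j, ⟪R x (cross (Z x) (e3 j)),
        fderiv ℝ (fderiv ℝ (fun z => R z (e3 j))) x v u⟫_ℝ :=
    Finset.sum_congr rfl fun j _ => by rw [(hβ (e3 j)).isSymmSndFDerivAt (by simp) u v]
  have h4 : det3 (Z x) (angularVelocity R x v) (angularVelocity R x u) =
      - det3 (Z x) (angularVelocity R x u) (angularVelocity R x v) := by
    simp only [det3_eq]; ring
  rw [h3] at h1
  rw [h4] at h2
  linarith

end Rotation

/-! ### Herglotz's integral inequality and the rigidity of total mean curvature -/

theorem det3_cross_left (n w x : E3) :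
    det3 n (cross w n) x = ⟪n, n⟫_ℝ * ⟪x, w⟫_ℝ - ⟪x, n⟫_ℝ * ⟪w, n⟫_ℝ := by
  simp only [det3_eq, inner_eq_sum_three, cross_zero_coord, cross_one_coord, cross_two_coord]
  ring

theorem det3_cross_right (n w x : E3) :
    det3 n x (cross w n) = ⟪x, n⟫_ℝ * ⟪w, n⟫_ℝ - ⟪n, n⟫_ℝ * ⟪x, w⟫_ℝ := by
  simp only [det3_eq, inner_eq_sum_three, cross_zero_coord, cross_one_coord, cross_two_coord]
  ring

theorem inner_cross_cross_cross (n a b c : E3) :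
    ⟪cross (cross a n) (cross b n), c⟫_ℝ = det3 n a b * ⟪n, c⟫_ℝ := by
  simp only [det3_eq, inner_eq_sum_three, cross_zero_coord, cross_one_coord, cross_two_coord]
  ring

theorem inner_cross_right (a b c : E3) : ⟪cross a b, c⟫_ℝ = det3 c a b := by
  simp only [det3_eq, inner_eq_sum_three, cross_zero_coord, cross_one_coord, cross_two_coord]
  ring

section Pair

variable {Ω Ω' : Set E3} {X Y : S2 → E3} (hX : IsConvexSphere Ω X) (hY : IsConvexSphere Ω' Y)
  {z₀ z₁ : E3} (hz₀ : z₀ ∈ interior Ω) (hz₁ : z₁ ∈ interior Ω')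
  (hiso : ∀ y, firstForm flatMetric Y y = firstForm flatMetric X y)
include hX hY hz₀ hz₁ hiso

/-- The angular velocity is tangent to the surface. This expresses that the rotation field
intertwines the differentials of two maps, whose second derivatives are symmetric. -/
theorem inner_normal_angularVelocity {x : E3} (hx : x ≠ 0) (u : E3) :
    ⟪outerNormal X z₀ (radialProj x),
      angularVelocity (rotationField X z₀ Y z₁) x u⟫_ℝ = 0 := by
  have hRs := radialSmooth_rotationField hX hY hz₀ hz₁
  have hR := inner_rotationField hX hY hz₀ hz₁ hiso
  set R := rotationField X z₀ Y z₁
  set η := angularVelocity R x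
  set ν := outerNormal X z₀ (radialProj x)
  have hd := hRs.differentiableAt one_le_infty hx
  have h1 : ∀ u v, R x (fderiv ℝ (surfDeriv X) x u v + cross (η u) (surfDeriv X x v)) =
      fderiv ℝ (surfDeriv Y) x u v := fun u v => by
    have k1 := hasFDerivAt_rotation_apply hRs hx (hasFDerivAt_surfDeriv_apply hX hx v)
    have k2 : (fun z => R z (surfDeriv X z v)) =ᶠ[𝓝 x] fun z => surfDeriv Y z v := by
      filter_upwards [isOpen_compl_singleton.mem_nhds hx] with z hz
      exact rotationField_surfDeriv hX hY hz₀ hz v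
    have k3 := k1.unique ((hasFDerivAt_surfDeriv_apply hY hx v).congr_of_eventuallyEq k2)
    have k4 := congrArg (fun A : E3 →L[ℝ] E3 => A u) k3
    simp only [add_apply, ContinuousLinearMap.comp_apply,
      ContinuousLinearMap.flip_apply, fderiv_eq_rotation_cross hd hR] at k4
    rw [map_add]
    exact k4
  have h2 : ∀ u v, cross (η u) (surfDeriv X x v) = cross (η v) (surfDeriv X x u) := fun u v => by
    have k : R x (fderiv ℝ (surfDeriv X) x u v + cross (η u) (surfDeriv X x v)) =
        R x (fderiv ℝ (surfDeriv X) x v u + cross (η v) (surfDeriv X x u)) := by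
      rw [h1, h1, fderiv_surfDeriv_symm hY hx]
    rw [fderiv_surfDeriv_symm hX hx] at k
    have k' := eq_of_inner_rotation (R := ContinuousLinearMap.id ℝ E3) (fun _ _ => rfl)
      (p := fderiv ℝ (surfDeriv X) x v u + cross (η u) (surfDeriv X x v))
      (q := fderiv ℝ (surfDeriv X) x v u + cross (η v) (surfDeriv X x u)) fun b => by
        rw [ContinuousLinearMap.id_apply, ← hR x, k, hR x]
    exact add_left_cancel k'
  have hν : ⟪ν, ν⟫_ℝ = 1 := by
    rw [real_inner_self_eq_norm_sq, norm_outerNormal hX hz₀, one_pow]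
  by_cases hu : surfDeriv X x u = 0
  · -- a direction on which the differential vanishes has zero angular velocity along `ν`
    obtain ⟨a, ha0, ha⟩ : ∃ a : E3, a ≠ 0 ∧ ⟪ν, a⟫_ℝ = 0 := by
      refine ⟨surfFrame X (radialProj x) 0, fun h => ?_, inner_outerNormal_surfDeriv hX hz₀ _ _⟩
      apply cross_surfFrame_ne_zero hX (radialProj x)
      rw [h]
      apply E3_ext <;> simp
    obtain ⟨v, hv⟩ := exists_surfDeriv_eq hX hz₀ hx ha
    have k := h2 u v
    rw [hu, hv] at k
    have k1 := congrArg (fun w => ⟪cross a ν, w⟫_ℝ) k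
    simp only [inner_cross_cross, ha, inner_zero_right] at k1
    have ha' : ⟪a, a⟫_ℝ ≠ 0 := by simpa using ha0
    have k2 : ⟪ν, η u⟫_ℝ * ⟪a, a⟫_ℝ = 0 := by linarith
    exact (mul_eq_zero.1 k2).resolve_right ha'
  · set p := surfDeriv X x u with hp
    have hpν : ⟪ν, p⟫_ℝ = 0 := inner_normal_surfDeriv hX hz₀ hx u
    obtain ⟨v, hv⟩ := exists_surfDeriv_eq hX hz₀ hx (w := cross ν p) (by
      simp only [inner_eq_sum_three, cross_zero_coord, cross_one_coord, cross_two_coord]; ring)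
    have k := congrArg (fun w => ⟪w, p⟫_ℝ) (h2 u v)
    simp only [← hp, hv, cross_cross] at k
    have k0 : ⟪cross (η v) p, p⟫_ℝ = 0 := by
      simp only [inner_eq_sum_three, cross_zero_coord, cross_one_coord, cross_two_coord]; ring
    rw [k0, inner_sub_left, inner_smul_left, inner_smul_left, hpν] at k
    have hp' : ⟪p, p⟫_ℝ ≠ 0 := by simpa using hu
    have k2 : ⟪η u, ν⟫_ℝ * ⟪p, p⟫_ℝ = 0 := by
      simp only [RCLike.conj_to_real] at k
      linarith
    rw [real_inner_comm]
    exact (mul_eq_zero.1 k2).resolve_right hp'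

omit hz₁ hiso in
theorem surfFrame_rotation (y : S2) (i : Fin 2) :
    surfFrame Y y i = rotationField X z₀ Y z₁ y (surfFrame X y i) :=
  (rotationField_surfDeriv hX hY hz₀ (coe_S2_ne_zero y) _).symm

theorem normalFrame_rotation (y : S2) (i : Fin 2) :
    normalFrame Y z₁ y i = rotationField X z₀ Y z₁ y (normalFrame X z₀ y i +
      cross (angularVelocity (rotationField X z₀ Y z₁) y (sphereFrame y i))
        (outerNormal X z₀ y)) := by
  have hx := coe_S2_ne_zero y
  have hRs := radialSmooth_rotationField hX hY hz₀ hz₁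
  have hd := hRs.differentiableAt one_le_infty hx
  have k1 := hasFDerivAt_rotation_apply hRs hx (hasFDerivAt_normal hX hz₀ hx)
  simp only [rotationField_normal hX hY hz₀] at k1
  have k4 := congrArg (fun A : E3 →L[ℝ] E3 => A (sphereFrame y i))
    ((hasFDerivAt_normal hY hz₁ hx).unique k1)
  simp only [add_apply, ContinuousLinearMap.comp_apply, radialProj_coe,
    ContinuousLinearMap.flip_apply,
    fderiv_eq_rotation_cross hd (inner_rotationField hX hY hz₀ hz₁ hiso)] at k4
  rw [map_add]
  exact k4

omit hz₀ hz₁ in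
theorem norm_areaVec_eq (y : S2) : ‖areaVec Y y‖ = ‖areaVec X y‖ := by
  rw [← areaDensity_flat hX, ← areaDensity_flat hY, areaDensity, areaDensity, hiso]

/-- The mean curvature density of `Y` dominates that of `X` up to the exact form
`T = -(ε / 2) d(2 ⟪P, η⟫)`, where `η` is the angular velocity, `P` the position vector relative to
`z₀`, and `ε` the sign of the parametrization. -/
theorem exists_integral_eq_zero_le : ∃ T : S2 → ℝ, Continuous T ∧ ∫ y, T y ∂sphereMeasure = 0 ∧
    ∀ y, meanCurvatureDensity X z₀ y + T y ≤ meanCurvatureDensity Y z₁ y := by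
  have hRs := radialSmooth_rotationField hX hY hz₀ hz₁
  have hR := inner_rotationField hX hY hz₀ hz₁ hiso
  have hην := fun {x : E3} (hx : x ≠ 0) u =>
    inner_normal_angularVelocity hX hY hz₀ hz₁ hiso (x := x) hx u
  have hsf := surfFrame_rotation (z₁ := z₁) hX hY hz₀
  have hnf := normalFrame_rotation hX hY hz₀ hz₁ hiso
  set R := rotationField X z₀ Y z₁ with hRdef
  obtain ⟨ε, hε, hN⟩ := exists_orientation hX hz₀
  have hP : ∀ x : E3, x ≠ 0 →
      HasFDerivAt (fun z => (X ∘ radialProj) z - z₀) (surfDeriv X x) x := fun x hx =>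
    (hasFDerivAt_surface hX hx).sub_const z₀
  have hF : ∀ j, RadialSmooth ∞ fun z => R z (cross ((X ∘ radialProj) z - z₀) (e3 j)) :=
    fun j => by
      refine ⟨hRs.1.clm_apply ?_, fun c hc x => ?_⟩
      · exact (crossL.flip (e3 j)).contDiff.comp_contDiffOn
          (hX.radialSmooth.1.sub contDiffOn_const)
      · rw [hRs.2 c hc, hX.radialSmooth.2 c hc]
  have hG : ∀ j, RadialSmooth ∞ fun z => R z (e3 j) := fun j =>
    ⟨hRs.1.clm_apply contDiffOn_const, fun c hc x => by rw [hRs.2 c hc]⟩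
  have hF1 := fun j => (hF j).of_le one_le_infty
  have hG2 := fun j => (hG j).of_le two_le_infty
  have hG1 := fun j => (hG j).of_le one_le_infty
  have hcont : ∀ j, Continuous fun y : S2 => wedgeInner y
      (fderiv ℝ (fun z => R z (cross ((X ∘ radialProj) z - z₀) (e3 j))) y)
      (fderiv ℝ (fun z => R z (e3 j)) y) := fun j =>
    continuous_wedgeInner_fderiv (hF1 j) (hG1 j)
  refine ⟨fun y => -(ε / 2) * ∑ j, wedgeInner y
      (fderiv ℝ (fun z => R z (cross ((X ∘ radialProj) z - z₀) (e3 j))) y)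
      (fderiv ℝ (fun z => R z (e3 j)) y), ?_, ?_, fun y => ?_⟩
  · exact continuous_const.mul (continuous_finsetSum _ fun j _ => hcont j)
  · rw [integral_const_mul, integral_finsetSum _ fun j _ => integrable_of_continuous (hcont j)]
    simp only [integral_wedgeInner_fderiv (hF1 _) (hG2 _), Finset.sum_const_zero, mul_zero]
  have hx := coe_S2_ne_zero y
  have h0 := frameDet_ne_zero y
  have hNy := (hN y).1
  have hNpos : 0 < ‖areaVec X y‖ := by simpa using areaVec_ne_zero hX y
  set η := angularVelocity R y
  set ν := outerNormal X z₀ y with hν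
  have hνν : ⟪ν, ν⟫_ℝ = 1 := by
    rw [real_inner_self_eq_norm_sq, norm_outerNormal hX hz₀, one_pow]
  have hην' : ∀ u, ⟪ν, η u⟫_ℝ = 0 := fun u => by
    have h := hην hx u
    rw [radialProj_coe] at h
    exact h
  have hην'' : ∀ u, ⟪η u, ν⟫_ℝ = 0 := fun u => by rw [real_inner_comm]; exact hην' u
  have hsν : ∀ i, ⟪surfFrame X y i, ν⟫_ℝ = 0 := fun i => by
    rw [real_inner_comm]; exact inner_outerNormal_surfDeriv hX hz₀ y _
  have hnν : ∀ i, ⟪normalFrame X z₀ y i, ν⟫_ℝ = 0 := fun i => by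
    have h := inner_normal_normalDeriv hX hz₀ hx (sphereFrame y i)
    rw [radialProj_coe] at h
    rw [real_inner_comm]; exact h
  set w : Fin 2 → E3 := fun i => η (sphereFrame y i) with hw
  set s := det3 ν (w 0) (w 1) with hs
  have hcross : cross (surfFrame X y 0) (surfFrame X y 1) =
      (frameDet y * (ε * ‖areaVec X y‖)) • ν := by
    rw [cross_surfFrame hX, ← smul_smul, ← hNy]
  -- the second fundamental forms of the two surfaces in the frame of `X`
  have hIIY : ∀ i j, ⟪normalFrame Y z₁ y i, surfFrame Y y j⟫_ℝ =
      ⟪normalFrame X z₀ y i, surfFrame X y j⟫_ℝ + ⟪cross (w i) ν, surfFrame X y j⟫_ℝ :=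
    fun i j => by rw [hnf, hsf, hR, inner_add_left]
  -- the sign of `s`: the difference of the second fundamental forms is indefinite
  have hsign : ε / frameDet y * s ≤ 0 := by
    obtain ⟨hsX, hpX⟩ := secondFundamental_frame hX hz₀ y
    obtain ⟨hsY, hpY⟩ := secondFundamental_frame hY hz₁ y
    have hstr := structure_equation hRs hR hx (hasFDerivAt_normal hX hz₀ hx)
      (fun z hz u => hην hz u) (sphereFrame y 0) (sphereFrame y 1)
    rw [radialProj_coe] at hstr
    change ⟪normalFrame X z₀ y 0, w 1⟫_ℝ - ⟪normalFrame X z₀ y 1, w 0⟫_ℝ = s at hstr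
    -- the two surfaces have the same Gauss curvature
    have hgauss : (gramPair (normalFrame X z₀ y) (surfFrame X y)).det =
        (gramPair (fun i => normalFrame X z₀ y i + cross (w i) ν) (surfFrame X y)).det := by
      rw [det_gramPair, det_gramPair, hcross, inner_smul_right, inner_smul_right]
      congr 1
      have e : ∀ a b c d : E3, ⟪cross (a + b) (c + d), ν⟫_ℝ =
          ⟪cross a c, ν⟫_ℝ + (det3 ν a d + det3 ν b c) + ⟪cross b d, ν⟫_ℝ := fun a b c d => by
        simp only [det3_eq, inner_eq_sum_three, cross_zero_coord, cross_one_coord,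
          cross_two_coord, PiLp.add_apply]
        ring
      rw [e, inner_cross_cross_cross, det3_cross_left, det3_cross_right, hνν, hnν, hnν]
      linarith
    have hdet := det_sub_nonpos hpX hpY (by
      rw [Matrix.det_fin_two, Matrix.det_fin_two] at hgauss
      simp only [gramPair, Matrix.of_apply, inner_add_left, ← hIIY] at hgauss
      rw [← hsX, ← hsY] at hgauss
      linarith)
    have hdet' : (gramPair (fun i => cross (w i) ν) (surfFrame X y)).det ≤ 0 := by
      rw [Matrix.det_fin_two]
      simp only [gramPair, Matrix.of_apply]
      have e : ∀ i j, ⟪cross (w i) ν, surfFrame X y j⟫_ℝ =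
          ⟪normalFrame Y z₁ y i, surfFrame Y y j⟫_ℝ -
            ⟪normalFrame X z₀ y i, surfFrame X y j⟫_ℝ := fun i j => by rw [hIIY]; ring
      rw [e, e, e, e, ← hsX, ← hsY]
      linarith
    -- `η₀ × η₁ = s ν`, and rotating both factors by a right angle does not change the product
    rw [det_gramPair, hcross, inner_cross_cross_cross, inner_smul_right, hνν] at hdet'
    have hε2 : ε / frameDet y * s = (s * (frameDet y * (ε * ‖areaVec X y‖) * 1)) *
        ((frameDet y)⁻¹ ^ 2 * ‖areaVec X y‖⁻¹) := by
      field_simp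
    rw [hε2]
    exact mul_nonpos_of_nonpos_of_nonneg hdet' (by positivity)
  -- the difference of the mean curvature densities is the trace of `η × ν`
  have hdiff : meanCurvatureDensity Y z₁ y = meanCurvatureDensity X z₀ y +
      ε / frameDet y * (⟪surfFrame X y 1, w 0⟫_ℝ - ⟪surfFrame X y 0, w 1⟫_ℝ) := by
    have g1 : gramPair (surfFrame Y y) (surfFrame Y y) =
        gramPair (surfFrame X y) (surfFrame X y) := by
      ext i j; simp only [gramPair, Matrix.of_apply, hsf, hR]
    have g2 : gramPair (normalFrame Y z₁ y) (surfFrame Y y) =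
        gramPair (fun i => normalFrame X z₀ y i + cross (w i) ν) (surfFrame X y) := by
      ext i j; simp only [gramPair, Matrix.of_apply, hIIY, inner_add_left]
    rw [meanCurvatureDensity, meanCurvatureDensity, g1, g2, norm_areaVec_eq hX hY hiso,
      trace_density hX hNy, trace_density hX hNy]
    have e : ∀ a b c : E3, det3 ν (a + b) c = det3 ν a c + det3 ν b c := fun a b c => by
      simp only [det3_eq, PiLp.add_apply]; ring
    have e' : ∀ a b c : E3, det3 ν c (a + b) = det3 ν c a + det3 ν c b := fun a b c => by
      simp only [det3_eq, PiLp.add_apply]; ring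
    rw [e, e', det3_cross_left, det3_cross_right, hνν, hsν, hsν]
    ring
  -- the exact form, evaluated on the frame
  have hT : frameDet y * ∑ j, wedgeInner y
      (fderiv ℝ (fun z => R z (cross ((X ∘ radialProj) z - z₀) (e3 j))) y)
      (fderiv ℝ (fun z => R z (e3 j)) y) =
      2 * (⟪surfFrame X y 0, w 1⟫_ℝ - ⟪surfFrame X y 1, w 0⟫_ℝ) -
        2 * det3 (X y - z₀) (w 0) (w 1) := by
    have h1 := sum_inner_fderiv_rotation hRs hR hx (hP y hx) (sphereFrame y 0) (sphereFrame y 1)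
    have h2 := sum_inner_fderiv_rotation hRs hR hx (hP y hx) (sphereFrame y 1) (sphereFrame y 0)
    have h3 : ∀ j, frameDet y * wedgeInner y
        (fderiv ℝ (fun z => R z (cross ((X ∘ radialProj) z - z₀) (e3 j))) y)
        (fderiv ℝ (fun z => R z (e3 j)) y) = _ := fun j =>
      (wedgeInner_apply (norm_coe_S2 y) ((hF1 j).fderiv_self le_rfl hx)
        ((hG1 j).fderiv_self le_rfl hx) (sphereFrame y 0) (sphereFrame y 1)).symm
    have h4 : det3 (X y - z₀) (w 1) (w 0) = - det3 (X y - z₀) (w 0) (w 1) := by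
      simp only [det3_eq]; ring
    rw [Finset.mul_sum, Finset.sum_congr rfl fun j _ => h3 j, Finset.sum_sub_distrib, h1, h2]
    simp only [Function.comp_apply, radialProj_coe]
    change 2 * ⟪surfFrame X y 0, w 1⟫_ℝ - det3 (X y - z₀) (w 0) (w 1) -
      (2 * ⟪surfFrame X y 1, w 0⟫_ℝ - det3 (X y - z₀) (w 1) (w 0)) = _
    rw [h4]; ring
  -- `η` is tangent, so that `η₀ × η₁` is normal
  have hdet3 : det3 (X y - z₀) (w 0) (w 1) = s * ⟪ν, X y - z₀⟫_ℝ := by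
    have h1 : cross ν (cross (w 0) (w 1)) = 0 := by
      rw [cross_cross, hην', hην']; simp
    have h2 := cross_cross ν ν (cross (w 0) (w 1))
    rw [h1, hνν, one_smul] at h2
    have h3 : cross ν (0 : E3) = 0 := by apply E3_ext <;> simp
    rw [h3, eq_comm, sub_eq_zero] at h2
    rw [← inner_cross_right, ← h2, inner_smul_left, real_inner_comm, inner_cross_right]
    rfl
  have hpos := inner_outerNormal_pos hX hz₀ y
  have hle : ε / frameDet y * s * ⟪ν, X y - z₀⟫_ℝ ≤ 0 :=
    mul_nonpos_of_nonpos_of_nonneg hsign hpos.le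
  rw [hdiff]
  set T := ∑ j, wedgeInner y
      (fderiv ℝ (fun z => R z (cross ((X ∘ radialProj) z - z₀) (e3 j))) y)
      (fderiv ℝ (fun z => R z (e3 j)) y)
  rw [hdet3] at hT
  have hfin : ε / frameDet y * (⟪surfFrame X y 1, w 0⟫_ℝ - ⟪surfFrame X y 0, w 1⟫_ℝ) =
      -(ε / 2) * T - ε / frameDet y * s * ⟪ν, X y - z₀⟫_ℝ := by
    have h5 : ⟪surfFrame X y 1, w 0⟫_ℝ - ⟪surfFrame X y 0, w 1⟫_ℝ =
        -(frameDet y * T) / 2 - s * ⟪ν, X y - z₀⟫_ℝ := by linarith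
    rw [h5]; field_simp
  linarith

theorem integral_meanCurvatureDensity_le :
    ∫ y, meanCurvatureDensity X z₀ y ∂sphereMeasure ≤
      ∫ y, meanCurvatureDensity Y z₁ y ∂sphereMeasure := by
  obtain ⟨T, hT, hT0, hle⟩ := exists_integral_eq_zero_le hX hY hz₀ hz₁ hiso
  have iX := integrable_of_continuous (continuous_meanCurvatureDensity hX hz₀)
  have iT := integrable_of_continuous hT
  have iY := integrable_of_continuous (continuous_meanCurvatureDensity hY hz₁)
  have h := integral_mono (iX.add iT) iY hle
  rwa [integral_add' iX iT, hT0, add_zero] at h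

/-- **Herglotz's rigidity**: isometric convex surfaces have the same total mean curvature. -/
theorem integral_meanCurvatureDensity_eq :
    ∫ y, meanCurvatureDensity X z₀ y ∂sphereMeasure =
      ∫ y, meanCurvatureDensity Y z₁ y ∂sphereMeasure :=
  le_antisymm (integral_meanCurvatureDensity_le hX hY hz₀ hz₁ hiso)
    (integral_meanCurvatureDensity_le hY hX hz₁ hz₀ fun y => (hiso y).symm)

end Pair

/-! ### Homotheties of convex surfaces -/

section Homothety

variable {Ω : Set E3} {X : S2 → E3} (hX : IsConvexSphere Ω X) {c : ℝ} (hc : 0 < c)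
include hX

theorem mvfderiv_const_smul (c : ℝ) (y : S2) :
    mvfderiv (𝓡 2) (fun z => c • X z) y = c • mvfderiv (𝓡 2) X y := by
  have h := mvfderiv_fun_smul (I := 𝓡 2) (x := y) (mdifferentiableAt_const (c := c))
    (hX.smooth.mdifferentiableAt (by simp) : MDifferentiableAt (𝓡 2) 𝓘(ℝ, E3) X y)
  rw [h, mvfderiv_const]
  ext v
  simp

theorem partialDeriv_const_smul (c : ℝ) (y : S2) (i : Fin 2) :
    partialDeriv (fun z => c • X z) y i = c • partialDeriv X y i := by
  rw [partialDeriv, mvfderiv_const_smul hX]; rfl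

theorem firstForm_const_smul (c : ℝ) (y : S2) :
    firstForm flatMetric (fun z => c • X z) y = c ^ 2 • firstForm flatMetric X y := by
  ext i j
  simp only [firstForm, Matrix.of_apply, Matrix.smul_apply, flatMetric_apply,
    partialDeriv_const_smul hX, inner_smul_left, inner_smul_right, RCLike.conj_to_real, smul_eq_mul]
  ring

theorem surfDeriv_const_smul (c : ℝ) {x : E3} (hx : x ≠ 0) :
    surfDeriv (fun z => c • X z) x = c • surfDeriv X x :=
  ((hasFDerivAt_surface hX hx).const_smul c).fderiv

theorem areaVec_const_smul (c : ℝ) {x : E3} (hx : x ≠ 0) :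
    areaVec (fun z => c • X z) x = c ^ 2 • areaVec X x := by
  rw [areaVec, areaVec, surfDeriv_const_smul hX c hx]
  apply E3_ext <;> simp [wedge, coordForm_apply] <;> ring

include hc

theorem IsConvexSphere.const_smul :
    IsConvexSphere ((fun x => c • x) '' Ω) (fun y => c • X y) where
  isCompact := hX.isCompact.image (continuous_const_smul c)
  convex := hX.convex.smul c
  interior_nonempty := by
    obtain ⟨z, hz⟩ := hX.interior_nonempty
    have h := (Homeomorph.smulOfNeZero (α := E3) c hc.ne').image_interior Ω
    exact ⟨c • z, h.subset ⟨z, hz, rfl⟩⟩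
  smooth := (contDiff_const_smul c).contMDiff.comp hX.smooth
  injective := fun a b h => hX.injective (smul_right_injective E3 hc.ne' h)
  immersion := fun y => by
    rw [mvfderiv_const_smul hX]
    exact fun a b h => hX.immersion y (smul_right_injective E3 hc.ne' h)
  range_eq := by
    have h := (Homeomorph.smulOfNeZero (α := E3) c hc.ne').image_frontier Ω
    rw [← hX.range_eq, ← range_comp] at h
    exact h

theorem outerNormal_const_smul (z₀ : E3) {x : E3} (hx : x ≠ 0) :
    outerNormal (fun z => c • X z) (c • z₀) x = outerNormal X z₀ x := by
  rw [outerNormal, outerNormal, areaVec_const_smul hX c hx, ← smul_sub, norm_smul,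
    inner_smul_left, inner_smul_right, smul_smul]
  congr 1
  simp only [RCLike.conj_to_real, abs_mul, norm_pow, Real.norm_eq_abs, abs_pow, abs_of_pos hc]
  field_simp

theorem meanCurvatureDensity_const_smul {z₀ : E3} (hz₀ : z₀ ∈ interior Ω) (y : S2) :
    meanCurvatureDensity (fun z => c • X z) (c • z₀) y = c * meanCurvatureDensity X z₀ y := by
  obtain ⟨ε, -, hN⟩ := exists_orientation hX hz₀
  have hy := coe_S2_ne_zero y
  have hcX := hX.const_smul hc
  have hν := outerNormal_const_smul hX hc z₀ hy
  have hN' : areaVec (fun z => c • X z) y =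
      (ε * ‖areaVec (fun z => c • X z) y‖) • outerNormal (fun z => c • X z) (c • z₀) y := by
    rw [hν, areaVec_const_smul hX c hy, norm_smul, norm_pow, Real.norm_eq_abs, abs_of_pos hc,
      mul_left_comm, ← smul_smul, ← (hN y).1]
  have hsf : ∀ i, surfFrame (fun z => c • X z) y i = c • surfFrame X y i := fun i => by
    rw [surfFrame, surfDeriv_const_smul hX c hy]; rfl
  have hnf : ∀ i, normalFrame (fun z => c • X z) (c • z₀) y i = normalFrame X z₀ y i :=
    fun i => by
      have h : (fun z => outerNormal (fun z => c • X z) (c • z₀) (radialProj z)) =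
          fun z => outerNormal X z₀ (radialProj z) :=
        funext fun z => outerNormal_const_smul hX hc z₀ (coe_S2_ne_zero _)
      rw [normalFrame, normalDeriv, h]; rfl
  rw [meanCurvatureDensity, meanCurvatureDensity, trace_density hcX hN',
    trace_density hX (hN y).1]
  simp only [hν, hsf, hnf, det3_eq, PiLp.smul_apply, smul_eq_mul]
  ring

end Homothety

/-! ### The Laplacian -/

theorem laplacian_eq_sum_fderiv (f : E3 → ℝ) (x : E3) :
    Laplacian.laplacian f x = ∑ i, fderiv ℝ (fderiv ℝ f) x (e3 i) (e3 i) := by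
  rw [InnerProductSpace.laplacian_eq_iteratedFDeriv_orthonormalBasis f
    (EuclideanSpace.basisFun (Fin 3) ℝ)]
  simp [iteratedFDeriv_two_apply]

theorem deriv_deriv_nonneg_of_isLocalMin {φ : ℝ → ℝ} {a : ℝ} (h : IsLocalMin φ a)
    (hc : ContinuousAt φ a) : 0 ≤ deriv (deriv φ) a := by
  by_contra! hneg
  have hmax := isLocalMax_of_deriv_deriv_neg hneg h.deriv_eq_zero hc
  have hconst : φ =ᶠ[𝓝 a] fun _ => φ a := by
    filter_upwards [h, hmax] with t h1 h2 using le_antisymm h2 h1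
  have h2 : deriv (deriv φ) a = 0 := by
    rw [hconst.deriv.deriv_eq]; simp
  linarith

/-- The weak minimum principle for superharmonic functions. -/
theorem le_of_laplacian_nonpos {Ω U : Set E3} (hΩ : IsCompact Ω) (hU : IsOpen U) (hΩU : Ω ⊆ U)
    {f : E3 → ℝ} (hf : ContDiffOn ℝ 2 f U) {f₀ : ℝ} (hlevel : ∀ x ∈ frontier Ω, f x = f₀)
    (hΔ : ∀ x ∈ Ω, Laplacian.laplacian f x ≤ 0) : ∀ x ∈ Ω, f₀ ≤ f x := by
  intro p hp
  by_contra! hlt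
  obtain ⟨B, hB⟩ := hΩ.exists_bound_of_continuousOn (f := fun x : E3 => ‖x‖ ^ 2) (by fun_prop)
  have hB' : ∀ x ∈ Ω, ‖x‖ ^ 2 ≤ B := fun x hx => (le_abs_self _).trans (hB x hx)
  have hB0 : 0 ≤ B := (sq_nonneg _).trans (hB' p hp)
  -- subtracting a small multiple of `‖x‖ ^ 2` makes the Laplacian negative
  obtain ⟨η, hη, hηB⟩ : ∃ η : ℝ, 0 < η ∧ η * B < f₀ - f p := by
    refine ⟨(f₀ - f p) / (2 * (B + 1)), by have := sub_pos.2 hlt; positivity, ?_⟩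
    have := sub_pos.2 hlt
    rw [div_mul_eq_mul_div, div_lt_iff₀ (by positivity)]
    nlinarith
  obtain ⟨m, hm, hmin⟩ := hΩ.exists_isMinOn ⟨p, hp⟩
    (f := fun x => f x - η * ‖x‖ ^ 2) ((hf.continuousOn.mono hΩU).sub (by fun_prop))
  have hmp : f m - η * ‖m‖ ^ 2 ≤ f p - η * ‖p‖ ^ 2 := hmin hp
  have hint : m ∈ interior Ω := by
    by_contra hm'
    have hfm := hlevel m ⟨subset_closure hm, hm'⟩
    have h1 := mul_le_mul_of_nonneg_left (hB' m hm) hη.le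
    have h2 : 0 ≤ η * ‖p‖ ^ 2 := by positivity
    linarith
  have hfd : ∀ x ∈ U, HasFDerivAt f (fderiv ℝ f x) x := fun x hx =>
    ((hf.contDiffAt (hU.mem_nhds hx)).differentiableAt two_ne_zero).hasFDerivAt
  have hfd2 : HasFDerivAt (fderiv ℝ f) (fderiv ℝ (fderiv ℝ f) m) m :=
    (((hf.contDiffAt (hU.mem_nhds (hΩU hm))).fderiv_right (m := 1) (by norm_num)).differentiableAt
      one_ne_zero).hasFDerivAt
  have key : ∀ i, 0 ≤ fderiv ℝ (fderiv ℝ f) m (e3 i) (e3 i) - 2 * η := fun i => by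
    have hline : ∀ t : ℝ, HasDerivAt (fun t : ℝ => m + t • e3 i) (e3 i) t := fun t => by
      simpa using ((hasDerivAt_id t).smul_const (e3 i)).const_add m
    have hcont : Tendsto (fun t : ℝ => m + t • e3 i) (𝓝 0) (𝓝 m) := by
      simpa using (hline 0).continuousAt.tendsto
    have hd1 : ∀ᶠ t : ℝ in 𝓝 0, HasDerivAt
        (fun t : ℝ => f (m + t • e3 i) - η * ‖m + t • e3 i‖ ^ 2)
        (fderiv ℝ f (m + t • e3 i) (e3 i) - η * (2 * ⟪m + t • e3 i, e3 i⟫_ℝ)) t := by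
      filter_upwards [hcont.eventually (hU.mem_nhds (hΩU hm))] with t ht
      exact ((hfd _ ht).comp_hasDerivAt t (hline t)).sub ((hline t).norm_sq.const_mul η)
    have hd2 : HasDerivAt (fun t : ℝ => fderiv ℝ f (m + t • e3 i) (e3 i) -
        η * (2 * ⟪m + t • e3 i, e3 i⟫_ℝ))
        (fderiv ℝ (fderiv ℝ f) m (e3 i) (e3 i) - 2 * η) 0 := by
      have k0 : m + (0 : ℝ) • e3 i = m := by simp
      have k1 : HasDerivAt (fun t : ℝ => fderiv ℝ f (m + t • e3 i))
          (fderiv ℝ (fderiv ℝ f) m (e3 i)) 0 :=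
        HasFDerivAt.comp_hasDerivAt (0 : ℝ) (by rw [k0]; exact hfd2) (hline 0)
      have k2 := k1.clm_apply (hasDerivAt_const (0 : ℝ) (e3 i))
      have k3 := (((hline 0).inner ℝ (hasDerivAt_const (0 : ℝ) (e3 i))).const_mul 2).const_mul η
      refine (k2.sub k3).congr_deriv ?_
      simp
      ring
    have hloc : IsLocalMin (fun t : ℝ => f (m + t • e3 i) - η * ‖m + t • e3 i‖ ^ 2) 0 := by
      filter_upwards [hcont.eventually (mem_interior_iff_mem_nhds.1 hint)] with t ht
      simpa using hmin ht
    have h1 := deriv_deriv_nonneg_of_isLocalMin hloc hd1.self_of_nhds.continuousAt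
    have h2 := EventuallyEq.deriv_eq (hd1.mono fun t ht => ht.deriv)
    rwa [h2, hd2.deriv] at h1
  have hsum := hΔ m hm
  rw [laplacian_eq_sum_fderiv, Fin.sum_univ_three] at hsum
  linarith [key 0, key 1, key 2]

/-- The flux of a gradient through the boundary of a convex body. -/
theorem integral_laplacian {Ω U : Set E3} {X : S2 → E3} (hX : IsConvexSphere Ω X) {z₀ : E3}
    (hz₀ : z₀ ∈ interior Ω) (hU : IsOpen U) (hΩU : Ω ⊆ U) {f : E3 → ℝ} (hf : ContDiffOn ℝ 2 f U) :
    ∫ x in Ω, Laplacian.laplacian f x =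
      ∫ y : S2, fderiv ℝ f (X y) (outerNormal X z₀ y) * ‖areaVec X y‖ ∂sphereMeasure := by
  let J : (E3 →L[ℝ] ℝ) →L[ℝ] E3 :=
    (InnerProductSpace.toDual ℝ E3).symm.toContinuousLinearEquiv.toContinuousLinearMap
  have hJ : ∀ (ℓ : E3 →L[ℝ] ℝ) v, ⟪J ℓ, v⟫_ℝ = ℓ v := fun ℓ v =>
    InnerProductSpace.toDual_symm_apply
  have hf1 : ContDiffOn ℝ 1 (fderiv ℝ f) U := hf.fderiv_of_isOpen hU (by norm_num)
  have h := integral_divergence hX hz₀ hU hΩU (J.contDiff.comp_contDiffOn hf1)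
  simp only [Function.comp_apply, hJ] at h
  rw [← h]
  refine setIntegral_congr_fun hX.isCompact.measurableSet fun x hx => ?_
  have hd : DifferentiableAt ℝ (fderiv ℝ f) x :=
    (hf1.contDiffAt (hU.mem_nhds (hΩU hx))).differentiableAt one_ne_zero
  have hc : ∀ (v : E3) i, v i = ⟪v, e3 i⟫_ℝ := fun v i => by
    rw [EuclideanSpace.inner_single_right]; simp
  simp only [divergence]
  rw [(J.hasFDerivAt.comp x hd.hasFDerivAt).fderiv, laplacian_eq_sum_fderiv, Fin.sum_univ_three]
  simp only [ContinuousLinearMap.comp_apply, hc, hJ]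

/-! ### The Brown–York mass -/

theorem volumeDensity_conformal (f : E3 → ℝ) (x : E3) :
    volumeDensity (conformalMetric f) x = f x ^ 6 := by
  have h : (Matrix.of fun i j : Fin 3 => conformalMetric f x (EuclideanSpace.single i 1)
      (EuclideanSpace.single j 1)) = Matrix.diagonal fun _ => f x ^ 4 := by
    ext i j
    rw [Matrix.of_apply, conformalMetric_apply, Matrix.diagonal_apply]
    by_cases hij : i = j
    · simp [hij]
    · rw [EuclideanSpace.inner_single_left]
      simp [hij]
  rw [volumeDensity, h, Matrix.det_diagonal]
  simp only [Finset.prod_const, Finset.card_univ, Fintype.card_fin]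
  rw [show (f x ^ 4) ^ 3 = (f x ^ 6) ^ 2 by ring,
    Real.sqrt_sq (by rw [show f x ^ 6 = (f x ^ 3) ^ 2 by ring]; positivity)]

section Mass

variable {Ω U : Set E3} {X : S2 → E3} (hX : IsConvexSphere Ω X) (hU : IsOpen U) (hΩU : Ω ⊆ U)
  {f : E3 → ℝ} (hf : ContDiffOn ℝ 2 f U) {f₀ : ℝ} (hf₀ : 0 < f₀) (hlevel : ∀ y, f (X y) = f₀)
include hX hf₀ hlevel

theorem exists_isWeylEmbedding :
    ∃ (Ω₀ : Set E3) (Y : S2 → E3), IsWeylEmbedding (conformalMetric f) X Ω₀ Y := by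
  refine ⟨_, _, hX.const_smul (c := f₀ ^ 2) (by positivity), fun y => ?_⟩
  rw [firstForm_const_smul hX, firstForm_conformal (hlevel y), ← pow_mul]

include hU hΩU hf

/-- The Brown–York mass is the flux of the conformal factor: by rigidity the embedded surface has
the total mean curvature of the homothetic copy `f₀ ^ 2 • X`. -/
theorem brownYorkMass_eq_flux {Ω₀ : Set E3} {Y : S2 → E3}
    (hY : IsWeylEmbedding (conformalMetric f) X Ω₀ Y) :
    brownYorkMass (conformalMetric f) Ω X Ω₀ Y =
      -(f₀ / (2 * Real.pi)) * ∫ x in Ω, Laplacian.laplacian f x := by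
  obtain ⟨z₀, hz₀⟩ := hX.interior_nonempty
  obtain ⟨hYs, hiso⟩ := hY
  obtain ⟨z₁, hz₁⟩ := hYs.interior_nonempty
  have hc : 0 < f₀ ^ 2 := by positivity
  have hcX := hX.const_smul hc
  have hz₀' : f₀ ^ 2 • z₀ ∈ interior ((fun x => f₀ ^ 2 • x) '' Ω) :=
    ((Homeomorph.smulOfNeZero (α := E3) (f₀ ^ 2) hc.ne').image_interior Ω).subset ⟨z₀, hz₀, rfl⟩
  have hrigid := integral_meanCurvatureDensity_eq hcX hYs hz₀' hz₁ fun y => by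
    rw [hiso, firstForm_conformal (hlevel y), firstForm_const_smul hX, ← pow_mul]
  simp only [meanCurvatureDensity_const_smul hX hc hz₀] at hrigid
  rw [integral_const_mul] at hrigid
  have hd : ∀ y, ContDiffAt ℝ 2 f (X y) := fun y =>
    hf.contDiffAt (hU.mem_nhds (hΩU (surface_mem hX y)))
  have hpt : ∀ y, (meanCurvature flatMetric Ω₀ Y y - meanCurvature (conformalMetric f) Ω X y) *
      areaDensity (conformalMetric f) X y = meanCurvatureDensity Y z₁ y -
        (f₀ ^ 2 * meanCurvatureDensity X z₀ y +
          4 * f₀ * (fderiv ℝ f (X y) (outerNormal X z₀ y) * ‖areaVec X y‖)) := fun y => by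
    have hA : areaDensity (conformalMetric f) X y = ‖areaVec Y y‖ := by
      rw [← areaDensity_flat hYs, areaDensity, areaDensity, hiso]
    rw [sub_mul]
    nth_rewrite 1 [hA]
    rw [meanCurvature_flat_mul hYs hz₁, areaDensity_conformal hX (hlevel y),
      meanCurvature_conformal_mul hX hz₀ hlevel hf₀ y ((hd y).differentiableAt two_ne_zero)]
  have iX := integrable_of_continuous (continuous_meanCurvatureDensity hX hz₀)
  have iY := integrable_of_continuous (continuous_meanCurvatureDensity hYs hz₁)
  have iF : Integrable (fun y : S2 => fderiv ℝ f (X y) (outerNormal X z₀ y) * ‖areaVec X y‖)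
      sphereMeasure := by
    refine integrable_of_continuous (Continuous.mul (Continuous.clm_apply ?_ ?_) ?_)
    · have h1 : ContinuousOn (fderiv ℝ f) U :=
        hf.continuousOn_fderiv_of_isOpen hU (by norm_num)
      exact h1.comp_continuous hX.smooth.continuous fun y => hΩU (surface_mem hX y)
    · exact continuous_outerNormal hX hz₀
    · exact (continuous_areaVec hX).norm
  have hint : surfaceIntegral (conformalMetric f) X (fun y => meanCurvature flatMetric Ω₀ Y y -
      meanCurvature (conformalMetric f) Ω X y) =
      - (4 * f₀ * ∫ x in Ω, Laplacian.laplacian f x) := by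
    rw [surfaceIntegral]
    simp only [hpt]
    change ∫ y, _ ∂sphereMeasure = _
    have iB : Integrable (fun y : S2 => f₀ ^ 2 * meanCurvatureDensity X z₀ y +
        4 * f₀ * (fderiv ℝ f (X y) (outerNormal X z₀ y) * ‖areaVec X y‖)) sphereMeasure :=
      (iX.const_mul _).add (iF.const_mul _)
    rw [integral_sub iY iB,
      integral_add (iX.const_mul _) (iF.const_mul _), integral_const_mul, integral_const_mul,
      ← hrigid, ← integral_laplacian hX hz₀ hU hΩU hf]
    ring
  rw [brownYorkMass, hint]
  have := Real.pi_ne_zero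
  field_simp
  ring

end Mass

end ConformalBrownYork

end

open ConformalBrownYork
theorem mainTheorem2
    (Ω U : Set E3) (X : S2 → E3) (hX : IsConvexSphere Ω X)
    (hU : IsOpen U) (hΩU : Ω ⊆ U)
    (f : E3 → ℝ) (hf : ContDiffOn ℝ 2 f U) (hf_pos : ∀ x ∈ Ω, 0 < f x)
    (f₀ : ℝ) (hlevel : ∀ x ∈ frontier Ω, f x = f₀)
    (ρ : E3 → ℝ)
    (hconstraint : ∀ x ∈ Ω, Laplacian.laplacian f x = -2 * Real.pi * ρ x * (f x) ^ 5) :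
    (∃ (Ω₀ : Set E3) (Y : S2 → E3), IsWeylEmbedding (conformalMetric f) X Ω₀ Y) ∧
    ∀ (Ω₀ : Set E3) (Y : S2 → E3), IsWeylEmbedding (conformalMetric f) X Ω₀ Y →
      brownYorkMass (conformalMetric f) Ω X Ω₀ Y =
          volumeIntegral (conformalMetric f) Ω (fun x => ρ x * (f₀ / f x)) ∧
        ((∀ x ∈ Ω, 0 ≤ ρ x) →
          brownYorkMass (conformalMetric f) Ω X Ω₀ Y ≤
            totalRestMass (conformalMetric f) Ω ρ) := by
  have hlevel' : ∀ y, f (X y) = f₀ := fun y => hlevel _ (hX.range_eq ▸ mem_range_self y)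
  have hf₀ : 0 < f₀ := by
    let y : S2 := radialProj 0
    rw [← hlevel' y]
    exact hf_pos _ (surface_mem hX y)
  have hΩm := hX.isCompact.measurableSet
  have hπ := Real.pi_pos
  refine ⟨exists_isWeylEmbedding hX hf₀ hlevel', fun Ω₀ Y hY => ?_⟩
  have heq : brownYorkMass (conformalMetric f) Ω X Ω₀ Y =
      volumeIntegral (conformalMetric f) Ω (fun x => ρ x * (f₀ / f x)) := by
    rw [brownYorkMass_eq_flux hX hU hΩU hf hf₀ hlevel' hY, volumeIntegral, ← integral_const_mul]
    refine setIntegral_congr_fun hΩm fun x hx => ?_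
    have := hf_pos x hx
    simp only [hconstraint x hx, volumeDensity_conformal]
    field_simp
  refine ⟨heq, fun hρ => ?_⟩
  have hle : ∀ x ∈ Ω, f₀ ≤ f x := by
    refine le_of_laplacian_nonpos hX.isCompact hU hΩU hf hlevel fun x hx => ?_
    rw [hconstraint x hx]
    have h1 := hf_pos x hx
    have h2 := hρ x hx
    have : 0 ≤ 2 * Real.pi * ρ x * f x ^ 5 := by positivity
    linarith
  -- the densities are continuous, because the constraint expresses `ρ` by the Laplacian
  have hΔ : ContinuousOn (Laplacian.laplacian f) Ω := by
    have h1 : ContinuousOn (fderiv ℝ (fderiv ℝ f)) U :=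
      (hf.fderiv_of_isOpen hU (m := 1) (by norm_num)).continuousOn_fderiv_of_isOpen hU le_rfl
    rw [funext fun x => laplacian_eq_sum_fderiv f x]
    exact continuousOn_finsetSum _ fun i _ =>
      (((h1.mono hΩU).clm_apply continuousOn_const).clm_apply continuousOn_const)
  have hfc : ContinuousOn f Ω := hf.continuousOn.mono hΩU
  have hi : ∀ {h : E3 → ℝ}, ContinuousOn h Ω →
      IntegrableOn (fun x => ρ x * f x ^ 5 * h x) Ω := fun {h} hh => by
    have h1 : ContinuousOn (fun x => -(2 * Real.pi)⁻¹ * Laplacian.laplacian f x * h x) Ω :=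
      (continuousOn_const.mul hΔ).mul hh
    refine (h1.integrableOn_compact hX.isCompact).congr_fun (fun x hx => ?_) hΩm
    simp only [hconstraint x hx]
    field_simp
  rw [heq, totalRestMass, volumeIntegral, volumeIntegral]
  have e1 : ∀ x ∈ Ω, ρ x * (f₀ / f x) * volumeDensity (conformalMetric f) x =
      ρ x * f x ^ 5 * f₀ := fun x hx => by
    have := hf_pos x hx
    rw [volumeDensity_conformal]; field_simp
  have e2 : ∀ x ∈ Ω, ρ x * volumeDensity (conformalMetric f) x = ρ x * f x ^ 5 * f x :=
    fun x _ => by rw [volumeDensity_conformal]; ring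
  rw [setIntegral_congr_fun hΩm e1, setIntegral_congr_fun hΩm e2]
  refine setIntegral_mono_on (hi continuousOn_const) (hi hfc) hΩm fun x hx => ?_
  have h1 := hf_pos x hx
  have h2 := hρ x hx
  exact mul_le_mul_of_nonneg_left (hle x hx) (by positivity)
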